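/- **Setting.** A *power set* is a sequence $P=\{(p_j,m_j)\}_{j\ge 0}\subset\mathbb C\times\mathbb N$ with $(m_j)$ bounded, $\operatorname{Re}p_j\le\operatorname{Re}p_{j+1}$ and $\operatorname{Re}p_j\to\infty$; put $\mu=\max_j m_j$. It is *appropriate* if it contains $(n,0)$ for every $n\in\mathbb N=\{0,1,2,\dots\}$ and no $p_j$ is a negative integer. $\mathcal S_P(\mathbb R_+)$ is the set of smooth functions $u$ on $(0,\infty)$ which are rapidly decreasing at $\infty$ together with all derivatives and satisfy $u(x)\sim\sum_{j}\sum_{k\le m_j}a_{jk}x^{p_j}\ln^kx$ as $x\to0^+$ for some $a_{jk}\in\mathbb C$, in the sense that for all $N,k\in\mathbb N$ $$\partial_x^k\Big(u(x)-\sum_{j\le N}\sum_{l\le m_j}a_{jl}x^{p_j}\ln^lx\Big)=O\big(x^{\operatorname{Re}p_{N+1}-k}(1+|\ln x|)^{\mu}\big),\qquad x\to0^+ .$$ The extension by zero $e_+u\in\mathcal S'(\mathbb R)$ is $\sum_{j\le N}\sum_{k\le m_j}a_{jk}\,x_+^{p_j}\ln^kx$ plus the function equal to $u-\sum_{j\le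 N}\sum_{k\le m_j}a_{jk}x^{p_j}\ln^kx$ on $(0,\infty)$ and to $0$ on $(-\infty,0]$, where $N$ is so large that $\operatorname{Re}p_{N+1}>-1$; here $x_+^a=\partial_x^nx_+^{a+n}/((a+1)\cdots(a+n))$ for $\operatorname{Re}a+n>-1$, and $x_+^a\ln^kx=\partial_a^kx_+^a$. The space $\mathcal S_P(\mathbb R_-)$ and the extension $e_-u$ are obtained by the reflection $x\mapsto-x$. With $\mathcal F\varphi(\xi)=(2\pi)^{-1/2}\int e^{-ix\xi}\varphi(x)\,dx$, extended to $\mathcal S'(\mathbb R)$ by duality, let $$\mathcal H^\pm_P=\{\mathcal F[e_\pm u] : u\in\mathcal S_P(\mathbb R_\pm)\}\subset\mathcal S'(\mathbb R).$$ Write $\mathbb C_\pm=\{\pm\operatorname{Im}\zeta>0\}$, $\langle\zeta\rangle=(1+|\zeta|^2)^{1/2}$ and, for real $\xi\ne0$, $\ln(\xi\mp i0)=\lim_{\eta\to0^+}\ln(\xi\mp i\eta)$ (principal branch), $(\xi\mp i0)^w=e^{w\ln(\xi\mp i0)}$. **Theorem.** Let $P$ be an appropriate power set. A tempered distribution $H$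 on $\mathbb R$ lies in $\mathcal H^{+}_P$ (resp. $\mathcal H^-_P$) if and only if there is an analytic function $h$ on $\mathbb C_-$ (resp. $\mathbb C_+$) such that * $h(\cdot\mp i\eta)\to H$ in $\mathcal S'(\mathbb R)$ as $\eta\to0^+$, that is, $H=h(\xi\mp i0)$; * there are $m\in\mathbb N$ and $C>0$ with $|h(\zeta)|\le C\langle\zeta\rangle^m$ for all $\zeta\in\mathbb C_\mp$; * $h(\xi\mp i0)$ is a smooth function on $\mathbb R$ and there are $c_{jl}\in\mathbb C$ such that, as $|\xi|\to\infty$, $$h(\xi\mp i0)\sim\sum_{j=0}^\infty\sum_{l=0}^{m_j}c_{jl}\,(\xi\mp i0)^{-p_j-1}\ln^l(\xi\mp i0)$$ with all derivatives, i.e. for all $N,k\in\mathbb N$ the $k$-th derivative of $h(\xi\mp i0)-\sum_{j\le N}\sum_{l\le m_j}c_{jl}(\xi\mp i0)^{-p_j-1}\ln^l(\xi\mp i0)$ is $O\big(|\xi|^{-\operatorname{Re}p_{N+1}-1-k}(1+|\ln|\xi||)^{\mu}\big)$. (Upper signs for $\mathcal H^+_P$, lower signs for $\mathcal H^-_P$.)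 If $P$ has no logarithmic indices (all $m_j=0$), the last expansion reads $h(\xi\mp i0)\sim\sum_jc_j(\xi\mp i0)^{-p_j-1}$; moreover, if $u\in\mathcal S_P(\mathbb R_\pm)$ and $u(x)\sim\sum_ja_j|x|^{p_j}$ as $x\to0^\pm$, then $\mathcal F[e_\pm u]$ has this expansion with $$c_j=a_j\,\frac{\Gamma(p_j+1)}{\sqrt{2\pi}}\,e^{\mp i\pi(p_j+1)/2}.$$ Finally, for every $j$ and real $\xi\neq0$, $(\xi\mp i0)^{-p_j-1}=\xi_+^{-p_j-1}+e^{\pm i\pi(p_j+1)}\,\xi_-^{-p_j-1}$, where $\xi_+^w$ is $\xi^w$ for $\xi>0$ and $0$ for $\xi<0$, and $\xi_-^w$ is $0$ for $\xi>0$ and $|\xi|^w$ for $\xi<0$. -/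

import Mathlib

open Filter Topology Asymptotics MeasureTheory SchwartzMap
open scoped ContDiff

namespace LogPoly

noncomputable section

/-! ### Tempered distributions on the line -/

/-- `f` is (absolutely) integrable against some negative power of `1 + |x|`. -/
def SlowGrowth (f : ℝ → ℂ) : Prop :=
  ∃ K : ℕ, Integrable (fun x : ℝ => ((1 + ‖x‖) ^ K)⁻¹ • f x)

theorem SlowGrowth.exists_bound {f : ℝ → ℂ} (hf : SlowGrowth f) :
    ∃ K : ℕ, ∃ C : ℝ, 0 ≤ C ∧ ∀ φ : 𝓢(ℝ, ℂ), Integrable (fun x => φ x * f x) ∧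
      ‖∫ x, φ x * f x‖ ≤
        C * (Finset.Iic (K, 0)).sup (schwartzSeminormFamily ℂ ℝ ℂ) φ := by
  obtain ⟨K, hK⟩ := hf
  refine ⟨K, 2 ^ K * ∫ x, ‖((1 + ‖x‖) ^ K)⁻¹ • f x‖, by positivity, fun φ => ?_⟩
  set S := (Finset.Iic (K, 0)).sup (schwartzSeminormFamily ℂ ℝ ℂ) φ with hS
  have hpos : ∀ x : ℝ, 0 < (1 + ‖x‖) ^ K := fun x => by positivity
  have hb : ∀ x : ℝ, ‖((1 + ‖x‖) ^ K) • φ x‖ ≤ 2 ^ K * S := fun x => by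
    have h := SchwartzMap.one_add_le_sup_seminorm_apply (𝕜 := ℂ) (m := (K, 0))
      (le_refl K) (le_refl 0) φ x
    rw [norm_iteratedFDeriv_zero] at h
    rw [norm_smul, Real.norm_of_nonneg (hpos x).le]
    exact h
  have heq : (fun x => φ x * f x) =
      fun x => (((1 + ‖x‖) ^ K) • φ x) * (((1 + ‖x‖) ^ K)⁻¹ • f x) := by
    funext x
    rw [smul_mul_smul_comm, mul_inv_cancel₀ (hpos x).ne', one_smul]
  have hint : Integrable (fun x => φ x * f x) := by
    rw [heq]
    refine hK.bdd_mul (c := 2 ^ K * S) ?_ (Eventually.of_forall hb)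
    exact ((by fun_prop : Continuous fun x : ℝ => (1 + ‖x‖) ^ K).smul
      φ.continuous).aestronglyMeasurable
  refine ⟨hint, ?_⟩
  calc ‖∫ x, φ x * f x‖ ≤ ∫ x, ‖φ x * f x‖ := norm_integral_le_integral_norm _
    _ ≤ ∫ x, (2 ^ K * S) * ‖((1 + ‖x‖) ^ K)⁻¹ • f x‖ := by
        refine integral_mono hint.norm (hK.norm.const_mul _) fun x => ?_
        have : φ x * f x = (((1 + ‖x‖) ^ K) • φ x) * (((1 + ‖x‖) ^ K)⁻¹ • f x) :=
          congrFun heq x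
        simp only [this, norm_mul]
        exact mul_le_mul_of_nonneg_right (hb x) (norm_nonneg _)
    _ = 2 ^ K * (∫ x, ‖((1 + ‖x‖) ^ K)⁻¹ • f x‖) * S := by
        rw [integral_const_mul]; ring

/-- The continuous linear form `φ ↦ ∫ φ f` on Schwartz functions, for `f` of slow growth. -/
def SlowGrowth.toCLM {f : ℝ → ℂ} (hf : SlowGrowth f) : 𝓢(ℝ, ℂ) →L[ℂ] ℂ :=
  SchwartzMap.mkCLMtoNormedSpace (fun φ => ∫ x, φ x * f x)
    (fun φ ψ => by
      obtain ⟨K, C, hC, h⟩ := hf.exists_bound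
      simp only [_root_.add_apply, add_mul]
      exact integral_add (h φ).1 (h ψ).1)
    (fun c φ => by
      simp only [_root_.smul_apply, smul_eq_mul, mul_assoc, RingHom.id_apply]
      exact integral_const_mul _ _)
    (by
      obtain ⟨K, C, hC, h⟩ := hf.exists_bound
      exact ⟨Finset.Iic (K, 0), C, hC, fun φ => (h φ).2⟩)

open scoped Classical in
/-- The tempered distribution `φ ↦ ∫ φ f` defined by a function `f` of slow growth
(and `0` if `f` is not of slow growth). -/
def regular (f : ℝ → ℂ) : 𝓢'(ℝ, ℂ) :=
  if hf : SlowGrowth f then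
    ContinuousLinearMap.toPointwiseConvergenceCLM _ _ _ _ hf.toCLM
  else 0

theorem regular_apply {f : ℝ → ℂ} (hf : SlowGrowth f) (φ : 𝓢(ℝ, ℂ)) :
    regular f φ = ∫ x, φ x * f x := by
  rw [regular, dif_pos hf]; rfl

/-- The dilation `φ ↦ φ (· * c)` of Schwartz functions, `c ≠ 0`. -/
def dilate (c : ℝˣ) : 𝓢(ℝ, ℂ) →L[ℂ] 𝓢(ℝ, ℂ) :=
  SchwartzMap.compCLMOfContinuousLinearEquiv ℂ (ContinuousLinearEquiv.unitsEquivAut ℝ c)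

theorem dilate_apply (c : ℝˣ) (φ : 𝓢(ℝ, ℂ)) (x : ℝ) : dilate c φ x = φ (x * c) := rfl

/-- `(2π)⁻¹` as a unit of `ℝ`. -/
def invTwoPi : ℝˣ := Units.mk0 (2 * Real.pi)⁻¹ (by positivity)

/-- The Fourier transform with the unitary normalization
`(2π)^{-1/2} ∫ exp (-i x ξ) φ x dx`, on Schwartz functions; see `fourierS_apply`. -/
def fourierS : 𝓢(ℝ, ℂ) →L[ℂ] 𝓢(ℝ, ℂ) :=
  ((Real.sqrt (2 * Real.pi))⁻¹ : ℂ) •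
    (dilate invTwoPi ∘L FourierTransform.fourierCLM ℂ 𝓢(ℝ, ℂ))

theorem fourierS_apply (φ : 𝓢(ℝ, ℂ)) (ξ : ℝ) :
    fourierS φ ξ = ((Real.sqrt (2 * Real.pi))⁻¹ : ℂ) *
      ∫ x : ℝ, Complex.exp (-Complex.I * x * ξ) * φ x := by
  have h : fourierS φ ξ = ((Real.sqrt (2 * Real.pi))⁻¹ : ℂ) *
      (FourierTransform.fourier φ : 𝓢(ℝ, ℂ)) (ξ * (2 * Real.pi)⁻¹) := rfl
  rw [h, SchwartzMap.fourier_coe, Real.fourier_eq']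
  congr 1
  refine integral_congr_ae (Eventually.of_forall fun x => ?_)
  simp only [smul_eq_mul]
  congr 2
  have hpi : (Real.pi : ℂ) ≠ 0 := by exact_mod_cast Real.pi_ne_zero
  simp only [RCLike.inner_apply, conj_trivial]
  push_cast
  field_simp

/-- The Fourier transform of tempered distributions, `⟨𝓕 U, φ⟩ = ⟨U, 𝓕 φ⟩`. -/
def fourierD : 𝓢'(ℝ, ℂ) →L[ℂ] 𝓢'(ℝ, ℂ) :=
  PointwiseConvergenceCLM.precomp ℂ fourierS

/-- For a sign `σ`, the pull-back of a tempered distribution under `x ↦ σ x`. -/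
def reflect (σ : ℤˣ) : 𝓢'(ℝ, ℂ) →L[ℂ] 𝓢'(ℝ, ℂ) :=
  PointwiseConvergenceCLM.precomp ℂ (dilate (Units.map (Int.castRingHom ℝ : ℤ →* ℝ) σ))

/-! ### Power sets and functions with log-polyhomogeneous behaviour at zero -/

/-- A power set: a sequence `(p_j, m_j) ∈ ℂ × ℕ` with bounded `m_j` and with `Re p_j`
nondecreasing and tending to `∞`. -/
structure PowerSet where
  p : ℕ → ℂ
  m : ℕ → ℕ
  bddAbove_m : BddAbove (Set.range m)
  monotone_re : Monotone fun j => (p j).re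
  tendsto_re : Tendsto (fun j => (p j).re) atTop atTop

/-- The largest logarithmic index `max_j m_j`. -/
def PowerSet.logDegree (P : PowerSet) : ℕ := ⨆ j, P.m j

/-- `P` is appropriate: it contains every pair `(n, 0)`, `n ∈ ℕ`, and no `p_j` is a negative
integer. -/
structure PowerSet.IsAppropriate (P : PowerSet) : Prop where
  contains_taylor : ∀ n : ℕ, ∃ j, P.p j = n ∧ P.m j = 0
  ne_negInt : ∀ j, ∀ n : ℕ, P.p j ≠ -((n : ℂ) + 1)

/-- The partial sum `∑_{j ≤ N} ∑_{k ≤ m_j} a_{jk} x^{p_j} ln^k x` (meant for `x > 0`). -/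
def partialSumZero (P : PowerSet) (a : ℕ → ℕ → ℂ) (N : ℕ) (x : ℝ) : ℂ :=
  ∑ j ∈ Finset.range (N + 1), ∑ k ∈ Finset.range (P.m j + 1),
    a j k * (x : ℂ) ^ P.p j * (Real.log x : ℂ) ^ k

/-- `u ∼ ∑_j ∑_{k ≤ m_j} a_{jk} x^{p_j} ln^k x` as `x → 0⁺`, with all derivatives: for all
`N, k`, the `k`-th derivative of the `N`-th remainder is `O(x^{Re p_{N+1} - k})`, up to the
power `max_j m_j` of the logarithm (so without logarithms if all `m_j` vanish). -/
def HasExpansionAtZero (P : PowerSet) (u : ℝ → ℂ) (a : ℕ → ℕ → ℂ) : Prop :=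
  ∀ N k : ℕ, iteratedDeriv k (fun x => u x - partialSumZero P a N x) =O[𝓝[>] 0]
    fun x : ℝ => x ^ ((P.p (N + 1)).re - k) * (1 + |Real.log x|) ^ P.logDegree

/-- The space `𝓢_P(ℝ₊)`: `u` is smooth on `(0, ∞)`, rapidly decreasing at infinity with all its
derivatives, and has an asymptotic expansion of type `P` at `0⁺`. The values of `u` on
`(-∞, 0]` play no role. -/
structure MemSchwartzP (P : PowerSet) (u : ℝ → ℂ) : Prop where
  smooth : ContDiffOn ℝ ∞ u (Set.Ioi 0)
  decay : ∀ k l : ℕ, iteratedDeriv k u =O[atTop] fun x : ℝ => (x ^ l)⁻¹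
  expansion : ∃ a, HasExpansionAtZero P u a

/-! ### Extension by zero -/

/-- The tempered distribution `x₊^a ln^l x`, for `a ∈ ℂ` not a negative integer.
It is `∂_a^l x₊^a`, where `x₊^a = ∂_x^n x₊^{a+n} / ((a+1)⋯(a+n))` and `n` is the least natural
number with `Re a + n > -1`; the derivative in `a` is written out by the Leibniz rule. For
`Re a > -1` this is `n = 0`, and one gets the locally integrable function itself. -/
def xPosLog (a : ℂ) (l : ℕ) : 𝓢'(ℝ, ℂ) :=
  let n : ℕ := ⌊-a.re⌋₊
  ∑ i ∈ Finset.range (l + 1),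
    ((l.choose i : ℂ) *
      iteratedDeriv (l - i) (fun b : ℂ => (∏ r ∈ Finset.range n, (b + r + 1))⁻¹) a) •
      (TemperedDistribution.derivCLM ℂ)^[n]
        (regular fun x : ℝ =>
          if 0 < x then (x : ℂ) ^ (a + n) * (Real.log x : ℂ) ^ i else 0)

/-- The tempered distribution
`∑_{j ≤ N} ∑_{k ≤ m_j} a_{jk} x₊^{p_j} ln^k x + (u - ∑_{j ≤ N} ∑_{k ≤ m_j} a_{jk} x^{p_j} ln^k x)`
where the function in the last bracket is extended by zero to `(-∞, 0]`. -/
def extendPos (P : PowerSet) (u : ℝ → ℂ) (a : ℕ → ℕ → ℂ) (N : ℕ) : 𝓢'(ℝ, ℂ) :=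
  (∑ j ∈ Finset.range (N + 1), ∑ k ∈ Finset.range (P.m j + 1), a j k • xPosLog (P.p j) k) +
    regular fun x => if 0 < x then u x - partialSumZero P a N x else 0

/-- For `u ∈ 𝓢_P(ℝ_σ)`, `U` is the extension by zero `e_σ u` of `u` from the half-line `ℝ_σ` to a
tempered distribution on `ℝ`. It does not depend on the choice of the coefficients `a` and of
the number `N`, which only has to be so large that the remainder is integrable at zero. -/
def IsExtension (P : PowerSet) (σ : ℤˣ) (u : ℝ → ℂ) (U : 𝓢'(ℝ, ℂ)) : Prop :=
  ∃ (a : ℕ → ℕ → ℂ) (N : ℕ), HasExpansionAtZero P (fun x => u ((σ : ℤ) * x)) a ∧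
    -1 < (P.p (N + 1)).re ∧ U = reflect σ (extendPos P (fun x => u ((σ : ℤ) * x)) a N)

/-- The space `𝓗^σ_P` of the Fourier transforms of the extensions by zero `e_σ u`,
`u ∈ 𝓢_P(ℝ_σ)`; here `u ∈ 𝓢_P(ℝ₋)` means that `x ↦ u (-x)` is in `𝓢_P(ℝ₊)`. -/
def spaceH (P : PowerSet) (σ : ℤˣ) : Set 𝓢'(ℝ, ℂ) :=
  {H | ∃ (u : ℝ → ℂ) (U : 𝓢'(ℝ, ℂ)), MemSchwartzP P (fun x => u ((σ : ℤ) * x)) ∧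
    IsExtension P σ u U ∧ H = fourierD U}

/-! ### Boundary values and expansions at infinity -/

/-- The open half-plane `ℂ₋` for `σ = 1`, and `ℂ₊` for `σ = -1`. -/
def halfPlane (σ : ℤˣ) : Set ℂ := {ζ | ((σ : ℤ) : ℝ) * ζ.im < 0}

/-- `ln (ξ - σ i0)` for real `ξ ≠ 0`: the limit of the principal logarithm of `ξ - σ i η` as
`η → 0⁺`; see `tendsto_log_bvLog`. -/
def bvLog (σ : ℤˣ) (ξ : ℝ) : ℂ :=
  (Real.log |ξ| : ℂ) - if ξ < 0 then (σ : ℤ) * Real.pi * Complex.I else 0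

/-- `(ξ - σ i0)^w` for real `ξ ≠ 0`. -/
def bvPow (σ : ℤˣ) (w : ℂ) (ξ : ℝ) : ℂ := Complex.exp (w * bvLog σ ξ)

theorem tendsto_log_bvLog (σ : ℤˣ) {ξ : ℝ} (hξ : ξ ≠ 0) :
    Tendsto (fun η : ℝ => Complex.log (ξ - (σ : ℤ) * η * Complex.I)) (𝓝[>] 0)
      (𝓝 (bvLog σ ξ)) := by
  have hc : Tendsto (fun η : ℝ => (ξ : ℂ) - (σ : ℤ) * η * Complex.I) (𝓝[>] 0) (𝓝 (ξ : ℂ)) := by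
    have : Continuous fun η : ℝ => (ξ : ℂ) - (σ : ℤ) * η * Complex.I := by fun_prop
    simpa using (this.tendsto 0).mono_left nhdsWithin_le_nhds
  rcases lt_or_gt_of_ne hξ with h | h
  · have hre : (ξ : ℂ).re < 0 := by simpa using h
    have him : (ξ : ℂ).im = 0 := by simp
    have hb : bvLog σ ξ = Real.log ‖(ξ : ℂ)‖ - (σ : ℤ) * Real.pi * Complex.I := by
      simp [bvLog, h]
    rcases Int.units_eq_one_or σ with rfl | rfl
    · have := Complex.tendsto_log_nhdsWithin_im_neg_of_re_neg_of_im_zero hre him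
      rw [hb]
      simp only [Units.val_one, Int.cast_one, one_mul] at hc ⊢
      refine this.comp (tendsto_nhdsWithin_iff.2 ⟨hc, ?_⟩)
      filter_upwards [self_mem_nhdsWithin] with η hη
      simpa using hη
    · have := (Complex.continuousWithinAt_log_of_re_neg_of_im_zero hre him).tendsto
      have hl : Complex.log (ξ : ℂ) = bvLog (-1) ξ := by
        rw [hb, Complex.log, Complex.arg_ofReal_of_neg h]
        simp
      rw [← hl]
      refine this.comp (tendsto_nhdsWithin_iff.2 ⟨hc, ?_⟩)
      filter_upwards [self_mem_nhdsWithin] with η hη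
      have hη' : (0 : ℝ) < η := hη
      simpa using hη'.le
  · have hl : Complex.log (ξ : ℂ) = bvLog σ ξ := by
      simp [bvLog, not_lt.2 h.le, abs_of_pos h, Complex.ofReal_log h.le]
    rw [← hl]
    exact ((continuousAt_clog (by simp [Complex.mem_slitPlane_iff, h])).tendsto).comp hc

/-- `ξ₊^w` for `ξ ≠ 0`. -/
def posPow (w : ℂ) (ξ : ℝ) : ℂ := if 0 < ξ then (ξ : ℂ) ^ w else 0

/-- `ξ₋^w` for `ξ ≠ 0`. -/
def negPow (w : ℂ) (ξ : ℝ) : ℂ := if ξ < 0 then ((|ξ| : ℝ) : ℂ) ^ w else 0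

/-- `g ∼ ∑_j ∑_{l ≤ m_j} c_{jl} (ξ - σ i0)^{-p_j - 1} ln^l (ξ - σ i0)` as `|ξ| → ∞`, with all
derivatives: for all `N, k`, the `k`-th derivative of the `N`-th remainder is
`O(|ξ|^{-Re p_{N+1} - 1 - k})`, up to the power `max_j m_j` of the logarithm (so without
logarithms if all `m_j` vanish). -/
def HasExpansionAtInfinity (P : PowerSet) (σ : ℤˣ) (g : ℝ → ℂ) (c : ℕ → ℕ → ℂ) : Prop :=
  ∀ N k : ℕ, iteratedDeriv k (fun ξ => g ξ - ∑ j ∈ Finset.range (N + 1),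
      ∑ l ∈ Finset.range (P.m j + 1), c j l * bvPow σ (-P.p j - 1) ξ * bvLog σ ξ ^ l)
    =O[cocompact ℝ] fun ξ : ℝ =>
      |ξ| ^ (-(P.p (N + 1)).re - 1 - k) * (1 + |Real.log (|ξ|)|) ^ P.logDegree

/-- The tempered distribution `H` is given by the smooth function `g` on `ℝ`. -/
def IsSmoothFunction (H : 𝓢'(ℝ, ℂ)) (g : ℝ → ℂ) : Prop :=
  ContDiff ℝ ∞ g ∧ SlowGrowth g ∧ H = regular g

/-- `h(ξ - σ i0) = H`: the functions `ξ ↦ h (ξ - σ i η)` converge to `H` in `𝓢'(ℝ)` as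
`η → 0⁺`. -/
def HasBoundaryValue (σ : ℤˣ) (h : ℂ → ℂ) (H : 𝓢'(ℝ, ℂ)) : Prop :=
  (∀ η : ℝ, 0 < η → SlowGrowth fun ξ => h (ξ - (σ : ℤ) * η * Complex.I)) ∧
  Tendsto (fun η : ℝ => regular fun ξ => h (ξ - (σ : ℤ) * η * Complex.I)) (𝓝[>] 0) (𝓝 H)

/-- `h` is polynomially bounded on the half-plane. -/
def PolynomialGrowth (σ : ℤˣ) (h : ℂ → ℂ) : Prop :=
  ∃ (m : ℕ) (C : ℝ), 0 < C ∧ ∀ ζ ∈ halfPlane σ, ‖h ζ‖ ≤ C * Real.sqrt (1 + ‖ζ‖ ^ 2) ^ m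

end

end LogPoly

open LogPoly

/-! The reflection `x ↦ σ x` removes the sign, so the work is done for `u` on the positive half-line
and `h` in the lower half-plane, where `e^{-ixζ}` is bounded for `x ≥ 0`. Away from `ξ = 0` the
Fourier transform of `x₊^a ln^l x` is the symbol `(2π)^{-1/2} ∂_s^l (Γ(s) (iξ)^{-s})` at `s = a + 1`
(see `gammaPow`), that is, a power of `ξ - i0` times a polynomial of degree `l` in `ln (ξ - i0)`.

This symbol is singular at the origin, so each term is replaced by the model `x^a ln^l x · e^{-x}
∑_{n<K} x^n/n!`. The model decreases exponentially and agrees with `x^a ln^l x` at zero up to order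
`Re a + K`, apart from logarithms. Its transform `gFun` is a finite sum of symbols at `1 + iζ`:
analytic for `Im ζ < 1` and polynomially bounded for `Im ζ ≤ 0`. Taylor's formula from `1 + iξ` back
to `iξ` shows that it differs from the symbol only by a term of order `-Re a - 1 - K`
(`symAt_gFun_sub`). For `Re a > -1` the transform is a Mellin integral; smaller `Re a` are reached
by differentiating the model (`fourierD_modelDist_aux`).

Direct implication (`exists_isLowerTransform`): `u` minus sufficiently many models, extended by
zero, is `C^M` and rapidly decreasing, so its transform is smooth, is `O(|ξ|^{-M})` together with
each derivative, and continues to the lower half-plane as a Laplace integral. The numbers `N`, `K`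
and hence `M` are arbitrary, while the total transform does not depend on them; this gives the whole
expansion.

Converse (`IsLowerTransform.exists_memSchwartzP`): subtracting from `g` the transforms of the models
leaves a fast decaying boundary value of a holomorphic function. By the Paley–Wiener argument
`fourierFn_eq_zero_of_hasLowerBV` its inverse transform `f` lives on `x ≥ 0`; it is also `C^M` and
rapidly decreasing, hence `O(x^M)` at zero. Models plus `f` form the required `u`, and injectivity
of the Fourier transform shows that every `M` gives the same `u`.

The coefficients at zero and at infinity are related, for each `j`, by a triangular matrix whose
diagonal entries are nonzero multiples of `Γ(p_j + 1)`; without logarithms it is the stated scalar.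
Exponents may be repeated in `P`, so the coefficients at zero need not be unique;
`extendPos_eq_extendPos` shows that, without logarithms, the extension by zero is unaffected by the
choice. -/

namespace LogPoly

noncomputable section

/-! ### Symbol estimates -/

/-- The weight `|x|^r (1 + |log |x||)^μ`. -/
def gauge (r : ℝ) (μ : ℕ) (x : ℝ) : ℝ := |x| ^ r * (1 + |Real.log (|x|)|) ^ μ

theorem gauge_nonneg (r : ℝ) (μ : ℕ) (x : ℝ) : 0 ≤ gauge r μ x := by
  unfold gauge; positivity

theorem gauge_le_of_le {μ μ' : ℕ} (h : μ ≤ μ') (r x : ℝ) : gauge r μ x ≤ gauge r μ' x := by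
  unfold gauge
  exact mul_le_mul_of_nonneg_left (pow_le_pow_right₀ (by simp) h) (by positivity)

theorem gauge_isBigO_of_le (l : Filter ℝ) {μ μ' : ℕ} (h : μ ≤ μ') (r : ℝ) :
    gauge r μ =O[l] gauge r μ' :=
  IsBigO.of_norm_le fun x => by
    rw [Real.norm_of_nonneg (gauge_nonneg _ _ _)]
    exact gauge_le_of_le h r x

theorem gauge_mul {x : ℝ} (hx : x ≠ 0) (r r' : ℝ) (μ μ' : ℕ) :
    gauge r μ x * gauge r' μ' x = gauge (r + r') (μ + μ') x := by
  unfold gauge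
  rw [Real.rpow_add (abs_pos.2 hx), pow_add]; ring

theorem gauge_zero_right (r : ℝ) : gauge r 0 = fun x => |x| ^ r := by
  funext x; simp [gauge]

theorem eventually_one_le_abs_cocompact (c : ℝ) : ∀ᶠ x : ℝ in cocompact ℝ, c ≤ |x| :=
  (tendsto_norm_cocompact_atTop (E := ℝ)).eventually (eventually_ge_atTop c)

theorem gauge_isBigO_cocompact {r r' : ℝ} (h : r ≤ r') {μ μ' : ℕ} (hμ : μ ≤ μ') :
    gauge r μ =O[cocompact ℝ] gauge r' μ' := by
  refine (IsBigO.of_bound 1 ?_).trans (gauge_isBigO_of_le _ hμ r')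
  filter_upwards [eventually_one_le_abs_cocompact 1] with x hx
  rw [Real.norm_of_nonneg (gauge_nonneg _ _ _), Real.norm_of_nonneg (gauge_nonneg _ _ _), one_mul]
  exact mul_le_mul_of_nonneg_right (Real.rpow_le_rpow_of_exponent_le hx h) (by positivity)

theorem gauge_isBigO_zero {r r' : ℝ} (h : r' ≤ r) {μ μ' : ℕ} (hμ : μ ≤ μ') :
    gauge r μ =O[𝓝[>] 0] gauge r' μ' := by
  refine (IsBigO.of_bound 1 ?_).trans (gauge_isBigO_of_le _ hμ r')
  filter_upwards [Ioo_mem_nhdsGT (zero_lt_one' ℝ)] with x hx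
  rw [Real.norm_of_nonneg (gauge_nonneg _ _ _), Real.norm_of_nonneg (gauge_nonneg _ _ _), one_mul]
  refine mul_le_mul_of_nonneg_right ?_ (by positivity)
  rw [abs_of_pos hx.1]
  exact Real.rpow_le_rpow_of_exponent_ge hx.1 hx.2.le h

theorem one_add_abs_log_isBigO_atTop (μ : ℕ) {s : ℝ} (hs : 0 < s) :
    (fun x : ℝ => (1 + |Real.log x|) ^ μ) =O[atTop] fun x => x ^ s := by
  -- The exponent `s / (μ + 1)` stays below `s` after taking the `μ`-th power and is meaningful for
  -- `μ = 0`.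
  have h1 : (fun x : ℝ => 1 + |Real.log x|) =O[atTop] fun x => x ^ (s / (μ + 1)) := by
    have hs' : 0 < s / (μ + 1) := by positivity
    refine IsBigO.add ?_ ((isLittleO_log_rpow_atTop hs').isBigO.norm_left)
    refine IsBigO.of_bound 1 ?_
    filter_upwards [eventually_ge_atTop 1] with x hx
    have := Real.one_le_rpow hx hs'.le
    rw [norm_one, one_mul, Real.norm_of_nonneg (by linarith)]
    exact this
  refine (h1.pow μ).trans (IsBigO.of_bound 1 ?_)
  filter_upwards [eventually_ge_atTop 1] with x hx
  have hx0 : 0 < x := by linarith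
  rw [← Real.rpow_mul_natCast hx0.le, Real.norm_of_nonneg (by positivity),
    Real.norm_of_nonneg (by positivity), one_mul]
  refine Real.rpow_le_rpow_of_exponent_le hx ?_
  rw [div_mul_eq_mul_div, div_le_iff₀ (by positivity)]
  nlinarith

theorem gauge_absorb_cocompact {r r' : ℝ} (h : r < r') (μ : ℕ) :
    gauge r μ =O[cocompact ℝ] gauge r' 0 := by
  have h1 := (one_add_abs_log_isBigO_atTop μ (sub_pos.2 h)).comp_tendsto
    (tendsto_norm_cocompact_atTop (E := ℝ))
  have h2 := (isBigO_refl (fun x : ℝ => |x| ^ r) (cocompact ℝ)).mul h1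
  refine h2.trans (IsBigO.of_bound 1 ?_)
  filter_upwards [eventually_one_le_abs_cocompact 1] with x hx
  simp only [Function.comp_apply, Real.norm_eq_abs, gauge, pow_zero, mul_one, one_mul]
  rw [← Real.rpow_add (by linarith)]
  simp

theorem gauge_inv {x : ℝ} (r : ℝ) (μ : ℕ) : gauge r μ x⁻¹ = gauge (-r) μ x := by
  unfold gauge
  rw [abs_inv, Real.log_inv, abs_neg, Real.inv_rpow (abs_nonneg x), Real.rpow_neg (abs_nonneg x)]

/-- The inversion `x ↦ x⁻¹` turns the statement at `0⁺` into the one at infinity, with the exponents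
negated. -/
theorem gauge_absorb_zero {r r' : ℝ} (h : r' < r) (μ : ℕ) :
    gauge r μ =O[𝓝[>] 0] gauge r' 0 := by
  have h1 := ((gauge_absorb_cocompact (neg_lt_neg h) μ).mono atTop_le_cocompact).comp_tendsto
    tendsto_inv_nhdsGT_zero
  refine (h1.congr (fun x => ?_) fun x => ?_) <;> simp [gauge_inv]

/-- The `k`-th derivative of `f` satisfies the symbol estimate of order `r` along the filter `l`,
up to the power `μ` of the logarithm. -/
structure SymAt (l : Filter ℝ) (k : ℕ) (r : ℝ) (μ : ℕ) (f : ℝ → ℂ) : Prop where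
  -- Carried along with the bound because `iteratedDeriv` is additive only where the summands are
  -- differentiable often enough.
  smooth : ∀ᶠ x in l, ContDiffAt ℝ k f x
  bound : iteratedDeriv k f =O[l] gauge (r - k) μ

namespace SymAt

variable {l : Filter ℝ} {k : ℕ} {r : ℝ} {μ : ℕ} {f g : ℝ → ℂ}

theorem add (hf : SymAt l k r μ f) (hg : SymAt l k r μ g) :
    SymAt l k r μ (fun x => f x + g x) := by
  refine ⟨?_, (hf.bound.add hg.bound).congr' ?_ EventuallyEq.rfl⟩
  · filter_upwards [hf.smooth, hg.smooth] with x h1 h2 using h1.add h2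
  · filter_upwards [hf.smooth, hg.smooth] with x h1 h2
    exact (iteratedDeriv_add h1 h2).symm

theorem const_mul (c : ℂ) (hf : SymAt l k r μ f) : SymAt l k r μ (fun x => c * f x) := by
  refine ⟨?_, (hf.bound.const_mul_left c).congr' ?_ EventuallyEq.rfl⟩
  · filter_upwards [hf.smooth] with x h1 using contDiffAt_const.mul h1
  · exact Eventually.of_forall fun x => (iteratedDeriv_const_mul_field c f).symm

theorem sub (hf : SymAt l k r μ f) (hg : SymAt l k r μ g) :
    SymAt l k r μ (fun x => f x - g x) := by
  simpa [sub_eq_add_neg] using hf.add (hg.const_mul (-1))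

theorem zero : SymAt l k r μ (fun _ => 0) := by
  refine ⟨Eventually.of_forall fun _ => contDiffAt_const, ?_⟩
  have : iteratedDeriv k (fun _ : ℝ => (0 : ℂ)) = fun _ => 0 := by
    funext x; simp
  rw [this]; exact isBigO_zero _ _

theorem sum {ι : Type*} (s : Finset ι) {f : ι → ℝ → ℂ} (h : ∀ i ∈ s, SymAt l k r μ (f i)) :
    SymAt l k r μ (fun x => ∑ i ∈ s, f i x) := by
  classical
  induction s using Finset.induction_on with
  | empty => simpa using zero
  | insert i s hi ih =>
    simp only [Finset.sum_insert hi]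
    exact (h i (by simp)).add (ih fun j hj => h j (by simp [hj]))

theorem congr (hf : SymAt l k r μ f) (h : ∀ᶠ x in l, f =ᶠ[𝓝 x] g) : SymAt l k r μ g := by
  refine ⟨?_, hf.bound.congr' ?_ EventuallyEq.rfl⟩
  · filter_upwards [hf.smooth, h] with x h1 h2 using h1.congr_of_eventuallyEq h2.symm
  · filter_upwards [h] with x h2 using h2.iteratedDeriv_eq k

theorem mono_gauge {r' : ℝ} {μ' : ℕ} (hf : SymAt l k r μ f)
    (h : gauge (r - k) μ =O[l] gauge (r' - k) μ') : SymAt l k r' μ' f :=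
  ⟨hf.smooth, hf.bound.trans h⟩

theorem mono_zero {r' : ℝ} {μ' : ℕ} (hf : SymAt (𝓝[>] 0) k r μ f) (hr : r' ≤ r) (hμ : μ ≤ μ') :
    SymAt (𝓝[>] 0) k r' μ' f :=
  hf.mono_gauge (gauge_isBigO_zero (by linarith) hμ)

theorem mono_infty {r' : ℝ} {μ' : ℕ} (hf : SymAt (cocompact ℝ) k r μ f) (hr : r ≤ r')
    (hμ : μ ≤ μ') : SymAt (cocompact ℝ) k r' μ' f :=
  hf.mono_gauge (gauge_isBigO_cocompact (by linarith) hμ)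

theorem absorb_top {r' : ℝ} (hf : SymAt atTop k r μ f) (hr : r < r') : SymAt atTop k r' 0 f :=
  hf.mono_gauge ((gauge_absorb_cocompact (by linarith) μ).mono atTop_le_cocompact)

end SymAt

theorem SymAt.deriv {l : Filter ℝ} {k : ℕ} {r : ℝ} {μ : ℕ} {f : ℝ → ℂ}
    (hf : SymAt l (k + 1) r μ f) : SymAt l k (r - 1) μ (deriv f) := by
  refine ⟨?_, ?_⟩
  · filter_upwards [hf.smooth] with x hx
    exact hx.derivWithin (by norm_cast)
  · have := hf.bound
    rw [iteratedDeriv_succ'] at this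
    convert this using 2
    push_cast; ring

/-! ### Powers with logarithms -/

/-- The function `x^a log^l x`. -/
def powLog (a : ℂ) (l : ℕ) (x : ℝ) : ℂ := (x : ℂ) ^ a * (Real.log x : ℂ) ^ l

theorem powLog_eq_exp (a : ℂ) (l : ℕ) {x : ℝ} (hx : 0 < x) :
    powLog a l x = Complex.exp (a * (Real.log x : ℂ)) * (Real.log x : ℂ) ^ l := by
  rw [powLog, Complex.cpow_def_of_ne_zero (by exact_mod_cast hx.ne'), Complex.ofReal_log hx.le,
    mul_comm a]

theorem contDiffAt_powLog (a : ℂ) (l : ℕ) {x : ℝ} (hx : 0 < x) (n : ℕ∞ω) :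
    ContDiffAt ℝ n (powLog a l) x := by
  have hlog : ContDiffAt ℝ n (fun x : ℝ => (Real.log x : ℂ)) x :=
    Complex.ofRealCLM.contDiff.contDiffAt.comp x (Real.contDiffAt_log.2 hx.ne')
  have h : ContDiffAt ℝ n (fun x : ℝ => Complex.exp (a * (Real.log x : ℂ)) *
      (Real.log x : ℂ) ^ l) x :=
    ((contDiffAt_const.mul hlog).cexp).mul (hlog.pow l)
  refine h.congr_of_eventuallyEq ?_
  filter_upwards [eventually_gt_nhds hx] with y hy using powLog_eq_exp a l hy

theorem continuousOn_powLog (a : ℂ) (l : ℕ) : ContinuousOn (powLog a l) (Set.Ioi 0) :=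
  fun _ hx => (contDiffAt_powLog a l hx 0).continuousAt.continuousWithinAt

theorem norm_powLog (a : ℂ) (l : ℕ) {x : ℝ} (hx : 0 < x) :
    ‖powLog a l x‖ = x ^ a.re * |Real.log x| ^ l := by
  rw [powLog, norm_mul, Complex.norm_cpow_eq_rpow_re_of_pos hx, norm_pow, Complex.norm_real,
    Real.norm_eq_abs]

/-- For `l = 0` the truncated index `l - 1` is harmless, since its coefficient is `l`. -/
theorem hasDerivAt_powLog (a : ℂ) (l : ℕ) {x : ℝ} (hx : 0 < x) :
    HasDerivAt (powLog a l) (a * powLog (a - 1) l x + l * powLog (a - 1) (l - 1) x) x := by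
  have hlog : HasDerivAt (fun x : ℝ => (Real.log x : ℂ)) ((x : ℂ)⁻¹) x := by
    simpa using (Real.hasDerivAt_log hx.ne').ofReal_comp
  have h := ((hlog.const_mul a).cexp).mul (hlog.pow l)
  refine (h.congr_of_eventuallyEq ?_).congr_deriv ?_
  · filter_upwards [eventually_gt_nhds hx] with y hy using powLog_eq_exp a l hy
  · rw [powLog_eq_exp _ _ hx, powLog_eq_exp _ _ hx]
    have hx' : Complex.exp ((a - 1) * (Real.log x : ℂ)) =
        Complex.exp (a * (Real.log x : ℂ)) * (x : ℂ)⁻¹ := by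
      rw [sub_mul, Complex.exp_sub, one_mul, ← Complex.ofReal_exp, Real.exp_log hx]
      rfl
    rw [hx']
    simp only [Pi.pow_apply]
    ring

/-- The factor `φ` is included to close the induction on `k`: the derivative of `powLog a i * φ` is
a combination of three products of the same kind, two with `a - 1` in place of `a` and one with
`φ'`, of order `κ - 1`, in place of `φ`. -/
theorem iteratedDeriv_powLog_mul_isBigO {l : Filter ℝ} (hl : ∀ᶠ x in l, 0 < x) (k : ℕ) :
    ∀ (κ : ℝ) (φ : ℝ → ℂ), ContDiff ℝ ∞ φ → (∀ j, SymAt l j κ 0 φ) → ∀ (a : ℂ) (i : ℕ),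
      iteratedDeriv k (fun x => powLog a i x * φ x) =O[l] gauge (a.re + κ - k) i := by
  induction k with
  | zero =>
    intro κ φ hφ h a i
    have h0 := (h 0).bound
    simp only [iteratedDeriv_zero, CharP.cast_eq_zero, sub_zero] at h0 ⊢
    have h1 : powLog a i =O[l] gauge a.re i := by
      refine IsBigO.of_bound 1 ?_
      filter_upwards [hl] with x hx
      rw [norm_powLog a i hx, Real.norm_of_nonneg (gauge_nonneg _ _ _), one_mul, gauge,
        abs_of_pos hx]
      exact mul_le_mul_of_nonneg_left (pow_le_pow_left₀ (abs_nonneg _) (by linarith) _)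
        (by positivity)
    refine (h1.mul h0).congr' EventuallyEq.rfl ?_
    filter_upwards [hl] with x hx
    simpa using gauge_mul hx.ne' a.re κ i 0
  | succ k ih =>
    intro κ φ hφ h a i
    have hφ' : ContDiff ℝ ∞ (deriv φ) := (contDiff_infty_iff_deriv.1 hφ).2
    have h1 := (ih κ φ hφ h (a - 1) i).const_mul_left a
    have h2 := ((ih κ φ hφ h (a - 1) (i - 1)).trans
      (gauge_isBigO_of_le l (Nat.sub_le i 1) _)).const_mul_left (i : ℂ)
    have h3 := ih (κ - 1) (deriv φ) hφ' (fun j => (h (j + 1)).deriv) a i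
    have e1 : (a - 1).re + κ - (k : ℝ) = a.re + κ - ((k + 1 : ℕ) : ℝ) := by
      push_cast; simp; ring
    have e2 : a.re + (κ - 1) - (k : ℝ) = a.re + κ - ((k + 1 : ℕ) : ℝ) := by
      push_cast; ring
    rw [e1] at h1 h2
    rw [e2] at h3
    refine ((h1.add h2).add h3).congr' ?_ EventuallyEq.rfl
    filter_upwards [hl] with x hx
    rw [iteratedDeriv_succ']
    have hd : _root_.deriv (fun x => powLog a i x * φ x) =ᶠ[𝓝 x] fun x =>
        a * (powLog (a - 1) i x * φ x) + i * (powLog (a - 1) (i - 1) x * φ x) +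
          powLog a i x * deriv φ x := by
      filter_upwards [eventually_gt_nhds hx] with y hy
      have := ((hasDerivAt_powLog a i hy).mul
        ((hφ.differentiable (by simp)) y).hasDerivAt).deriv
      rw [show (fun x => powLog a i x * φ x) = powLog a i * φ from rfl, this]
      ring
    rw [hd.iteratedDeriv_eq]
    have c1 : ∀ b j, ContDiffAt ℝ k (fun x => powLog b j x * φ x) x := fun b j =>
      (contDiffAt_powLog b j hx k).mul (hφ.contDiffAt.of_le (by exact_mod_cast le_top))
    have c2 : ContDiffAt ℝ k (fun x => powLog a i x * deriv φ x) x :=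
      (contDiffAt_powLog a i hx k).mul (hφ'.contDiffAt.of_le (by exact_mod_cast le_top))
    have e3 := iteratedDeriv_add ((contDiffAt_const (c := a).mul (c1 (a - 1) i)).add
      (contDiffAt_const (c := (i : ℂ)).mul (c1 (a - 1) (i - 1)))) c2
    have e4 := iteratedDeriv_add (contDiffAt_const (c := a).mul (c1 (a - 1) i))
      (contDiffAt_const (c := (i : ℂ)).mul (c1 (a - 1) (i - 1)))
    rw [iteratedDeriv_const_mul_field, iteratedDeriv_const_mul_field] at e4
    exact (e3.trans (congrArg (· + _) e4)).symm

theorem symAt_powLog_mul {l : Filter ℝ} (hl : ∀ᶠ x in l, 0 < x) {κ : ℝ} {φ : ℝ → ℂ}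
    (hφ : ContDiff ℝ ∞ φ) (h : ∀ j, SymAt l j κ 0 φ) (a : ℂ) (i k : ℕ) :
    SymAt l k (a.re + κ) i (fun x => powLog a i x * φ x) := by
  refine ⟨?_, iteratedDeriv_powLog_mul_isBigO hl k κ φ hφ h a i⟩
  filter_upwards [hl] with x hx
  exact (contDiffAt_powLog a i hx k).mul (hφ.contDiffAt.of_le (by exact_mod_cast le_top))

theorem symAt_zero_one (j : ℕ) : SymAt (𝓝[>] 0) j 0 0 (fun _ => 1) := by
  refine ⟨Eventually.of_forall fun _ => contDiffAt_const, ?_⟩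
  cases j with
  | zero =>
    simp only [iteratedDeriv_zero, gauge_zero_right]
    exact IsBigO.of_bound 1 (Eventually.of_forall fun x => by simp)
  | succ j =>
    have : iteratedDeriv (j + 1) (fun _ : ℝ => (1 : ℂ)) = fun _ => 0 := by
      funext x; simp [iteratedDeriv_const]
    rw [this]; exact isBigO_zero _ _

theorem symAt_zero_powLog (a : ℂ) (i k : ℕ) : SymAt (𝓝[>] 0) k a.re i (powLog a i) := by
  have := symAt_powLog_mul (l := 𝓝[>] 0) self_mem_nhdsWithin contDiff_const symAt_zero_one a i k
  simpa only [add_zero, mul_one] using this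

/-! ### The truncated exponential series -/

/-- The function `e^{-x} ∑_{n < K} x^n / n!`. -/
def expTail (K : ℕ) (x : ℝ) : ℂ :=
  Complex.exp (-x) * ∑ n ∈ Finset.range K, (x : ℂ) ^ n / n.factorial

theorem contDiff_expTail (K : ℕ) {n : ℕ∞ω} : ContDiff ℝ n (expTail K) := by
  have h : ContDiff ℝ n (fun x : ℝ => (x : ℂ)) := Complex.ofRealCLM.contDiff
  exact h.neg.cexp.mul (ContDiff.sum fun i _ => (h.pow i).div_const _)

/-- The product rule telescopes: differentiating the polynomial removes its top term, and minus that
term is all that survives. -/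
theorem hasDerivAt_expTail_succ (K : ℕ) (x : ℝ) :
    HasDerivAt (expTail (K + 1)) (-(Complex.exp (-x) * ((x : ℂ) ^ K / K.factorial))) x := by
  have hx : HasDerivAt (fun x : ℝ => (x : ℂ)) 1 x := (hasDerivAt_id x).ofReal_comp
  have he : HasDerivAt (fun x : ℝ => Complex.exp (-x)) (-Complex.exp (-x)) x := by
    simpa using hx.neg.cexp
  induction K with
  | zero =>
    have : expTail (0 + 1) = fun x : ℝ => Complex.exp (-x) := by funext x; simp [expTail]
    rw [this]; simpa using he
  | succ K ih =>
    have : expTail (K + 1 + 1) = fun x : ℝ => expTail (K + 1) x +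
        Complex.exp (-x) * ((x : ℂ) ^ (K + 1) / (K + 1).factorial) := by
      funext x; simp only [expTail, Finset.sum_range_succ _ (K + 1), mul_add]
    rw [this]
    refine (ih.add (he.mul ((hx.pow (K + 1)).div_const _))).congr_deriv ?_
    have hK : (K.factorial : ℂ) ≠ 0 := by exact_mod_cast K.factorial_ne_zero
    have hK' : (K : ℂ) + 1 ≠ 0 := by exact_mod_cast K.succ_ne_zero
    rw [Nat.factorial_succ]; push_cast
    field_simp
    simp

/-- The derivative stays within the family, so the estimates at zero and at infinity become
inductions on the order of the derivative. -/
theorem deriv_expTail (K : ℕ) :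
    deriv (expTail K) = fun x => expTail (K - 1) x - expTail K x := by
  funext x
  cases K with
  | zero =>
    have : expTail 0 = fun _ => 0 := by funext x; simp [expTail]
    simp [this]
  | succ K =>
    rw [(hasDerivAt_expTail_succ K x).deriv]
    simp only [expTail, Finset.sum_range_succ, Nat.add_sub_cancel]
    ring

/-- The function is `-e^{-x}` times the remainder of the exponential series after `K` terms, hence
`O(x^K)`; its derivative is the difference of the same functions for `K - 1` and `K`. -/
theorem symAt_zero_expTail_sub_one (j : ℕ) :
    ∀ K : ℕ, SymAt (𝓝[>] 0) j K 0 (fun x => expTail K x - 1) := by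
  induction j with
  | zero =>
    intro K
    refine ⟨Eventually.of_forall fun x =>
      ((contDiff_expTail K).sub contDiff_const).contDiffAt, ?_⟩
    have h := (Complex.exp_sub_sum_range_isBigO_pow K).comp_tendsto
      (Complex.continuous_ofReal.tendsto' 0 0 rfl)
    have h2 : (fun x : ℝ => Complex.exp (-x)) =O[𝓝 0] fun _ => (1 : ℝ) := by
      have : Continuous fun x : ℝ => Complex.exp (-x) := by fun_prop
      exact (this.tendsto 0).isBigO_one ℝ
    refine ((h2.mul h.norm_right).neg_left.mono nhdsWithin_le_nhds).congr' ?_ ?_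
    · refine Eventually.of_forall fun x => ?_
      simp only [iteratedDeriv_zero, expTail, Function.comp_apply]
      have : Complex.exp (-x) * Complex.exp x = 1 := by rw [← Complex.exp_add]; simp
      linear_combination -this
    · filter_upwards with x
      simp [gauge_zero_right]
  | succ j ih =>
    intro K
    refine ⟨Eventually.of_forall fun x =>
      ((contDiff_expTail K).sub contDiff_const).contDiffAt, ?_⟩
    rw [iteratedDeriv_succ']
    cases K with
    | zero =>
      have : deriv (fun x => expTail 0 x - 1) = fun _ => 0 := by
        funext x; simp [expTail]
      rw [this]
      exact (SymAt.zero (l := 𝓝[>] 0) (k := j) (r := -1)).bound.trans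
        (gauge_isBigO_zero (by push_cast; linarith) le_rfl)
    | succ K =>
      have : deriv (fun x => expTail (K + 1) x - 1) =
          fun x => (expTail K x - 1) - (expTail (K + 1) x - 1) := by
        funext x
        rw [deriv_sub_const, deriv_expTail]; simp
      rw [this]
      have := ((ih K).sub ((ih (K + 1)).mono_zero (r' := K) (by simp) le_rfl)).bound
      convert this using 2
      push_cast; ring

theorem symAt_top_expTail (j : ℕ) :
    ∀ (κ : ℝ) (K : ℕ), SymAt atTop j κ 0 (expTail K) := by
  induction j with
  | zero =>
    intro κ K
    refine ⟨Eventually.of_forall fun x => (contDiff_expTail K).contDiffAt, ?_⟩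
    have h : ∀ n ∈ Finset.range K,
        (fun x : ℝ => Complex.exp (-x) * ((x : ℂ) ^ n / n.factorial)) =O[atTop]
          gauge κ 0 := by
      intro n _
      have h1 := (isLittleO_exp_neg_mul_rpow_atTop one_pos (κ - n)).isBigO
      have h2 : (fun x : ℝ => Complex.exp (-x)) =O[atTop] fun x : ℝ => x ^ (κ - n) := by
        refine (IsBigO.of_norm_left (f' := fun x : ℝ => Complex.exp (-x)) ?_)
        refine h1.congr_left fun x => ?_
        rw [Complex.norm_exp]; simp
      have h3 : (fun x : ℝ => (x : ℂ) ^ n / n.factorial) =O[atTop] fun x : ℝ => x ^ n := by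
        refine IsBigO.of_bound (n.factorial : ℝ)⁻¹ (Eventually.of_forall fun x => ?_)
        simp [div_eq_inv_mul]
      refine (h2.mul h3).congr' EventuallyEq.rfl ?_
      filter_upwards [eventually_gt_atTop 0] with x hx
      rw [gauge_zero_right, ← Real.rpow_natCast, ← Real.rpow_add hx]
      simp [abs_of_pos hx]
    have := IsBigO.sum h
    simp only [iteratedDeriv_zero, CharP.cast_eq_zero, sub_zero]
    refine this.congr_left fun x => ?_
    simp [expTail, Finset.mul_sum]
  | succ j ih =>
    intro κ K
    refine ⟨Eventually.of_forall fun x => (contDiff_expTail K).contDiffAt, ?_⟩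
    rw [iteratedDeriv_succ', deriv_expTail]
    have := ((ih (κ - 1) (K - 1)).sub (ih (κ - 1) K)).bound
    convert this using 2
    push_cast; ring

theorem symAt_zero_powLog_mul_expTail_sub_one (a : ℂ) (i K k : ℕ) :
    SymAt (𝓝[>] 0) k (a.re + K) i (fun x => powLog a i x * (expTail K x - 1)) :=
  symAt_powLog_mul self_mem_nhdsWithin ((contDiff_expTail K).sub contDiff_const)
    (fun j => symAt_zero_expTail_sub_one j K) a i k

theorem symAt_top_powLog_mul_expTail (a : ℂ) (i K k : ℕ) (r : ℝ) :
    SymAt atTop k r 0 (fun x => powLog a i x * expTail K x) := by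
  have := symAt_powLog_mul (eventually_gt_atTop 0) (contDiff_expTail K)
    (fun j => symAt_top_expTail j (r - 1 - a.re) K) a i k
  exact this.absorb_top (by linarith)

/-! ### Functions vanishing on the negative half-line -/

theorem iteratedDeriv_eq_zero_of_vanish {M : ℕ} {f : ℝ → ℂ} (hf : ContDiff ℝ M f)
    (h0 : ∀ x < 0, f x = 0) {j : ℕ} (hj : j ≤ M) : iteratedDeriv j f 0 = 0 := by
  have hc : Continuous (iteratedDeriv j f) := hf.continuous_iteratedDeriv j (by exact_mod_cast hj)
  have h1 : Tendsto (iteratedDeriv j f) (𝓝[<] 0) (𝓝 (iteratedDeriv j f 0)) :=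
    (hc.tendsto 0).mono_left nhdsWithin_le_nhds
  have h2 : Tendsto (iteratedDeriv j f) (𝓝[<] 0) (𝓝 0) := by
    refine tendsto_const_nhds.congr' ?_
    filter_upwards [self_mem_nhdsWithin] with x hx
    have : f =ᶠ[𝓝 x] fun _ => 0 := by
      filter_upwards [eventually_lt_nhds hx] with y hy using h0 y hy
    rw [this.iteratedDeriv_eq]; simp
  exact tendsto_nhds_unique h1 h2

/-- Descent from the derivative of order `M`, which is merely bounded: the lower derivatives vanish
at `0`, so the mean value inequality on `[0, y]` gains one power of `y` at each step down. -/
theorem exists_bound_iteratedDeriv_of_vanish {M : ℕ} {f : ℝ → ℂ} (hf : ContDiff ℝ M f)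
    (h0 : ∀ x < 0, f x = 0) (n : ℕ) :
    ∀ j, j + n = M → ∃ C, 0 ≤ C ∧ ∀ y ∈ Set.Icc (0 : ℝ) 1, ‖iteratedDeriv j f y‖ ≤ C * y ^ n := by
  induction n with
  | zero =>
    intro j hj
    have hc : Continuous (iteratedDeriv j f) :=
      hf.continuous_iteratedDeriv j (by exact_mod_cast (by omega : j ≤ M))
    obtain ⟨C, hC⟩ := isCompact_Icc.exists_bound_of_continuousOn hc.continuousOn
      (s := Set.Icc (0 : ℝ) 1)
    exact ⟨C, (norm_nonneg _).trans (hC 0 (by simp)), fun y hy => by simpa using hC y hy⟩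
  | succ n ih =>
    intro j hj
    obtain ⟨C, hC, h⟩ := ih (j + 1) (by omega)
    refine ⟨C, hC, fun y hy => ?_⟩
    have hd : Differentiable ℝ (iteratedDeriv j f) :=
      hf.differentiable_iteratedDeriv j (by exact_mod_cast (by omega : j < M))
    have := norm_image_sub_le_of_norm_deriv_le_segment' (f := iteratedDeriv j f)
      (f' := iteratedDeriv (j + 1) f) (a := 0) (b := y) (C := C * y ^ n)
      (fun x _ => by
        rw [iteratedDeriv_succ]
        exact (hd x).hasDerivAt.hasDerivWithinAt)
      (fun x hx => (h x ⟨hx.1, hx.2.le.trans hy.2⟩).trans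
        (mul_le_mul_of_nonneg_left (pow_le_pow_left₀ hx.1 hx.2.le n) hC)) y ⟨hy.1, le_rfl⟩
    rw [iteratedDeriv_eq_zero_of_vanish hf h0 (by omega), sub_zero, sub_zero] at this
    rw [pow_succ, ← mul_assoc]; exact this

theorem symAt_zero_of_vanish {M : ℕ} {f : ℝ → ℂ} (hf : ContDiff ℝ M f)
    (h0 : ∀ x < 0, f x = 0) {j : ℕ} (hj : j ≤ M) : SymAt (𝓝[>] 0) j M 0 f := by
  refine ⟨Eventually.of_forall fun x => hf.contDiffAt.of_le (by exact_mod_cast hj), ?_⟩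
  obtain ⟨C, hC, h⟩ := exists_bound_iteratedDeriv_of_vanish hf h0 (M - j) j (by omega)
  refine IsBigO.of_bound C ?_
  filter_upwards [Ioo_mem_nhdsGT (zero_lt_one' ℝ)] with x hx
  rw [Real.norm_of_nonneg (gauge_nonneg _ _ _), gauge_zero_right]
  simp only [abs_of_pos hx.1]
  rw [← Nat.cast_sub hj, Real.rpow_natCast]
  exact h x ⟨hx.1.le, hx.2.le⟩

/-! ### Functions of slow growth -/

/-- The extension by zero of a function on the positive half-line. -/
def zeroExt (q : ℝ → ℂ) (x : ℝ) : ℂ := if 0 < x then q x else 0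

theorem zeroExt_eq_indicator (q : ℝ → ℂ) : zeroExt q = Set.indicator (Set.Ioi 0) q := by
  funext x; simp [zeroExt, Set.indicator_apply]

theorem integrable_zeroExt_iff {q : ℝ → ℂ} :
    Integrable (zeroExt q) ↔ IntegrableOn q (Set.Ioi 0) := by
  rw [zeroExt_eq_indicator, integrable_indicator_iff measurableSet_Ioi]

theorem integral_mul_zeroExt (φ q : ℝ → ℂ) :
    ∫ x, φ x * zeroExt q x = ∫ x in Set.Ioi 0, φ x * q x := by
  rw [← integral_indicator measurableSet_Ioi]
  congr 1
  funext x
  by_cases h : 0 < x <;> simp [zeroExt, h]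

theorem zeroExt_add (q r : ℝ → ℂ) : zeroExt (fun x => q x + r x) = fun x => zeroExt q x + zeroExt r x := by
  funext x; by_cases h : 0 < x <;> simp [zeroExt, h]

theorem zeroExt_const_mul (c : ℂ) (q : ℝ → ℂ) :
    zeroExt (fun x => c * q x) = fun x => c * zeroExt q x := by
  funext x; by_cases h : 0 < x <;> simp [zeroExt, h]

theorem zeroExt_sum {ι : Type*} (s : Finset ι) (q : ι → ℝ → ℂ) :
    zeroExt (fun x => ∑ i ∈ s, q i x) = fun x => ∑ i ∈ s, zeroExt (q i) x := by
  funext x; by_cases h : 0 < x <;> simp [zeroExt, h]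

theorem integrable_zeroExt {q : ℝ → ℂ} (hq : ContinuousOn q (Set.Ioi 0)) {r s : ℝ} {μ ν : ℕ}
    (hr : -1 < r) (h0 : q =O[𝓝[>] 0] gauge r μ) (hs : s < -1) (h1 : q =O[atTop] gauge s ν) :
    Integrable (zeroExt q) := by
  rw [integrable_zeroExt_iff]
  obtain ⟨r', hr1, hr2⟩ := exists_between hr
  obtain ⟨s', hs1, hs2⟩ := exists_between hs
  have h0' : q =O[𝓝[>] 0] fun x => x ^ (-(-r')) := by
    refine (h0.trans (gauge_absorb_zero hr2 μ)).congr' EventuallyEq.rfl ?_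
    filter_upwards [self_mem_nhdsWithin] with x hx
    have hx : 0 < x := hx
    simp [gauge_zero_right, abs_of_pos hx]
  have h1' : q =O[atTop] fun x => x ^ (-(-s')) := by
    refine (h1.trans ((gauge_absorb_cocompact hs1 ν).mono atTop_le_cocompact)).congr'
      EventuallyEq.rfl ?_
    filter_upwards [eventually_gt_atTop 0] with x hx
    simp [gauge_zero_right, abs_of_pos hx]
  -- At `s = 1` the Mellin integral is the plain integral of `q`. The intermediate exponents `r'`
  -- and `s'` have absorbed the logarithms.
  have := mellinConvergent_of_isBigO_rpow (s := 1)
    (hq.locallyIntegrableOn measurableSet_Ioi) h1' (by simp; linarith) h0' (by simp; linarith)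
  simpa [MellinConvergent] using this

theorem SlowGrowth.aestronglyMeasurable {f : ℝ → ℂ} (hf : SlowGrowth f) :
    AEStronglyMeasurable f volume := by
  obtain ⟨K, hK⟩ := hf
  have h := ((by fun_prop : Continuous fun x : ℝ => (1 + ‖x‖) ^ K).aestronglyMeasurable
    (μ := volume)).smul hK.aestronglyMeasurable
  refine h.congr (Eventually.of_forall fun x => ?_)
  simp only [Pi.smul_apply']
  rw [smul_smul, mul_inv_cancel₀ (by positivity), one_smul]

theorem norm_inv_weight (K : ℕ) (x : ℝ) : ‖((1 + ‖x‖) ^ K)⁻¹‖ = ((1 + ‖x‖) ^ K)⁻¹ :=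
  Real.norm_of_nonneg (by positivity)

theorem SlowGrowth.mono_exponent {f : ℝ → ℂ} {K K' : ℕ} (h : K ≤ K')
    (hf : Integrable (fun x : ℝ => ((1 + ‖x‖) ^ K)⁻¹ • f x)) :
    Integrable (fun x : ℝ => ((1 + ‖x‖) ^ K')⁻¹ • f x) := by
  have hm := SlowGrowth.aestronglyMeasurable ⟨K, hf⟩
  refine hf.mono ?_ (Eventually.of_forall fun x => ?_)
  · have : Continuous fun x : ℝ => ((1 + ‖x‖) ^ K')⁻¹ :=
      Continuous.inv₀ (by fun_prop) fun x => by positivity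
    exact this.aestronglyMeasurable.smul hm
  · rw [norm_smul, norm_smul]
    refine mul_le_mul_of_nonneg_right ?_ (norm_nonneg _)
    rw [norm_inv_weight, norm_inv_weight]
    exact inv_anti₀ (by positivity) (pow_le_pow_right₀ (by simp) h)

theorem SlowGrowth.add {f g : ℝ → ℂ} (hf : SlowGrowth f) (hg : SlowGrowth g) :
    SlowGrowth fun x => f x + g x := by
  obtain ⟨K, hK⟩ := hf
  obtain ⟨K', hK'⟩ := hg
  refine ⟨max K K', ?_⟩
  simp only [smul_add]
  exact (SlowGrowth.mono_exponent (le_max_left _ _) hK).add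
    (SlowGrowth.mono_exponent (le_max_right _ _) hK')

theorem SlowGrowth.const_mul {f : ℝ → ℂ} (c : ℂ) (hf : SlowGrowth f) :
    SlowGrowth fun x => c * f x := by
  obtain ⟨K, hK⟩ := hf
  refine ⟨K, (hK.const_mul c).congr (Eventually.of_forall fun x => ?_)⟩
  simp only [Complex.real_smul]; ring

theorem SlowGrowth.sub {f g : ℝ → ℂ} (hf : SlowGrowth f) (hg : SlowGrowth g) :
    SlowGrowth fun x => f x - g x := by
  simpa [sub_eq_add_neg] using hf.add (hg.const_mul (-1))

theorem slowGrowth_of_integrable {f : ℝ → ℂ} (hf : Integrable f) : SlowGrowth f :=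
  ⟨0, by simpa using hf⟩

theorem SlowGrowth.sum {ι : Type*} (s : Finset ι) {f : ι → ℝ → ℂ}
    (h : ∀ i ∈ s, SlowGrowth (f i)) : SlowGrowth fun x => ∑ i ∈ s, f i x := by
  classical
  induction s using Finset.induction_on with
  | empty => exact slowGrowth_of_integrable (integrable_zero ℝ ℂ volume)
  | insert i s hi ih =>
    simp only [Finset.sum_insert hi]
    exact (h i (by simp)).add (ih fun j hj => h j (by simp [hj]))

theorem slowGrowth_of_bound {f : ℝ → ℂ} (hf : AEStronglyMeasurable f volume) {C : ℝ} {m : ℕ}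
    (h : ∀ x, ‖f x‖ ≤ C * (1 + ‖x‖) ^ m) : SlowGrowth f := by
  refine ⟨m + 2, ?_⟩
  have hC : 0 ≤ C := by
    have := (norm_nonneg _).trans (h 0)
    simpa using this
  have hi : Integrable fun x : ℝ => C * (1 + ‖x‖) ^ (-(2 : ℝ)) :=
    (integrable_one_add_norm (by simp)).const_mul C
  refine hi.mono' ?_ (Eventually.of_forall fun x => ?_)
  · have : Continuous fun x : ℝ => ((1 + ‖x‖) ^ (m + 2))⁻¹ :=
      Continuous.inv₀ (by fun_prop) fun x => by positivity
    exact this.aestronglyMeasurable.smul hf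
  · rw [norm_smul, Real.norm_of_nonneg (by positivity),
      Real.rpow_neg (by positivity), Real.rpow_ofNat]
    calc ((1 + ‖x‖) ^ (m + 2))⁻¹ * ‖f x‖ ≤ ((1 + ‖x‖) ^ (m + 2))⁻¹ * (C * (1 + ‖x‖) ^ m) :=
          mul_le_mul_of_nonneg_left (h x) (by positivity)
      _ = C * ((1 + ‖x‖) ^ 2)⁻¹ := by
        have : (1 + ‖x‖) ≠ 0 := by positivity
        field_simp
        ring

theorem slowGrowth_zeroExt {q : ℝ → ℂ} (hq : ContinuousOn q (Set.Ioi 0)) {r s : ℝ} {μ ν : ℕ}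
    (hr : -1 < r) (h0 : q =O[𝓝[>] 0] gauge r μ) (h1 : q =O[atTop] gauge s ν) :
    SlowGrowth (zeroExt q) := by
  obtain ⟨K, hK⟩ := exists_nat_gt (s + 2)
  refine ⟨K, ?_⟩
  have hw : Continuous fun x : ℝ => (((1 + ‖x‖) ^ K)⁻¹ : ℂ) :=
    Continuous.inv₀ (by fun_prop) fun x => by
      have : (0 : ℝ) < (1 + ‖x‖) ^ K := by positivity
      exact_mod_cast this.ne'
  have hn : ∀ x : ℝ, ‖(((1 + ‖x‖) ^ K)⁻¹ : ℂ)‖ = ((1 + ‖x‖) ^ K)⁻¹ := fun x => by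
    rw [norm_inv, norm_pow]
    congr 2
    rw [show (1 + (‖x‖ : ℂ)) = ((1 + ‖x‖ : ℝ) : ℂ) by push_cast; rfl, Complex.norm_real,
      Real.norm_of_nonneg (by positivity)]
  have : Integrable (zeroExt fun x => (((1 + ‖x‖) ^ K)⁻¹ : ℂ) * q x) := by
    refine integrable_zeroExt (hw.continuousOn.mul hq) hr (μ := μ) (s := s - K) (ν := ν) ?_
      (by linarith) ?_
    · refine (IsBigO.of_bound 1 (Eventually.of_forall fun x => ?_)).trans h0
      rw [norm_mul, hn]
      exact mul_le_mul_of_nonneg_right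
        (inv_le_one_of_one_le₀ (one_le_pow₀ (by simp))) (norm_nonneg _)
    · have h2 : (fun x : ℝ => (((1 + ‖x‖) ^ K)⁻¹ : ℂ)) =O[atTop] gauge (-K) 0 := by
        refine IsBigO.of_bound 1 ?_
        filter_upwards [eventually_gt_atTop 0] with x hx
        rw [hn, Real.norm_of_nonneg (gauge_nonneg _ _ _), gauge_zero_right]
        simp only [abs_of_pos hx]
        rw [Real.rpow_neg hx.le, Real.rpow_natCast, one_mul, Real.norm_of_nonneg hx.le]
        exact inv_anti₀ (by positivity) (pow_le_pow_left₀ hx.le (by linarith) K)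
      refine (h2.mul h1).congr' EventuallyEq.rfl ?_
      filter_upwards [eventually_gt_atTop 0] with x hx
      rw [gauge_mul hx.ne']
      congr 1 <;> ring
  refine this.congr (Eventually.of_forall fun x => ?_)
  by_cases h : 0 < x <;> simp [zeroExt, h]

theorem SlowGrowth.locallyIntegrable {f : ℝ → ℂ} (hf : SlowGrowth f) : LocallyIntegrable f := by
  obtain ⟨K, hK⟩ := hf
  have h := hK.locallyIntegrable.continuous_smul
    (by fun_prop : Continuous fun x : ℝ => (1 + ‖x‖) ^ K)
  refine h.congr (Eventually.of_forall fun x => ?_)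
  beta_reduce
  rw [smul_smul, mul_inv_cancel₀ (by positivity), one_smul]

theorem SlowGrowth.integrable_mul {f : ℝ → ℂ} (hf : SlowGrowth f) (φ : 𝓢(ℝ, ℂ)) :
    Integrable fun x => φ x * f x :=
  let ⟨_, _, _, h⟩ := hf.exists_bound
  (h φ).1

/-! ### Regular distributions -/

theorem regular_add {f g : ℝ → ℂ} (hf : SlowGrowth f) (hg : SlowGrowth g) :
    regular (fun x => f x + g x) = regular f + regular g := by
  ext φ
  rw [add_apply, regular_apply (hf.add hg), regular_apply hf, regular_apply hg,
    ← integral_add (hf.integrable_mul φ) (hg.integrable_mul φ)]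
  simp only [mul_add]

theorem regular_const_mul {f : ℝ → ℂ} (c : ℂ) (hf : SlowGrowth f) :
    regular (fun x => c * f x) = c • regular f := by
  ext φ
  rw [smul_apply, regular_apply (hf.const_mul c), regular_apply hf, smul_eq_mul,
    ← integral_const_mul]
  congr 1; funext x; ring

theorem regular_sub {f g : ℝ → ℂ} (hf : SlowGrowth f) (hg : SlowGrowth g) :
    regular (fun x => f x - g x) = regular f - regular g := by
  ext φ
  rw [sub_apply, regular_apply (hf.sub hg), regular_apply hf, regular_apply hg,
    ← integral_sub (hf.integrable_mul φ) (hg.integrable_mul φ)]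
  simp only [mul_sub]

theorem regular_zero : regular (fun _ => 0) = 0 := by
  have h : SlowGrowth fun _ => 0 := slowGrowth_of_integrable (integrable_zero ℝ ℂ volume)
  ext φ
  rw [regular_apply h]; simp

theorem regular_sum {ι : Type*} (s : Finset ι) {f : ι → ℝ → ℂ} (h : ∀ i ∈ s, SlowGrowth (f i)) :
    regular (fun x => ∑ i ∈ s, f i x) = ∑ i ∈ s, regular (f i) := by
  classical
  induction s using Finset.induction_on with
  | empty => simpa using regular_zero
  | insert i s hi ih =>
    simp only [Finset.sum_insert hi]
    rw [regular_add (h i (by simp)) (SlowGrowth.sum s fun j hj => h j (by simp [hj])),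
      ih fun j hj => h j (by simp [hj])]

theorem ae_eq_of_regular_eq {f g : ℝ → ℂ} (hf : SlowGrowth f) (hg : SlowGrowth g)
    (h : regular f = regular g) : f =ᵐ[volume] g := by
  have hd : SlowGrowth fun x => f x - g x := hf.sub hg
  have h0 : ∀ φ : 𝓢(ℝ, ℂ), ∫ x, φ x * (f x - g x) = 0 := fun φ => by
    rw [← regular_apply hd, regular_sub hf hg, h, sub_self]; rfl
  have := ae_eq_zero_of_integral_contDiff_smul_eq_zero hd.locallyIntegrable
    fun ψ hψ hψc => by
      have hc : HasCompactSupport fun x => (ψ x : ℂ) :=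
        hψc.comp_left (g := ((↑) : ℝ → ℂ)) Complex.ofReal_zero
      exact h0 (hc.toSchwartzMap (Complex.ofRealCLM.contDiff.comp hψ))
  filter_upwards [this] with x hx using sub_eq_zero.1 hx

theorem eq_of_regular_eq {f g : ℝ → ℂ} (hf : SlowGrowth f) (hg : SlowGrowth g)
    (hfc : Continuous f) (hgc : Continuous g) (h : regular f = regular g) : f = g :=
  (hfc.ae_eq_iff_eq volume hgc).1 (ae_eq_of_regular_eq hf hg h)

theorem eqOn_of_regular_zeroExt_eq {f g : ℝ → ℂ} (hf : SlowGrowth (zeroExt f))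
    (hg : SlowGrowth (zeroExt g)) (hfc : ContinuousOn f (Set.Ioi 0))
    (hgc : ContinuousOn g (Set.Ioi 0)) (h : regular (zeroExt f) = regular (zeroExt g)) :
    Set.EqOn f g (Set.Ioi 0) := by
  refine Measure.eqOn_open_of_ae_eq (μ := volume) ?_ isOpen_Ioi hfc hgc
  rw [EventuallyEq, ae_restrict_iff' measurableSet_Ioi]
  filter_upwards [ae_eq_of_regular_eq hf hg h] with x hx hx0
  have hx0 : 0 < x := hx0
  simpa [zeroExt, hx0] using hx

/-- Integration by parts on the half-line. The limit `0` of `q` at the origin excludes a point mass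
there; the boundary term at infinity vanishes because the product and its derivative are integrable.
-/
theorem derivCLM_regular_zeroExt {q q' : ℝ → ℂ} (hd : ∀ x ∈ Set.Ioi 0, HasDerivAt q (q' x) x)
    (hq : SlowGrowth (zeroExt q)) (hq' : SlowGrowth (zeroExt q'))
    (h0 : Tendsto q (𝓝[>] 0) (𝓝 0)) :
    TemperedDistribution.derivCLM ℂ (regular (zeroExt q)) = regular (zeroExt q') := by
  ext φ
  rw [TemperedDistribution.derivCLM_apply_apply, regular_apply hq, regular_apply hq',
    integral_mul_zeroExt, integral_mul_zeroExt]
  have hi : ∀ (ψ : 𝓢(ℝ, ℂ)) {f : ℝ → ℂ}, SlowGrowth (zeroExt f) →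
      IntegrableOn (fun x => ψ x * f x) (Set.Ioi 0) := fun ψ f hf => by
    rw [← integrable_zeroExt_iff]
    refine (hf.integrable_mul ψ).congr (Eventually.of_forall fun x => ?_)
    by_cases h : 0 < x <;> simp [zeroExt, h]
  have h1 := hi φ hq'
  have h2 : IntegrableOn (fun x => deriv φ x * q x) (Set.Ioi 0) :=
    hi (SchwartzMap.derivCLM ℂ ℂ φ) hq
  have hder : ∀ x ∈ Set.Ioi (0 : ℝ),
      HasDerivAt (fun x => φ x * q x) (deriv φ x * q x + φ x * q' x) x := fun x hx =>
    (φ.hasDerivAt x).mul (hd x hx)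
  have htop := tendsto_zero_of_hasDerivAt_of_integrableOn_Ioi hder (h2.add h1) (hi φ hq)
  have hbot : Tendsto ((φ : ℝ → ℂ) * q) (𝓝[>] 0) (𝓝 0) := by
    have := ((φ.continuous.tendsto 0).mono_left (nhdsWithin_le_nhds (s := Set.Ioi 0))).mul h0
    rwa [mul_zero] at this
  have := integral_Ioi_mul_deriv_eq_deriv_mul (fun x _ => φ.hasDerivAt x) hd h1 h2 hbot htop
  rw [this, sub_zero, zero_sub, ← integral_neg]
  congr 1; funext x
  simp

/-! ### The Fourier transform of functions -/

/-- The bilinear form `(x, ξ) ↦ x ξ / (2π)`. -/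
def scaledMul : ℝ →L[ℝ] ℝ →L[ℝ] ℝ := (2 * Real.pi)⁻¹ • ContinuousLinearMap.mul ℝ ℝ

theorem scaledMul_apply (x ξ : ℝ) : scaledMul x ξ = (2 * Real.pi)⁻¹ * (x * ξ) := by
  simp [scaledMul]

/-- The Fourier transform with unitary normalization. -/
def fourierFn (f : ℝ → ℂ) (ξ : ℝ) : ℂ :=
  ((Real.sqrt (2 * Real.pi))⁻¹ : ℂ) * ∫ x : ℝ, Complex.exp (-Complex.I * x * ξ) * f x

theorem scaledMul_toLinearMap₁₂_apply (x ξ : ℝ) :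
    scaledMul.toLinearMap₁₂ x ξ = (2 * Real.pi)⁻¹ * (x * ξ) :=
  scaledMul_apply x ξ

/-- The pairing `x ξ / (2π)` turns the standard character into `e^{-ixξ}`, so general results on
`VectorFourier.fourierIntegral` apply to `fourierFn` without changes of variables. -/
theorem vectorFourier_scaledMul (f : ℝ → ℂ) (ξ : ℝ) :
    VectorFourier.fourierIntegral Real.fourierChar volume scaledMul.toLinearMap₁₂ f ξ =
      ∫ x : ℝ, Complex.exp (-Complex.I * x * ξ) * f x := by
  rw [VectorFourier.fourierIntegral]
  congr 1; funext x
  rw [Circle.smul_def, Real.fourierChar_apply, smul_eq_mul]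
  congr 2
  have hpi : (Real.pi : ℂ) ≠ 0 := by exact_mod_cast Real.pi_ne_zero
  simp only [scaledMul_toLinearMap₁₂_apply]
  push_cast
  field_simp

theorem fourierFn_eq (f : ℝ → ℂ) : fourierFn f = fun ξ => ((Real.sqrt (2 * Real.pi))⁻¹ : ℂ) *
    VectorFourier.fourierIntegral Real.fourierChar volume scaledMul.toLinearMap₁₂ f ξ := by
  funext ξ; rw [vectorFourier_scaledMul, fourierFn]

theorem fourierS_eq_fourierFn (φ : 𝓢(ℝ, ℂ)) (ξ : ℝ) : fourierS φ ξ = fourierFn φ ξ :=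
  fourierS_apply φ ξ

theorem norm_fourierFn_le (f : ℝ → ℂ) (ξ : ℝ) :
    ‖fourierFn f ξ‖ ≤ ‖((Real.sqrt (2 * Real.pi))⁻¹ : ℂ)‖ * ∫ x, ‖f x‖ := by
  rw [fourierFn, norm_mul]
  refine mul_le_mul_of_nonneg_left ((norm_integral_le_integral_norm _).trans_eq ?_) (norm_nonneg _)
  congr 1; funext x
  rw [norm_mul, Complex.norm_exp]; simp

theorem continuous_fourierFn {f : ℝ → ℂ} (hf : Integrable f) : Continuous (fourierFn f) := by
  rw [fourierFn_eq]
  refine continuous_const.mul (VectorFourier.fourierIntegral_continuous Real.continuous_fourierChar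
    ?_ hf)
  exact (by simp only [scaledMul_toLinearMap₁₂_apply]; fun_prop)

theorem slowGrowth_fourierFn {f : ℝ → ℂ} (hf : Integrable f) : SlowGrowth (fourierFn f) :=
  slowGrowth_of_bound (continuous_fourierFn hf).aestronglyMeasurable (m := 0)
    fun x => by simpa using norm_fourierFn_le f x

theorem integral_fourierFn_mul {f g : ℝ → ℂ} (hf : Integrable f) (hg : Integrable g) :
    ∫ x, fourierFn f x * g x = ∫ x, f x * fourierFn g x := by
  have h := VectorFourier.integral_fourierIntegral_smul_eq_flip (f := f) (g := g)
    (μ := volume) (ν := volume) (L := scaledMul.toLinearMap₁₂) Real.continuous_fourierChar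
    (by simp only [scaledMul_toLinearMap₁₂_apply]; fun_prop) hf hg
  have hflip : scaledMul.toLinearMap₁₂.flip = scaledMul.toLinearMap₁₂ := by
    ext; simp
  rw [hflip] at h
  simp only [fourierFn_eq, smul_eq_mul] at h ⊢
  calc _ = ((Real.sqrt (2 * Real.pi))⁻¹ : ℂ) * ∫ x, VectorFourier.fourierIntegral Real.fourierChar
        volume scaledMul.toLinearMap₁₂ f x * g x := by
        rw [← integral_const_mul]; congr 1; funext x; ring
    _ = _ := by rw [h, ← integral_const_mul]; congr 1; funext x; ring

theorem fourierD_apply (U : 𝓢'(ℝ, ℂ)) (φ : 𝓢(ℝ, ℂ)) : fourierD U φ = U (fourierS φ) := rfl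

theorem fourierD_regular {f : ℝ → ℂ} (hf : Integrable f) :
    fourierD (regular f) = regular (fourierFn f) := by
  ext φ
  rw [fourierD_apply, regular_apply (slowGrowth_of_integrable hf),
    regular_apply (slowGrowth_fourierFn hf), ← integral_fourierFn_mul φ.integrable hf]
  simp only [fourierS_eq_fourierFn]

theorem hasTemperateGrowth_ofReal : Function.HasTemperateGrowth (fun x : ℝ => (x : ℂ)) := by
  fun_prop

theorem derivCLM_fourierS (φ : 𝓢(ℝ, ℂ)) :
    SchwartzMap.derivCLM ℂ ℂ (fourierS φ) =
      fourierS ((-Complex.I) • SchwartzMap.smulLeftCLM ℂ (fun x : ℝ => (x : ℂ)) φ) := by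
  set ψ := SchwartzMap.smulLeftCLM ℂ (fun x : ℝ => (x : ℂ)) φ with hψ
  have hψx : ∀ x, ψ x = x * φ x := fun x => by
    rw [hψ, SchwartzMap.smulLeftCLM_apply_apply hasTemperateGrowth_ofReal, smul_eq_mul]
  ext ξ
  rw [SchwartzMap.derivCLM_apply]
  have h1 : Integrable fun x : ℝ => x • φ x := by
    refine ψ.integrable.congr (Eventually.of_forall fun x => ?_)
    rw [hψx]; rfl
  have h2 := Real.hasDerivAt_fourier φ.integrable h1 (ξ * (2 * Real.pi)⁻¹)
  have h3 := (h2.scomp ξ ((hasDerivAt_id ξ).mul_const (2 * Real.pi)⁻¹)).const_mul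
    ((Real.sqrt (2 * Real.pi))⁻¹ : ℂ)
  have h4 : (fourierS φ : ℝ → ℂ) = fun ξ => ((Real.sqrt (2 * Real.pi))⁻¹ : ℂ) *
      (FourierTransform.fourier (φ : ℝ → ℂ)) (ξ * (2 * Real.pi)⁻¹) := by
    funext ξ
    rw [← SchwartzMap.fourier_coe]; rfl
  rw [h4]
  refine (HasDerivAt.deriv h3).trans ?_
  rw [map_smul, smul_apply]
  have h5 : fourierS ψ ξ = ((Real.sqrt (2 * Real.pi))⁻¹ : ℂ) *
      (FourierTransform.fourier (ψ : ℝ → ℂ)) (ξ * (2 * Real.pi)⁻¹) := by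
    rw [← SchwartzMap.fourier_coe]; rfl
  rw [h5, show (fun x : ℝ => (-2 * (Real.pi : ℂ) * Complex.I * x) • φ x) =
    (-2 * (Real.pi : ℂ) * Complex.I) • (ψ : ℝ → ℂ) by
      funext x; simp only [Pi.smul_apply, hψx, smul_eq_mul]; ring]
  have h6 : FourierTransform.fourier ((-2 * (Real.pi : ℂ) * Complex.I) • (ψ : ℝ → ℂ))
      (ξ * (2 * Real.pi)⁻¹) = (-2 * (Real.pi : ℂ) * Complex.I) *
        FourierTransform.fourier (ψ : ℝ → ℂ) (ξ * (2 * Real.pi)⁻¹) := by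
    rw [Real.fourier_eq, Real.fourier_eq, ← integral_const_mul]
    congr 1; funext v
    simp only [Pi.smul_apply, Circle.smul_def, smul_eq_mul]
    ring
  rw [h6]
  simp only [smul_eq_mul, one_mul, Complex.real_smul]
  have hpi : (Real.pi : ℂ) ≠ 0 := by exact_mod_cast Real.pi_ne_zero
  push_cast
  field_simp

theorem SlowGrowth.mul_id {G : ℝ → ℂ} (hG : SlowGrowth G) : SlowGrowth fun ξ : ℝ => (ξ : ℂ) * G ξ := by
  have hm := hG.aestronglyMeasurable
  obtain ⟨K, hK⟩ := hG
  refine ⟨K + 1, hK.mono ?_ (Eventually.of_forall fun x => ?_)⟩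
  · have : Continuous fun x : ℝ => ((1 + ‖x‖) ^ (K + 1))⁻¹ :=
      Continuous.inv₀ (by fun_prop) fun x => by positivity
    exact this.aestronglyMeasurable.smul (Complex.continuous_ofReal.aestronglyMeasurable.mul hm)
  · rw [norm_smul, norm_smul, norm_mul, Complex.norm_real, ← mul_assoc]
    refine mul_le_mul_of_nonneg_right ?_ (norm_nonneg _)
    rw [norm_inv_weight, norm_inv_weight, pow_succ, mul_inv, mul_assoc]
    refine mul_le_of_le_one_right (by positivity) ?_
    rw [inv_mul_le_one₀ (by positivity)]
    linarith

theorem fourierD_derivCLM {V : 𝓢'(ℝ, ℂ)} {G : ℝ → ℂ} (hG : SlowGrowth G)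
    (h : fourierD V = regular G) :
    fourierD (TemperedDistribution.derivCLM ℂ V) =
      regular fun ξ => Complex.I * ((ξ : ℂ) * G ξ) := by
  ext φ
  rw [fourierD_apply, TemperedDistribution.derivCLM_apply_apply, derivCLM_fourierS, ← map_neg,
    ← neg_smul, neg_neg, ← fourierD_apply, h, regular_apply hG,
    regular_apply (hG.mul_id.const_mul _)]
  congr 1; funext x
  rw [smul_apply, SchwartzMap.smulLeftCLM_apply_apply hasTemperateGrowth_ofReal,
    smul_eq_mul, smul_eq_mul]
  ring

theorem dilate_dilate_inv (c : ℝˣ) (φ : 𝓢(ℝ, ℂ)) : dilate c (dilate c⁻¹ φ) = φ := by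
  ext x
  rw [dilate_apply, dilate_apply, mul_assoc, ← Units.val_mul, mul_inv_cancel, Units.val_one,
    mul_one]

theorem fourierS_surjective : Function.Surjective fourierS := fun ψ => by
  have hc : ((Real.sqrt (2 * Real.pi))⁻¹ : ℂ) ≠ 0 := by
    refine inv_ne_zero ?_
    exact_mod_cast (Real.sqrt_pos.2 (by positivity)).ne'
  set χ := ((Real.sqrt (2 * Real.pi))⁻¹ : ℂ)⁻¹ • dilate invTwoPi⁻¹ ψ with hχ
  refine ⟨FourierTransformInv.fourierInv χ, ?_⟩
  change ((Real.sqrt (2 * Real.pi))⁻¹ : ℂ) • dilate invTwoPi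
    (FourierTransform.fourier (FourierTransformInv.fourierInv χ)) = ψ
  rw [FourierTransform.fourier_fourierInv_eq, hχ, map_smul, dilate_dilate_inv, smul_smul,
    mul_inv_cancel₀ hc, one_smul]

theorem fourierD_injective : Function.Injective fourierD := fun U V h => by
  ext ψ
  obtain ⟨φ, rfl⟩ := fourierS_surjective ψ
  rw [← fourierD_apply, ← fourierD_apply, h]

/-! ### Laplace transforms -/

theorem differentiableOn_laplace {q : ℝ → ℂ}
    (h : ∀ δ : ℝ, 0 < δ → IntegrableOn (fun x : ℝ => Complex.exp (-(δ * x)) * q x) (Set.Ioi 0)) :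
    DifferentiableOn ℂ (fun z => ∫ x in Set.Ioi (0 : ℝ), Complex.exp (-(z * x)) * q x)
      {z | 0 < z.re} := by
  intro z₀ hz₀
  have hz₀ : 0 < z₀.re := hz₀
  refine DifferentiableAt.differentiableWithinAt ?_
  -- On the ball of radius `δ` around `z₀` one has `Re z ≥ 2δ`: one factor `e^{-δx}` secures
  -- integrability, the other absorbs the `x` coming from the derivative, since `x e^{-δx} ≤ δ⁻¹`.
  set δ := z₀.re / 4 with hδ
  have hδ0 : 0 < δ := by positivity
  have hmeas : ∀ z : ℂ, AEStronglyMeasurable (fun x : ℝ => Complex.exp (-(z * x)) * q x)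
      (volume.restrict (Set.Ioi 0)) := fun z => by
    have h1 := (h δ hδ0).aestronglyMeasurable
    have h2 : Continuous fun x : ℝ => Complex.exp (-((z - δ) * x)) := by fun_prop
    refine (h2.aestronglyMeasurable.mul h1).congr (Eventually.of_forall fun x => ?_)
    simp only [Pi.mul_apply]
    rw [← mul_assoc, ← Complex.exp_add]
    congr 2; ring
  have hnorm : ∀ (z : ℂ) (x : ℝ), ‖Complex.exp (-(z * x))‖ = Real.exp (-(z.re * x)) := fun z x => by
    rw [Complex.norm_exp]; simp
  have hint : ∀ z : ℂ, δ < z.re → IntegrableOn (fun x : ℝ => Complex.exp (-(z * x)) * q x)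
      (Set.Ioi 0) := fun z hz => by
    refine Integrable.mono (h δ hδ0) (hmeas z) ?_
    filter_upwards [ae_restrict_mem measurableSet_Ioi] with x hx
    have hx : 0 < x := hx
    rw [norm_mul, norm_mul, hnorm, hnorm]
    refine mul_le_mul_of_nonneg_right (Real.exp_le_exp.2 ?_) (norm_nonneg _)
    simp only [Complex.ofReal_re]
    nlinarith
  have hder := hasDerivAt_integral_of_dominated_loc_of_deriv_le
    (μ := volume.restrict (Set.Ioi (0 : ℝ))) (x₀ := z₀)
    (F := fun z (x : ℝ) => Complex.exp (-(z * x)) * q x)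
    (F' := fun z (x : ℝ) => -x * (Complex.exp (-(z * x)) * q x))
    (bound := fun x => δ⁻¹ * ‖Complex.exp (-(δ * x)) * q x‖)
    (Metric.ball_mem_nhds z₀ hδ0) (Eventually.of_forall hmeas) (hint z₀ (by simp [hδ]; linarith))
    ((Complex.continuous_ofReal.neg.aestronglyMeasurable).mul (hmeas z₀)) ?_
    ((h δ hδ0).norm.const_mul _) ?_
  · exact hder.2.differentiableAt
  · filter_upwards [ae_restrict_mem measurableSet_Ioi] with x hx z hz
    have hx : 0 < x := hx
    have hre : 2 * δ ≤ z.re := by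
      have h1 := (Complex.abs_re_le_norm (z - z₀)).trans (mem_ball_iff_norm.1 hz).le
      rw [Complex.sub_re, abs_le] at h1
      linarith
    rw [norm_mul, norm_mul, norm_mul, hnorm, hnorm, norm_neg, Complex.norm_real,
      Real.norm_of_nonneg hx.le, ← mul_assoc, ← mul_assoc]
    refine mul_le_mul_of_nonneg_right ?_ (norm_nonneg _)
    simp only [Complex.ofReal_re]
    have h1 : Real.exp (-(z.re * x)) ≤ Real.exp (-(δ * x)) * Real.exp (-(δ * x)) := by
      rw [← Real.exp_add]; exact Real.exp_le_exp.2 (by nlinarith)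
    have h2 : x * Real.exp (-(δ * x)) ≤ δ⁻¹ := by
      rw [Real.exp_neg, ← div_eq_mul_inv, div_le_iff₀ (Real.exp_pos _), inv_mul_eq_div,
        le_div_iff₀ hδ0]
      have := Real.add_one_le_exp (δ * x)
      linarith
    calc x * Real.exp (-(z.re * x)) ≤ x * (Real.exp (-(δ * x)) * Real.exp (-(δ * x))) :=
          mul_le_mul_of_nonneg_left h1 hx.le
      _ ≤ _ := by
          rw [← mul_assoc]
          exact mul_le_mul_of_nonneg_right h2 (Real.exp_pos _).le
  · refine Eventually.of_forall fun x z _ => ?_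
    have h1 : HasDerivAt (fun z : ℂ => Complex.exp (-(z * x))) (Complex.exp (-(z * x)) * -x) z := by
      simpa using (((hasDerivAt_id z).mul_const (x : ℂ)).neg).cexp
    exact (h1.mul_const (q x)).congr_deriv (by ring)

/-! ### Derivatives of `Γ(s) z^{-s}` in `s` -/

/-- `1/Γ` is entire and does not vanish off the poles of `Γ`, so smoothness of every order follows
by inversion. -/
theorem contDiffAt_Gamma {s : ℂ} (hs : ∀ m : ℕ, s ≠ -m) {n : ℕ∞ω} :
    ContDiffAt ℂ n Complex.Gamma s := by
  have h : ContDiff ℂ n fun s => (Complex.Gamma s)⁻¹ :=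
    Complex.differentiable_one_div_Gamma.contDiff
  have h2 := h.contDiffAt.inv (inv_ne_zero (Complex.Gamma_ne_zero hs))
  exact h2.congr_of_eventuallyEq (Eventually.of_forall fun w => by simp)

theorem cpow_neg_eq_exp {z : ℂ} (hz : z ≠ 0) :
    (fun w : ℂ => z ^ (-w)) = fun w => Complex.exp (-Complex.log z * w) := by
  funext w; rw [Complex.cpow_def_of_ne_zero hz]; ring_nf

theorem contDiff_cpow_neg {z : ℂ} (hz : z ≠ 0) {n : ℕ∞ω} : ContDiff ℂ n fun w : ℂ => z ^ (-w) := by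
  rw [cpow_neg_eq_exp hz]
  exact (contDiff_const.mul contDiff_id).cexp

theorem iteratedDeriv_cpow_neg {z : ℂ} (hz : z ≠ 0) (i : ℕ) (s : ℂ) :
    iteratedDeriv i (fun w : ℂ => z ^ (-w)) s = (-Complex.log z) ^ i * z ^ (-s) := by
  rw [cpow_neg_eq_exp hz, iteratedDeriv_cexp_const_mul, Complex.cpow_def_of_ne_zero hz]
  ring_nf

theorem iteratedDeriv_add_const_mul {F : ℂ → ℂ} (c : ℂ) {s : ℂ} {l : ℕ}
    (hF : ContDiffAt ℂ l F s) :
    iteratedDeriv l (fun w => (w + c) * F w) s =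
      (s + c) * iteratedDeriv l F s + l * iteratedDeriv (l - 1) F s := by
  have h := iteratedDeriv_mul (f := fun w : ℂ => w + c)
    ((contDiff_id.add contDiff_const).contDiffAt) hF
  have hd : ∀ i, iteratedDeriv i (fun w : ℂ => w + c) s =
      if i = 0 then s + c else if i = 1 then 1 else 0 := fun i => by
    have := congrFun (iteratedDeriv_comp_add_const i (id : ℂ → ℂ) c) s
    simp only [id_eq] at this
    rw [this, iteratedDeriv_id]
  rw [show (fun w => (w + c) * F w) = (fun w => w + c) * F from rfl, h]
  simp only [hd]
  cases l with
  | zero => simp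
  | succ l =>
    rw [Finset.sum_range_succ', Finset.sum_range_succ']
    simp
    ring

/-- The `l`-th derivative of `w ↦ Γ(w) z^{-w}` at `s`. -/
def gammaPow (l : ℕ) (s z : ℂ) : ℂ := iteratedDeriv l (fun w => Complex.Gamma w * z ^ (-w)) s

theorem contDiffAt_Gamma_mul_cpow {s z : ℂ} (hs : ∀ m : ℕ, s ≠ -m) (hz : z ≠ 0) {n : ℕ∞ω} :
    ContDiffAt ℂ n (fun w => Complex.Gamma w * z ^ (-w)) s :=
  (contDiffAt_Gamma hs).mul (contDiff_cpow_neg hz).contDiffAt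

theorem gammaPow_eq_sum {s z : ℂ} (hs : ∀ m : ℕ, s ≠ -m) (hz : z ≠ 0) (l : ℕ) :
    gammaPow l s z = ∑ i ∈ Finset.range (l + 1), (l.choose i : ℂ) *
      iteratedDeriv i Complex.Gamma s * ((-Complex.log z) ^ (l - i) * z ^ (-s)) := by
  rw [gammaPow, show (fun w => Complex.Gamma w * z ^ (-w)) = Complex.Gamma * fun w : ℂ => z ^ (-w)
    from rfl, iteratedDeriv_mul (contDiffAt_Gamma hs) (contDiff_cpow_neg hz).contDiffAt]
  simp only [iteratedDeriv_cpow_neg hz]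

theorem ne_neg_nat_add {s : ℂ} (hs : ∀ m : ℕ, s ≠ -m) (n m : ℕ) : s + n ≠ -m := fun h =>
  hs (m + n) (by push_cast; linear_combination h)

theorem ne_neg_nat_add_one {s : ℂ} (hs : ∀ m : ℕ, s ≠ -m) (m : ℕ) : s + 1 ≠ -m := by
  simpa using ne_neg_nat_add hs 1 m

/-- The functional equation of `Γ` in the form `z · Γ(w+1) z^{-(w+1)} = w · Γ(w) z^{-w}`,
differentiated `l` times in `w`. It is the source of the recursions both in `z` and on the Fourier
side. -/
theorem mul_gammaPow_add_one {s z : ℂ} (hs : ∀ m : ℕ, s ≠ -m) (hz : z ≠ 0) (l : ℕ) :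
    z * gammaPow l (s + 1) z = s * gammaPow l s z + l * gammaPow (l - 1) s z := by
  have h1 : z * gammaPow l (s + 1) z =
      iteratedDeriv l (fun w => z * (Complex.Gamma (w + 1) * z ^ (-(w + 1)))) s := by
    rw [iteratedDeriv_const_mul_field, gammaPow]
    congr 1
    exact (congrFun (iteratedDeriv_comp_add_const l
      (fun w => Complex.Gamma w * z ^ (-w)) 1) s).symm
  have h2 : (fun w => z * (Complex.Gamma (w + 1) * z ^ (-(w + 1)))) =ᶠ[𝓝 s]
      fun w => (w + 0) * (Complex.Gamma w * z ^ (-w)) := by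
    have hs0 : s ≠ 0 := by simpa using hs 0
    filter_upwards [eventually_ne_nhds hs0] with w hw
    rw [Complex.Gamma_add_one w hw, neg_add, Complex.cpow_add _ _ hz, Complex.cpow_neg_one]
    field_simp
    ring
  rw [h1, h2.iteratedDeriv_eq, iteratedDeriv_add_const_mul 0 (contDiffAt_Gamma_mul_cpow hs hz)]
  simp [gammaPow]

/-- Formally `∂_z` commutes with `∂_s^l` and maps `Γ(s) z^{-s}` to `-Γ(s+1) z^{-(s+1)}`. The finite
Leibniz sum makes the interchange explicit, and `mul_gammaPow_add_one` collects the result. -/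
theorem hasDerivAt_gammaPow {s z : ℂ} (hs : ∀ m : ℕ, s ≠ -m) (hz : z ∈ Complex.slitPlane)
    (l : ℕ) : HasDerivAt (gammaPow l s) (-gammaPow l (s + 1) z) z := by
  have hz0 : z ≠ 0 := Complex.slitPlane_ne_zero hz
  have hterm : ∀ i ∈ Finset.range (l + 1), HasDerivAt
      (fun z => (l.choose i : ℂ) * iteratedDeriv i Complex.Gamma s *
        ((-Complex.log z) ^ (l - i) * z ^ (-s)))
      (-z⁻¹ * (s * ((l.choose i : ℂ) * iteratedDeriv i Complex.Gamma s *
        ((-Complex.log z) ^ (l - i) * z ^ (-s))) + ((l.choose i : ℂ) * ((l - i : ℕ) : ℂ)) *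
          iteratedDeriv i Complex.Gamma s * ((-Complex.log z) ^ (l - i - 1) * z ^ (-s)))) z := by
    intro i _
    have h1 := (Complex.hasDerivAt_log hz).neg.pow (l - i)
    have h2 := (hasDerivAt_id z).cpow_const (c := -s) hz
    refine ((h1.mul h2).const_mul _).congr_deriv ?_
    simp only [id_eq, Pi.neg_apply, Pi.pow_apply]
    rw [sub_eq_add_neg (-s), Complex.cpow_add _ _ hz0, Complex.cpow_neg_one]
    ring
  have hsum := HasDerivAt.fun_sum hterm
  have hev : gammaPow l s =ᶠ[𝓝 z] fun z => ∑ i ∈ Finset.range (l + 1), (l.choose i : ℂ) *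
      iteratedDeriv i Complex.Gamma s * ((-Complex.log z) ^ (l - i) * z ^ (-s)) := by
    filter_upwards [eventually_ne_nhds hz0] with w hw using gammaPow_eq_sum hs hw l
  refine (hsum.congr_of_eventuallyEq hev).congr_deriv ?_
  have hM := mul_gammaPow_add_one hs hz0 l
  rw [← Finset.mul_sum, Finset.sum_add_distrib, ← Finset.mul_sum, ← gammaPow_eq_sum hs hz0]
  have h3 : ∑ i ∈ Finset.range (l + 1), ((l.choose i : ℂ) * ((l - i : ℕ) : ℂ)) *
      iteratedDeriv i Complex.Gamma s * ((-Complex.log z) ^ (l - i - 1) * z ^ (-s)) =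
      l * gammaPow (l - 1) s z := by
    cases l with
    | zero => simp
    | succ l =>
      rw [Finset.sum_range_succ, Nat.add_sub_cancel, gammaPow_eq_sum hs hz0, Finset.mul_sum]
      simp only [Nat.sub_self, Nat.cast_zero, mul_zero, zero_mul, add_zero]
      refine Finset.sum_congr rfl fun i hi => ?_
      have hi : i ≤ l := Nat.lt_succ_iff.1 (Finset.mem_range.1 hi)
      have hc : (((l + 1).choose i : ℂ) * ((l + 1 - i : ℕ) : ℂ)) = l.choose i * (l + 1 : ℕ) := by
        exact_mod_cast (Nat.choose_mul_succ_eq l i).symm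
      rw [hc, show l + 1 - i - 1 = l - i by omega]
      ring
  rw [h3, ← hM]
  field_simp

theorem differentiableOn_gammaPow {s : ℂ} (hs : ∀ m : ℕ, s ≠ -m) (l : ℕ) :
    DifferentiableOn ℂ (gammaPow l s) Complex.slitPlane :=
  fun _ hz => (hasDerivAt_gammaPow hs hz l).differentiableAt.differentiableWithinAt

theorem exists_norm_gammaPow_le {s : ℂ} (hs : ∀ m : ℕ, s ≠ -m) (l : ℕ) :
    ∃ C, 0 ≤ C ∧ ∀ z, z ≠ 0 → ‖gammaPow l s z‖ ≤ C * gauge (-s.re) l ‖z‖ := by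
  -- Since `|arg z| ≤ π`, the factor `(1 + π)^l` accounts for the imaginary part of the logarithm
  -- and `e^{π |Im s|}` for the contribution of the argument to `|z^{-s}|`.
  refine ⟨∑ i ∈ Finset.range (l + 1), ‖(l.choose i : ℂ) * iteratedDeriv i Complex.Gamma s‖ *
    ((1 + Real.pi) ^ l * Real.exp (Real.pi * |s.im|)), by positivity, fun z hz => ?_⟩
  rw [gammaPow_eq_sum hs hz, Finset.sum_mul]
  refine (norm_sum_le _ _).trans (Finset.sum_le_sum fun i hi => ?_)
  rw [norm_mul, norm_mul _ (z ^ (-s)), norm_pow, norm_neg, mul_assoc]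
  refine mul_le_mul_of_nonneg_left ?_ (norm_nonneg _)
  have hpi := Real.pi_pos
  have hlog : ‖Complex.log z‖ ≤ (1 + Real.pi) * (1 + |Real.log (|‖z‖|)|) := by
    refine (Complex.norm_le_abs_re_add_abs_im _).trans ?_
    rw [Complex.log_re, Complex.log_im, abs_norm]
    have := Complex.abs_arg_le_pi z
    nlinarith [abs_nonneg (Real.log ‖z‖)]
  have hlog1 : 1 ≤ (1 + Real.pi) * (1 + |Real.log (|‖z‖|)|) := by
    nlinarith [abs_nonneg (Real.log (|‖z‖|))]
  have h1 : ‖Complex.log z‖ ^ (l - i) ≤ ((1 + Real.pi) * (1 + |Real.log (|‖z‖|)|)) ^ l :=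
    (pow_le_pow_left₀ (norm_nonneg _) hlog _).trans (pow_le_pow_right₀ hlog1 (Nat.sub_le _ _))
  have h2 : ‖z ^ (-s)‖ ≤ ‖z‖ ^ (-s.re) * Real.exp (Real.pi * |s.im|) := by
    rw [Complex.norm_cpow_of_ne_zero hz, div_eq_mul_inv, ← Real.exp_neg]
    refine mul_le_mul_of_nonneg_left (Real.exp_le_exp.2 ?_) (by positivity)
    calc -(z.arg * (-s).im) = z.arg * s.im := by simp
      _ ≤ |z.arg * s.im| := le_abs_self _
      _ ≤ Real.pi * |s.im| := by
        rw [abs_mul]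
        exact mul_le_mul_of_nonneg_right (Complex.abs_arg_le_pi z) (abs_nonneg _)
  refine (mul_le_mul h1 h2 (norm_nonneg _) (by positivity)).trans_eq ?_
  rw [gauge, mul_pow, abs_norm]; ring

/-- Each derivative along the line raises `s` by one and brings out `-i`, so symbol estimates of all
orders reduce to the bound for the function itself. -/
theorem iteratedDeriv_gammaPow_affine {s : ℂ} (hs : ∀ m : ℕ, s ≠ -m) (c : ℂ) (l k : ℕ) :
    ∀ ξ : ℝ, c + Complex.I * ξ ∈ Complex.slitPlane →
      iteratedDeriv k (fun ξ : ℝ => gammaPow l s (c + Complex.I * ξ)) ξ =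
        (-Complex.I) ^ k * gammaPow l (s + k) (c + Complex.I * ξ) := by
  induction k with
  | zero => intro ξ _; simp
  | succ k ih =>
    intro ξ hξ
    have hopen : ∀ᶠ η : ℝ in 𝓝 ξ, c + Complex.I * η ∈ Complex.slitPlane :=
      (by fun_prop : Continuous fun η : ℝ => c + Complex.I * (η : ℂ)).continuousAt.eventually
        (Complex.isOpen_slitPlane.mem_nhds hξ)
    have hev : iteratedDeriv k (fun ξ : ℝ => gammaPow l s (c + Complex.I * ξ)) =ᶠ[𝓝 ξ]
        fun ξ : ℝ => (-Complex.I) ^ k * gammaPow l (s + k) (c + Complex.I * ξ) := by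
      filter_upwards [hopen] with η hη using ih η hη
    rw [iteratedDeriv_succ, hev.deriv_eq]
    have h1 : HasDerivAt (fun ξ : ℝ => c + Complex.I * (ξ : ℂ)) Complex.I ξ := by
      simpa using ((hasDerivAt_id ξ).ofReal_comp.const_mul Complex.I).const_add c
    have h2 := ((hasDerivAt_gammaPow (ne_neg_nat_add hs k) hξ l).comp ξ h1).const_mul
      ((-Complex.I) ^ k)
    refine h2.deriv.trans ?_
    push_cast
    rw [add_assoc]; ring

theorem contDiffAt_gammaPow_affine {s : ℂ} (hs : ∀ m : ℕ, s ≠ -m) (c : ℂ) (l : ℕ) {ξ : ℝ}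
    (hξ : c + Complex.I * ξ ∈ Complex.slitPlane) {n : ℕ∞ω} :
    ContDiffAt ℝ n (fun ξ : ℝ => gammaPow l s (c + Complex.I * ξ)) ξ := by
  have h1 : ContDiffAt ℂ n (gammaPow l s) (c + Complex.I * ξ) :=
    ((differentiableOn_gammaPow hs l).analyticOnNhd Complex.isOpen_slitPlane _ hξ).contDiffAt
  have h2 : ContDiff ℝ n fun ξ : ℝ => c + Complex.I * (ξ : ℂ) :=
    contDiff_const.add (contDiff_const.mul Complex.ofRealCLM.contDiff)
  exact (h1.restrict_scalars ℝ).comp ξ h2.contDiffAt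

theorem I_mul_mem_slitPlane {ξ : ℝ} (hξ : ξ ≠ 0) : Complex.I * (ξ : ℂ) ∈ Complex.slitPlane := by
  rw [Complex.mem_slitPlane_iff]; right; simpa using hξ

theorem symAt_gammaPow {s : ℂ} (hs : ∀ m : ℕ, s ≠ -m) (l k : ℕ) :
    SymAt (cocompact ℝ) k (-s.re) l (fun ξ : ℝ => gammaPow l s (Complex.I * ξ)) := by
  have hne : ∀ᶠ ξ : ℝ in cocompact ℝ, ξ ≠ 0 := by
    filter_upwards [eventually_one_le_abs_cocompact 1] with ξ hξ h
    simp [h] at hξ; linarith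
  refine ⟨?_, ?_⟩
  · filter_upwards [hne] with ξ hξ
    simpa using contDiffAt_gammaPow_affine hs 0 l (by simpa using I_mul_mem_slitPlane hξ)
  · obtain ⟨C, hC, h⟩ := exists_norm_gammaPow_le (ne_neg_nat_add hs k) l
    refine IsBigO.of_bound C ?_
    filter_upwards [hne] with ξ hξ
    have h1 := iteratedDeriv_gammaPow_affine hs 0 l k ξ (by simpa using I_mul_mem_slitPlane hξ)
    simp only [zero_add] at h1
    rw [h1, Real.norm_of_nonneg (gauge_nonneg _ _ _)]
    have h2 := h (Complex.I * ξ) (by simpa using hξ)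
    have h3 : gauge (-(s + k).re) l ‖Complex.I * (ξ : ℂ)‖ = gauge (-s.re - k) l ξ := by
      simp only [gauge, norm_mul, Complex.norm_I, one_mul, Complex.norm_real, Real.norm_eq_abs,
        abs_abs, Complex.add_re, Complex.natCast_re]
      congr 2; ring
    rw [h3] at h2
    simpa using h2

/-! ### The Mellin integral of a logarithmic power times an exponential -/

theorem isBigO_cexp_neg_mul_atTop {z : ℂ} (hz : 0 < z.re) (b : ℝ) :
    (fun x : ℝ => Complex.exp (-(z * x))) =O[atTop] fun x : ℝ => x ^ b := by
  refine IsBigO.of_norm_left ((isLittleO_exp_neg_mul_rpow_atTop hz b).isBigO.congr_left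
    fun x => ?_)
  rw [Complex.norm_exp]; simp

theorem integrableOn_powLog_mul_exp {a z : ℂ} (ha : -1 < a.re) (hz : 0 < z.re) (l : ℕ) :
    IntegrableOn (fun x : ℝ => powLog a l x * Complex.exp (-(z * x))) (Set.Ioi 0) := by
  rw [← integrable_zeroExt_iff]
  have hc : Continuous fun x : ℝ => Complex.exp (-(z * x)) := by fun_prop
  have h0 : powLog a l =O[𝓝[>] 0] gauge a.re l := by
    simpa using (symAt_zero_powLog a l 0).bound
  have h1 : powLog a l =O[atTop] gauge a.re l := by
    refine IsBigO.of_bound 1 ?_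
    filter_upwards [eventually_gt_atTop 0] with x hx
    rw [norm_powLog a l hx, Real.norm_of_nonneg (gauge_nonneg _ _ _), one_mul, gauge,
      abs_of_pos hx]
    exact mul_le_mul_of_nonneg_left (pow_le_pow_left₀ (abs_nonneg _) (by linarith) _)
      (by positivity)
  refine integrable_zeroExt ((continuousOn_powLog a l).mul hc.continuousOn) ha (μ := l) ?_
    (s := -2) (ν := l) (by norm_num) ?_
  · have := h0.mul (((hc.tendsto 0).mono_left nhdsWithin_le_nhds).isBigO_one ℝ)
    simpa using this
  · have := h1.mul (isBigO_cexp_neg_mul_atTop hz (-2 - a.re))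
    refine this.congr' EventuallyEq.rfl ?_
    filter_upwards [eventually_gt_atTop 0] with x hx
    have : x ^ (-2 - a.re) = gauge (-2 - a.re) 0 x := by
      rw [gauge_zero_right]; simp [abs_of_pos hx]
    rw [this, gauge_mul hx.ne']
    congr 1; ring

/-- For real `z > 0` this is a rescaled `Γ`-integral. Both sides are analytic in the right
half-plane, so the identity theorem extends it to complex `z`. -/
theorem integral_cpow_mul_exp_neg_mul_Ioi' {s z : ℂ} (hs : 0 < s.re) (hz : 0 < z.re) :
    ∫ x in Set.Ioi (0 : ℝ), Complex.exp (-(z * x)) * (x : ℂ) ^ (s - 1) =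
      Complex.Gamma s * z ^ (-s) := by
  have hint : ∀ δ : ℝ, 0 < δ →
      IntegrableOn (fun x : ℝ => Complex.exp (-(δ * x)) * (x : ℂ) ^ (s - 1)) (Set.Ioi 0) := by
    intro δ hδ
    have := integrableOn_powLog_mul_exp (a := s - 1) (z := δ) (by simpa using hs) (by simpa) 0
    simpa [powLog, mul_comm] using this
  have hopen : IsOpen {z : ℂ | 0 < z.re} := isOpen_lt continuous_const Complex.continuous_re
  have h1 := (differentiableOn_laplace hint).analyticOnNhd hopen
  have h2 : AnalyticOnNhd ℂ (fun z : ℂ => Complex.Gamma s * z ^ (-s)) {z : ℂ | 0 < z.re} := by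
    refine DifferentiableOn.analyticOnNhd (fun w hw => ?_) hopen
    exact (((hasDerivAt_id w).cpow_const (c := -s)
      (Or.inl hw)).differentiableAt.const_mul _).differentiableWithinAt
  have hconn : IsPreconnected {z : ℂ | 0 < z.re} := (convex_halfSpace_re_gt 0).isPreconnected
  refine h1.eqOn_of_preconnected_of_frequently_eq h2 hconn (z₀ := 1) (by simp) ?_ hz
  have htend : Tendsto (fun t : ℝ => (t : ℂ)) (𝓝[>] 1) (𝓝[≠] 1) := by
    refine tendsto_nhdsWithin_iff.2 ⟨?_, ?_⟩
    · exact (Complex.continuous_ofReal.tendsto' 1 1 (by simp)).mono_left nhdsWithin_le_nhds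
    · filter_upwards [self_mem_nhdsWithin] with t ht h
      have ht : 1 < t := ht
      have h : (t : ℂ) = 1 := h
      have : t = 1 := by exact_mod_cast h
      linarith
  refine htend.frequently (Eventually.frequently ?_)
  filter_upwards [self_mem_nhdsWithin] with t ht
  have ht : 0 < t := lt_trans one_pos ht
  have := Complex.integral_cpow_mul_exp_neg_mul_Ioi hs ht
  rw [mul_comm (Complex.Gamma s), Complex.cpow_neg, ← Complex.inv_cpow _ _ (by
    rw [Complex.arg_ofReal_of_nonneg ht.le]; exact Real.pi_pos.ne), ← one_div, ← this]
  congr 1; funext x; ring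

/-- Differentiating a Mellin transform in `s` brings one more `log x` under the integral; the case
`l = 0` is the `Γ`-integral. -/
theorem mellin_log_pow_mul_exp {z : ℂ} (hz : 0 < z.re) (l : ℕ) :
    ∀ s : ℂ, 0 < s.re →
      mellin (fun x : ℝ => (Real.log x : ℂ) ^ l * Complex.exp (-(z * x))) s = gammaPow l s z := by
  have hz0 : z ≠ 0 := by rintro rfl; simp at hz
  have hreg : ∀ s : ℂ, 0 < s.re → ∀ m : ℕ, s ≠ -m := fun s hs m h => by
    rw [h] at hs; simp at hs; linarith [(Nat.cast_nonneg m : (0 : ℝ) ≤ m)]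
  induction l with
  | zero =>
    intro s hs
    rw [gammaPow, iteratedDeriv_zero, ← integral_cpow_mul_exp_neg_mul_Ioi' hs hz, mellin]
    congr 1; funext x; simp [mul_comm]
  | succ l ih =>
    intro s hs
    have hc : ContinuousOn (fun x : ℝ => (Real.log x : ℂ) ^ l * Complex.exp (-(z * x)))
        (Set.Ioi 0) := by
      refine ContinuousOn.mul (ContinuousOn.pow ?_ l) (by fun_prop)
      exact Complex.continuous_ofReal.comp_continuousOn
        (Real.continuousOn_log.mono fun x hx => (ne_of_gt hx))
    have e : (fun x : ℝ => (Real.log x : ℂ) ^ l * Complex.exp (-(z * x))) =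
        fun x => powLog 0 l x * Complex.exp (-(z * x)) := by
      funext x; simp [powLog]
    have htop : (fun x : ℝ => (Real.log x : ℂ) ^ l * Complex.exp (-(z * x))) =O[atTop]
        fun x => x ^ (-(s.re + 1)) := by
      have h1 : (fun x : ℝ => (Real.log x : ℂ) ^ l) =O[atTop] fun x : ℝ => x ^ (1 : ℝ) := by
        refine (IsBigO.of_bound 1 (Eventually.of_forall fun x => ?_)).trans
          (one_add_abs_log_isBigO_atTop l one_pos)
        rw [norm_pow, Complex.norm_real, Real.norm_eq_abs, Real.norm_of_nonneg (by positivity),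
          one_mul]
        exact pow_le_pow_left₀ (abs_nonneg _) (by linarith) _
      refine (h1.mul (isBigO_cexp_neg_mul_atTop hz (-(s.re + 1) - 1))).congr' EventuallyEq.rfl ?_
      filter_upwards [eventually_gt_atTop 0] with x hx
      rw [← Real.rpow_add hx]; congr 1; ring
    have hbot : (fun x : ℝ => (Real.log x : ℂ) ^ l * Complex.exp (-(z * x))) =O[𝓝[>] 0]
        fun x => x ^ (-(s.re / 2)) := by
      have h0 : powLog 0 l =O[𝓝[>] 0] gauge 0 l := by
        simpa using (symAt_zero_powLog 0 l 0).bound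
      have h1 := h0.trans (gauge_absorb_zero (by linarith : -(s.re / 2) < 0) l)
      have hcc : Continuous fun x : ℝ => Complex.exp (-(z * x)) := by fun_prop
      have h2 := h1.mul (((hcc.tendsto 0).mono_left nhdsWithin_le_nhds).isBigO_one ℝ)
      rw [e]
      refine h2.congr' EventuallyEq.rfl ?_
      filter_upwards [self_mem_nhdsWithin] with x hx
      have hx : 0 < x := hx
      simp [gauge_zero_right, abs_of_pos hx]
    have h := (mellin_hasDerivAt_of_isBigO_rpow (hc.locallyIntegrableOn measurableSet_Ioi)
      htop (by linarith) hbot (by linarith)).2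
    have hev : mellin (fun x : ℝ => (Real.log x : ℂ) ^ l * Complex.exp (-(z * x))) =ᶠ[𝓝 s]
        fun s => gammaPow l s z := by
      filter_upwards [(isOpen_lt continuous_const Complex.continuous_re).mem_nhds hs] with w hw
        using ih w hw
    have h2 : gammaPow (l + 1) s z = deriv (fun s => gammaPow l s z) s := by
      rw [gammaPow, iteratedDeriv_succ]; rfl
    rw [h2, ← hev.deriv_eq, h.deriv]
    congr 1; funext x
    rw [Complex.real_smul]; ring

theorem integral_powLog_mul_exp {a z : ℂ} (ha : -1 < a.re) (hz : 0 < z.re) (l : ℕ) :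
    ∫ x in Set.Ioi (0 : ℝ), powLog a l x * Complex.exp (-(z * x)) = gammaPow l (a + 1) z := by
  rw [← mellin_log_pow_mul_exp hz l (a + 1) (by simp; linarith), mellin]
  congr 1; funext x
  rw [powLog, add_sub_cancel_right, smul_eq_mul, mul_assoc]

/-! ### Taylor expansion along the shift -/

theorem gauge_le_of_comparable (r : ℝ) (l : ℕ) {x y : ℝ} (hx : 1 ≤ |x|) (h1 : |x| ≤ y)
    (h2 : y ≤ 2 * |x|) : gauge r l y ≤ (2 ^ |r| * 2 ^ l) * gauge r l x := by
  have hx0 : 0 < |x| := by linarith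
  have hy0 : 0 < y := by linarith
  have hpow : y ^ r ≤ 2 ^ |r| * |x| ^ r := by
    rcases le_total 0 r with hr | hr
    · rw [abs_of_nonneg hr, ← Real.mul_rpow (by norm_num) hx0.le]
      exact Real.rpow_le_rpow hy0.le h2 hr
    · calc y ^ r ≤ |x| ^ r := Real.rpow_le_rpow_of_nonpos hx0 h1 hr
        _ = 1 * |x| ^ r := (one_mul _).symm
        _ ≤ _ := mul_le_mul_of_nonneg_right
          (Real.one_le_rpow (by norm_num) (abs_nonneg r)) (by positivity)
  have hlog : 1 + |Real.log (|y|)| ≤ 2 * (1 + |Real.log (|x|)|) := by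
    rw [abs_of_pos hy0, abs_of_nonneg (Real.log_nonneg (hx.trans h1)),
      abs_of_nonneg (Real.log_nonneg hx)]
    have h3 := Real.log_le_log hy0 h2
    rw [Real.log_mul (by norm_num) hx0.ne'] at h3
    have h4 : Real.log 2 ≤ 1 := by
      have := Real.log_le_sub_one_of_pos (by norm_num : (0 : ℝ) < 2)
      linarith
    linarith [Real.log_nonneg hx]
  unfold gauge
  rw [abs_of_pos hy0] at hlog ⊢
  calc y ^ r * (1 + |Real.log y|) ^ l
      ≤ (2 ^ |r| * |x| ^ r) * (2 * (1 + |Real.log (|x|)|)) ^ l :=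
        mul_le_mul hpow (pow_le_pow_left₀ (by positivity) hlog l) (by positivity) (by positivity)
    _ = _ := by rw [mul_pow]; ring

/-- The sum is the Taylor polynomial of `gammaPow l s` with base point `t + c`, evaluated at `c`;
the signs of `(-t)^n` cancel those of the derivatives. In the base point it telescopes, leaving only
the top term. -/
theorem hasDerivAt_sum_gammaPow {s : ℂ} (hs : ∀ m : ℕ, s ≠ -m) (l K : ℕ) {c : ℂ} {t : ℝ}
    (ht : (t : ℂ) + c ∈ Complex.slitPlane) :
    HasDerivAt (fun t : ℝ => ∑ n ∈ Finset.range (K + 1),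
        ((t : ℂ) ^ n / n.factorial) * gammaPow l (s + n) (t + c))
      (-((t : ℂ) ^ K / K.factorial * gammaPow l (s + (K + 1 : ℕ)) (t + c))) t := by
  have hx : HasDerivAt (fun x : ℝ => (x : ℂ)) 1 t := (hasDerivAt_id t).ofReal_comp
  have hg : ∀ n : ℕ, HasDerivAt (fun t : ℝ => gammaPow l (s + n) (t + c))
      (-gammaPow l (s + (n + 1 : ℕ)) (t + c)) t := fun n => by
    have := (hasDerivAt_gammaPow (ne_neg_nat_add hs n) ht l).comp t (hx.add_const c)
    refine this.congr_deriv ?_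
    push_cast; rw [add_assoc]; ring
  induction K with
  | zero => simpa using hg 0
  | succ K ih =>
    simp_rw [Finset.sum_range_succ _ (K + 1)]
    refine (ih.add (((hx.pow (K + 1)).div_const _).mul (hg (K + 1)))).congr_deriv ?_
    have hK : (K.factorial : ℂ) ≠ 0 := by exact_mod_cast K.factorial_ne_zero
    have hK' : (K : ℂ) + 1 ≠ 0 := by exact_mod_cast K.succ_ne_zero
    simp only [Pi.pow_apply, Nat.factorial_succ, Nat.add_sub_cancel]
    push_cast
    field_simp
    ring

/-- The base point moves from `iξ` at `t = 0`, where the Taylor sum is exact, to `1 + iξ` at `t =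
1`. The derivative in between involves only `gammaPow` at `s + K + 1`, and `|t + iξ|` is comparable
with `|ξ|`. -/
theorem exists_norm_sum_gammaPow_sub_le {s : ℂ} (hs : ∀ m : ℕ, s ≠ -m) (l K : ℕ) :
    ∃ C, 0 ≤ C ∧ ∀ ξ : ℝ, 1 ≤ |ξ| →
      ‖∑ n ∈ Finset.range (K + 1), ((n.factorial : ℂ)⁻¹) * gammaPow l (s + n) (1 + Complex.I * ξ)
        - gammaPow l s (Complex.I * ξ)‖ ≤ C * gauge (-s.re - (K + 1 : ℕ)) l ξ := by
  obtain ⟨C, hC, h⟩ := exists_norm_gammaPow_le (ne_neg_nat_add hs (K + 1)) l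
  set r := -(s + (K + 1 : ℕ)).re with hr
  refine ⟨C * (2 ^ |r| * 2 ^ l), by positivity, fun ξ hξ => ?_⟩
  have hξ0 : ξ ≠ 0 := by rintro rfl; simp at hξ; linarith
  have hmem : ∀ t : ℝ, (t : ℂ) + Complex.I * ξ ∈ Complex.slitPlane := fun t => by
    rw [Complex.mem_slitPlane_iff]; right; simpa using hξ0
  have hd := fun t : ℝ => hasDerivAt_sum_gammaPow hs l K (hmem t)
  have hb : ∀ t ∈ Set.Ico (0 : ℝ) 1, ‖-((t : ℂ) ^ K / K.factorial *
      gammaPow l (s + (K + 1 : ℕ)) (t + Complex.I * ξ))‖ ≤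
      C * (2 ^ |r| * 2 ^ l) * gauge r l ξ := fun t ht => by
    rw [norm_neg, norm_mul]
    have h1 : ‖(t : ℂ) ^ K / K.factorial‖ ≤ 1 := by
      rw [norm_div, norm_pow, Complex.norm_real, Complex.norm_natCast, Real.norm_of_nonneg ht.1]
      refine div_le_one_of_le₀ ((pow_le_one₀ ht.1 ht.2.le).trans ?_) (by positivity)
      exact_mod_cast K.factorial_pos
    have h2 := h _ (Complex.slitPlane_ne_zero (hmem t))
    have hlo : |ξ| ≤ ‖(t : ℂ) + Complex.I * ξ‖ := by
      have := Complex.abs_im_le_norm ((t : ℂ) + Complex.I * ξ)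
      simpa using this
    have hhi : ‖(t : ℂ) + Complex.I * ξ‖ ≤ 2 * |ξ| := by
      refine (norm_add_le _ _).trans ?_
      rw [norm_mul, Complex.norm_I, one_mul, Complex.norm_real, Complex.norm_real,
        Real.norm_of_nonneg ht.1, Real.norm_eq_abs]
      linarith [ht.2]
    have h3 := gauge_le_of_comparable r l hξ hlo hhi
    calc _ ≤ 1 * (C * gauge r l ‖(t : ℂ) + Complex.I * ξ‖) :=
          mul_le_mul h1 h2 (norm_nonneg _) zero_le_one
      _ ≤ _ := by
          rw [one_mul, mul_assoc C]
          exact mul_le_mul_of_nonneg_left h3 hC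
  have hmv := norm_image_sub_le_of_norm_deriv_le_segment_01'
    (fun t _ => (hd t).hasDerivWithinAt) hb
  have e0 : ∑ n ∈ Finset.range (K + 1), (((0 : ℝ) : ℂ) ^ n / n.factorial) *
      gammaPow l (s + n) (((0 : ℝ) : ℂ) + Complex.I * ξ) = gammaPow l s (Complex.I * ξ) := by
    rw [Finset.sum_range_succ']; simp
  rw [e0] at hmv
  have er : r = -s.re - (K + 1 : ℕ) := by
    simp only [hr, Complex.add_re, Complex.natCast_re]; ring
  rw [er] at hmv ⊢
  refine le_trans (le_of_eq ?_) hmv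
  congr 2
  refine Finset.sum_congr rfl fun n _ => ?_
  simp [div_eq_mul_inv]

/-! ### Fourier–Laplace transforms of the exponentially damped powers -/

/-- The Fourier-Laplace transform of `x₊^a log^l x e^{-x} ∑_{n < K} x^n / n!`. -/
def gFun (a : ℂ) (l K : ℕ) (ζ : ℂ) : ℂ :=
  ((Real.sqrt (2 * Real.pi))⁻¹ : ℂ) * ∑ n ∈ Finset.range K,
    ((n.factorial : ℂ)⁻¹) * gammaPow l (a + 1 + n) (1 + Complex.I * ζ)

theorem one_add_I_mul_mem {ζ : ℂ} (hζ : ζ.im < 1) : 1 + Complex.I * ζ ∈ Complex.slitPlane := by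
  rw [Complex.mem_slitPlane_iff]; left; simp; linarith

theorem differentiableOn_gFun {a : ℂ} (ha : ∀ m : ℕ, a + 1 ≠ -m) (l K : ℕ) :
    DifferentiableOn ℂ (gFun a l K) {ζ | ζ.im < 1} := by
  intro ζ hζ
  refine DifferentiableAt.differentiableWithinAt ?_
  refine (DifferentiableAt.fun_sum fun n _ => ?_).const_mul _
  refine DifferentiableAt.const_mul ?_ _
  have h1 := (hasDerivAt_gammaPow (ne_neg_nat_add ha n) (one_add_I_mul_mem hζ) l).differentiableAt
  exact h1.comp ζ ((differentiableAt_id.const_mul Complex.I).const_add 1)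

theorem contDiff_gFun {a : ℂ} (ha : ∀ m : ℕ, a + 1 ≠ -m) (l K : ℕ) {n : ℕ∞ω} :
    ContDiff ℝ n (fun ξ : ℝ => gFun a l K ξ) := by
  refine contDiff_const.mul (ContDiff.sum fun i _ => contDiff_const.mul ?_)
  rw [contDiff_iff_contDiffAt]
  intro ξ
  exact contDiffAt_gammaPow_affine (ne_neg_nat_add ha i) 1 l (one_add_I_mul_mem (by simp))

theorem symAt_gFun_sub {a : ℂ} (ha : ∀ m : ℕ, a + 1 ≠ -m) (l K k : ℕ) :
    SymAt (cocompact ℝ) k (-a.re - 1 - (K + 1 : ℕ)) l (fun ξ : ℝ => gFun a l (K + 1) ξ -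
      ((Real.sqrt (2 * Real.pi))⁻¹ : ℂ) * gammaPow l (a + 1) (Complex.I * ξ)) := by
  have hne : ∀ᶠ ξ : ℝ in cocompact ℝ, 1 ≤ |ξ| ∧ ξ ≠ 0 := by
    filter_upwards [eventually_one_le_abs_cocompact 1] with ξ hξ
    refine ⟨hξ, fun h => ?_⟩
    simp [h] at hξ; linarith
  have hz : ∀ ξ : ℝ, ξ ≠ 0 → (0 : ℂ) + Complex.I * ξ ∈ Complex.slitPlane := fun ξ hξ => by
    simpa using I_mul_mem_slitPlane hξ
  have hsm : ∀ ξ : ℝ, ξ ≠ 0 → ContDiffAt ℝ k (fun ξ : ℝ =>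
      gammaPow l (a + 1) (Complex.I * ξ)) ξ := fun ξ hξ => by
    simpa using contDiffAt_gammaPow_affine ha 0 l (hz ξ hξ) (n := k)
  have hsm1 : ∀ (n : ℕ) (ξ : ℝ), ContDiffAt ℝ k (fun ξ : ℝ =>
      gammaPow l (a + 1 + n) (1 + Complex.I * ξ)) ξ := fun n ξ =>
    contDiffAt_gammaPow_affine (ne_neg_nat_add ha n) 1 l (one_add_I_mul_mem (by simp))
  refine ⟨?_, ?_⟩
  · filter_upwards [hne] with ξ hξ
    exact (contDiff_gFun ha l (K + 1)).contDiffAt.sub (contDiffAt_const.mul (hsm ξ hξ.2))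
  -- Differentiating `k` times replaces `a + 1` by `a + 1 + k` in both functions, so the Taylor
  -- estimate is applied there.
  · obtain ⟨C, hC, h⟩ := exists_norm_sum_gammaPow_sub_le (ne_neg_nat_add ha k) l K
    refine IsBigO.of_bound (‖((Real.sqrt (2 * Real.pi))⁻¹ : ℂ)‖ * C) ?_
    filter_upwards [hne] with ξ hξ
    have e1 : iteratedDeriv k (fun ξ : ℝ => gFun a l (K + 1) ξ) ξ =
        ((Real.sqrt (2 * Real.pi))⁻¹ : ℂ) * ((-Complex.I) ^ k * ∑ n ∈ Finset.range (K + 1),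
          ((n.factorial : ℂ)⁻¹) * gammaPow l (a + 1 + k + n) (1 + Complex.I * ξ)) := by
      simp only [gFun]
      rw [iteratedDeriv_const_mul_field, iteratedDeriv_fun_sum
        fun n _ => contDiffAt_const.mul (hsm1 n ξ)]
      congr 1
      rw [Finset.mul_sum]
      refine Finset.sum_congr rfl fun n _ => ?_
      rw [iteratedDeriv_const_mul_field, iteratedDeriv_gammaPow_affine (ne_neg_nat_add ha n) 1 l k ξ
        (one_add_I_mul_mem (by simp)), add_right_comm]
      ring
    have e2 := iteratedDeriv_gammaPow_affine ha 0 l k ξ (hz ξ hξ.2)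
    simp only [zero_add] at e2
    have e3 := iteratedDeriv_sub (f := fun ξ : ℝ => gFun a l (K + 1) ξ)
      ((contDiff_gFun ha l (K + 1)).contDiffAt (x := ξ))
      (contDiffAt_const (c := ((Real.sqrt (2 * Real.pi))⁻¹ : ℂ)).mul (hsm ξ hξ.2))
    refine (congrArg norm e3).trans_le ?_
    rw [iteratedDeriv_const_mul_field, e1, e2, ← mul_sub, ← mul_sub, norm_mul, norm_mul, norm_pow,
      norm_neg, Complex.norm_I, one_pow, one_mul, Real.norm_of_nonneg (gauge_nonneg _ _ _),
      mul_assoc]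
    refine mul_le_mul_of_nonneg_left ((h ξ hξ.1).trans_eq ?_) (norm_nonneg _)
    congr 2
    simp only [Complex.add_re, Complex.natCast_re, Complex.one_re]
    ring

theorem gauge_le_pow (r : ℝ) (l : ℕ) {y : ℝ} (hy : 1 ≤ y) {m : ℕ} (hm : r ≤ m) :
    gauge r l y ≤ 2 ^ l * y ^ (m + l) := by
  have hy0 : 0 < y := by linarith
  unfold gauge
  rw [abs_of_pos hy0, abs_of_nonneg (Real.log_nonneg hy), pow_add]
  have h1 : y ^ r ≤ y ^ m := by
    rw [← Real.rpow_natCast]; exact Real.rpow_le_rpow_of_exponent_le hy hm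
  have h2 : 1 + Real.log y ≤ 2 * y := by
    have := Real.log_le_sub_one_of_pos hy0; linarith
  calc y ^ r * (1 + Real.log y) ^ l ≤ y ^ m * (2 * y) ^ l :=
        mul_le_mul h1 (pow_le_pow_left₀ (by linarith [Real.log_nonneg hy]) h2 l)
          (by have := Real.log_nonneg hy; positivity) (by positivity)
    _ = _ := by rw [mul_pow]; ring

/-- For `Im ζ ≤ 0` the real part of `1 + iζ` is at least one, so neither the logarithm nor a
negative power can blow up. -/
theorem exists_norm_gFun_le {a : ℂ} (ha : ∀ m : ℕ, a + 1 ≠ -m) (l K : ℕ) :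
    ∃ (C : ℝ) (m : ℕ), 0 ≤ C ∧ ∀ ζ : ℂ, ζ.im ≤ 0 → ‖gFun a l K ζ‖ ≤ C * (1 + ‖ζ‖) ^ m := by
  choose C hC h using fun n : ℕ => exists_norm_gammaPow_le (ne_neg_nat_add ha n) l
  obtain ⟨m, hm⟩ := exists_nat_ge (-(a + 1).re)
  refine ⟨‖((Real.sqrt (2 * Real.pi))⁻¹ : ℂ)‖ * ∑ n ∈ Finset.range K,
    ‖((n.factorial : ℂ)⁻¹)‖ * (C n * 2 ^ l), m + l, ?_, fun ζ hζ => ?_⟩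
  · exact mul_nonneg (norm_nonneg _) (Finset.sum_nonneg fun n _ =>
      mul_nonneg (norm_nonneg _) (mul_nonneg (hC n) (by positivity)))
  · rw [gFun, norm_mul, mul_assoc, Finset.sum_mul]
    refine mul_le_mul_of_nonneg_left ((norm_sum_le _ _).trans (Finset.sum_le_sum fun n _ => ?_))
      (norm_nonneg _)
    rw [norm_mul, mul_assoc]
    refine mul_le_mul_of_nonneg_left ?_ (norm_nonneg _)
    have hmem := one_add_I_mul_mem (by linarith : ζ.im < 1)
    have hlo : 1 ≤ ‖1 + Complex.I * ζ‖ := by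
      have := (le_abs_self _).trans (Complex.abs_re_le_norm (1 + Complex.I * ζ))
      simp at this; linarith
    have hhi : ‖1 + Complex.I * ζ‖ ≤ 1 + ‖ζ‖ := by
      refine (norm_add_le _ _).trans ?_
      simp
    have hre : -(a + 1 + n).re ≤ m := by
      refine le_trans ?_ hm
      simp only [Complex.add_re, Complex.natCast_re]
      linarith [(Nat.cast_nonneg n : (0 : ℝ) ≤ n)]
    calc ‖gammaPow l (a + 1 + n) (1 + Complex.I * ζ)‖
        ≤ C n * gauge (-(a + 1 + n).re) l ‖1 + Complex.I * ζ‖ :=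
          h n _ (Complex.slitPlane_ne_zero hmem)
      _ ≤ C n * (2 ^ l * ‖1 + Complex.I * ζ‖ ^ (m + l)) :=
          mul_le_mul_of_nonneg_left (gauge_le_pow _ l hlo hre) (hC n)
      _ ≤ C n * (2 ^ l * (1 + ‖ζ‖) ^ (m + l)) := by
          refine mul_le_mul_of_nonneg_left (mul_le_mul_of_nonneg_left ?_ (by positivity)) (hC n)
          exact pow_le_pow_left₀ (norm_nonneg _) hhi _
      _ = _ := by ring

theorem slowGrowth_gFun {a : ℂ} (ha : ∀ m : ℕ, a + 1 ≠ -m) (l K : ℕ) :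
    SlowGrowth fun ξ : ℝ => gFun a l K ξ := by
  obtain ⟨C, m, -, h⟩ := exists_norm_gFun_le ha l K
  refine slowGrowth_of_bound (contDiff_gFun ha l K (n := 0)).continuous.aestronglyMeasurable
    (C := C) (m := m) fun ξ => ?_
  simpa using h ξ (by simp)

/-! ### The distributions `x₊^a log^l x` -/

theorem zero_smul_distribution (T : 𝓢'(ℝ, ℂ)) : (0 : ℂ) • T = 0 := zero_smul ℂ T

/-- The coefficient `1 / ((b + 1) ⋯ (b + n))`. -/
def invPoch (n : ℕ) (b : ℂ) : ℂ := (∏ r ∈ Finset.range n, (b + r + 1))⁻¹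

theorem contDiffAt_invPoch {a : ℂ} (ha : ∀ m : ℕ, a + 1 ≠ -m) (n : ℕ) {k : ℕ∞ω} :
    ContDiffAt ℂ k (invPoch n) a := by
  have h : ContDiff ℂ k fun b : ℂ => ∏ r ∈ Finset.range n, (b + r + 1) :=
    contDiff_prod fun r _ => (contDiff_id.add contDiff_const).add contDiff_const
  refine h.contDiffAt.inv (Finset.prod_ne_zero_iff.2 fun r _ h0 => ha r ?_)
  linear_combination h0

theorem add_one_mul_invPoch_succ {b : ℂ} (hb : b + 1 ≠ 0) (n : ℕ) :
    (b + 1) * invPoch (n + 1) b = invPoch n (b + 1) := by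
  rw [invPoch, invPoch, Finset.prod_range_succ']
  have : ∏ r ∈ Finset.range n, (b + ((r + 1 : ℕ) : ℂ) + 1) =
      ∏ r ∈ Finset.range n, (b + 1 + r + 1) :=
    Finset.prod_congr rfl fun r _ => by push_cast; ring
  rw [this]
  simp only [Nat.cast_zero, add_zero, mul_inv]
  field_simp

theorem iteratedDeriv_invPoch {a : ℂ} (ha : ∀ m : ℕ, a + 1 ≠ -m) (n l : ℕ) :
    iteratedDeriv l (invPoch n) (a + 1) = (a + 1) * iteratedDeriv l (invPoch (n + 1)) a +
      l * iteratedDeriv (l - 1) (invPoch (n + 1)) a := by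
  rw [← iteratedDeriv_add_const_mul 1 (contDiffAt_invPoch ha (n + 1)),
    ← congrFun (iteratedDeriv_comp_add_const l (invPoch n) 1) a]
  refine EventuallyEq.iteratedDeriv_eq l ?_
  have h0 : a ≠ -1 := fun h => ha 0 (by simp [h])
  filter_upwards [eventually_ne_nhds h0] with b hb
  exact (add_one_mul_invPoch_succ (fun h => hb (by linear_combination h)) n).symm

theorem xPosLog_eq (a : ℂ) (l : ℕ) {n : ℕ} (hn : ⌊-a.re⌋₊ = n) :
    xPosLog a l = ∑ i ∈ Finset.range (l + 1),
      ((l.choose i : ℂ) * iteratedDeriv (l - i) (invPoch n) a) •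
        (TemperedDistribution.derivCLM ℂ)^[n] (regular (zeroExt (powLog (a + n) i))) := by
  subst hn; rfl

theorem xPosLog_of_re_gt {a : ℂ} (ha : -1 < a.re) (l : ℕ) :
    xPosLog a l = regular (zeroExt (powLog a l)) := by
  have hn : ⌊-a.re⌋₊ = 0 := Nat.floor_eq_zero.2 (by linarith)
  have h1 : invPoch 0 = fun _ => 1 := by funext b; simp [invPoch]
  rw [xPosLog_eq a l hn, Finset.sum_range_succ, Finset.sum_eq_zero, h1]
  · simp
  · intro i hi
    have : l - i ≠ 0 := by have := Finset.mem_range.1 hi; omega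
    rw [h1, iteratedDeriv_const, if_neg this, mul_zero, zero_smul_distribution]

/-- This is `∂_x x₊^{a+1} = (a+1) x₊^a` differentiated `l` times in `a`. For `Re a ≤ -1` the
defining number of derivatives is one larger for `a` than for `a + 1`, so both sides are
combinations of the same distributions `T i` and only the coefficients have to be compared. -/
theorem derivCLM_xPosLog {a : ℂ} (ha : ∀ m : ℕ, a + 1 ≠ -m) (hre : a.re ≤ -1) (l : ℕ) :
    TemperedDistribution.derivCLM ℂ (xPosLog (a + 1) l) =
      (a + 1) • xPosLog a l + (l : ℂ) • xPosLog a (l - 1) := by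
  set n := ⌊-(a + 1).re⌋₊ with hn
  have hn' : ⌊-a.re⌋₊ = n + 1 := by
    have : -a.re = -(a + 1).re + 1 := by simp
    rw [this, Nat.floor_add_one]
    simp; linarith
  set T : ℕ → 𝓢'(ℝ, ℂ) := fun i => (TemperedDistribution.derivCLM ℂ)^[n + 1]
    (regular (zeroExt (powLog (a + (n + 1 : ℕ)) i))) with hT
  have e1 : TemperedDistribution.derivCLM ℂ (xPosLog (a + 1) l) = ∑ i ∈ Finset.range (l + 1),
      ((l.choose i : ℂ) * iteratedDeriv (l - i) (invPoch n) (a + 1)) • T i := by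
    rw [xPosLog_eq (a + 1) l hn.symm, map_sum]
    refine Finset.sum_congr rfl fun i _ => ?_
    rw [map_smul, hT]
    simp only [Function.iterate_succ_apply']
    rw [show a + 1 + (n : ℂ) = a + (n + 1 : ℕ) by push_cast; ring]
  have e2 : ∀ l, xPosLog a l = ∑ i ∈ Finset.range (l + 1),
      ((l.choose i : ℂ) * iteratedDeriv (l - i) (invPoch (n + 1)) a) • T i :=
    fun l => xPosLog_eq a l hn'
  rw [e1, e2 l, Finset.smul_sum]
  have e3 : (l : ℂ) • xPosLog a (l - 1) = ∑ i ∈ Finset.range (l + 1),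
      ((l.choose i : ℂ) * ((l - i : ℕ) : ℂ) * iteratedDeriv (l - i - 1) (invPoch (n + 1)) a) •
        T i := by
    cases l with
    | zero => simp [zero_smul_distribution]
    | succ l =>
      rw [Finset.sum_range_succ, Nat.add_sub_cancel, e2 l, Finset.smul_sum]
      simp only [Nat.sub_self, Nat.cast_zero, mul_zero, zero_mul, zero_smul_distribution, add_zero]
      refine Finset.sum_congr rfl fun i hi => ?_
      have hi : i ≤ l := Nat.lt_succ_iff.1 (Finset.mem_range.1 hi)
      have hc : (((l + 1).choose i : ℂ) * ((l + 1 - i : ℕ) : ℂ)) = l.choose i * (l + 1 : ℕ) := by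
        exact_mod_cast (Nat.choose_mul_succ_eq l i).symm
      rw [smul_smul, hc, show l + 1 - i - 1 = l - i by omega]
      congr 1; ring
  rw [e3, ← Finset.sum_add_distrib]
  refine Finset.sum_congr rfl fun i _ => ?_
  rw [smul_smul, ← add_smul, iteratedDeriv_invPoch ha]
  congr 1; ring

/-! ### Regularized powers and their Fourier transforms -/

/-- The function `x^a log^l x (e^{-x} ∑_{n < K} x^n / n! - 1)`. -/
def tailFn (a : ℂ) (l K : ℕ) (x : ℝ) : ℂ := powLog a l x * (expTail K x - 1)

/-- The function `x^a log^l x e^{-x} ∑_{n < K} x^n / n!`. -/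
def modelFn (a : ℂ) (l K : ℕ) (x : ℝ) : ℂ := powLog a l x * expTail K x

/-- The distribution `x₊^a log^l x e^{-x} ∑_{n < K} x^n / n!`, regularized at zero. -/
def modelDist (a : ℂ) (l K : ℕ) : 𝓢'(ℝ, ℂ) :=
  xPosLog a l + regular (zeroExt (tailFn a l K))

theorem continuousOn_tailFn (a : ℂ) (l K : ℕ) : ContinuousOn (tailFn a l K) (Set.Ioi 0) :=
  (continuousOn_powLog a l).mul
    ((contDiff_expTail K (n := 0)).continuous.sub continuous_const).continuousOn

theorem continuousOn_modelFn (a : ℂ) (l K : ℕ) : ContinuousOn (modelFn a l K) (Set.Ioi 0) :=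
  (continuousOn_powLog a l).mul (contDiff_expTail K (n := 0)).continuous.continuousOn

theorem tailFn_isBigO_zero (a : ℂ) (l K : ℕ) : tailFn a l K =O[𝓝[>] 0] gauge (a.re + K) l := by
  have h := (symAt_zero_powLog_mul_expTail_sub_one a l K 0).bound
  simp only [iteratedDeriv_zero, CharP.cast_eq_zero, sub_zero] at h
  exact h

theorem powLog_isBigO_top (a : ℂ) (l : ℕ) : powLog a l =O[atTop] gauge a.re l := by
  refine IsBigO.of_bound 1 ?_
  filter_upwards [eventually_gt_atTop 0] with x hx
  rw [norm_powLog a l hx, Real.norm_of_nonneg (gauge_nonneg _ _ _), one_mul, gauge,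
    abs_of_pos hx]
  exact mul_le_mul_of_nonneg_left (pow_le_pow_left₀ (abs_nonneg _) (by linarith) _)
    (by positivity)

theorem powLog_isBigO_zero (a : ℂ) (l : ℕ) : powLog a l =O[𝓝[>] 0] gauge a.re l := by
  simpa using (symAt_zero_powLog a l 0).bound

theorem modelFn_isBigO_top (a : ℂ) (l K : ℕ) (r : ℝ) : modelFn a l K =O[atTop] gauge r 0 := by
  have h := (symAt_top_powLog_mul_expTail a l K 0 r).bound
  simp only [iteratedDeriv_zero, CharP.cast_eq_zero, sub_zero] at h
  exact h

theorem tailFn_eq (a : ℂ) (l K : ℕ) :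
    tailFn a l K = fun x => modelFn a l K x - powLog a l x := by
  funext x; simp [tailFn, modelFn, mul_sub]

theorem tailFn_isBigO_top (a : ℂ) (l K : ℕ) : tailFn a l K =O[atTop] gauge a.re l := by
  rw [tailFn_eq]
  exact ((modelFn_isBigO_top a l K a.re).trans
    (gauge_isBigO_of_le _ (Nat.zero_le l) _)).sub (powLog_isBigO_top a l)

theorem slowGrowth_tailFn {a : ℂ} {K : ℕ} (h : -1 < a.re + K) (l : ℕ) :
    SlowGrowth (zeroExt (tailFn a l K)) :=
  slowGrowth_zeroExt (continuousOn_tailFn a l K) h (tailFn_isBigO_zero a l K)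
    (tailFn_isBigO_top a l K)

theorem slowGrowth_powLog {a : ℂ} (h : -1 < a.re) (l : ℕ) : SlowGrowth (zeroExt (powLog a l)) :=
  slowGrowth_zeroExt (continuousOn_powLog a l) h (powLog_isBigO_zero a l) (powLog_isBigO_top a l)

theorem integrable_modelFn {a : ℂ} (h : -1 < a.re) (l K : ℕ) :
    Integrable (zeroExt (modelFn a l K)) := by
  refine integrable_zeroExt (continuousOn_modelFn a l K) h (μ := l) ?_ (s := -2) (by norm_num)
    (modelFn_isBigO_top a l K (-2))
  have := (powLog_isBigO_zero a l).mul
    ((((contDiff_expTail K (n := 0)).continuous.tendsto 0).mono_left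
      (nhdsWithin_le_nhds (s := Set.Ioi 0))).isBigO_one ℝ)
  simp only [mul_one] at this
  exact this

theorem modelDist_of_re_gt {a : ℂ} (ha : -1 < a.re) (l K : ℕ) :
    modelDist a l K = regular (zeroExt (modelFn a l K)) := by
  have hK : -1 < a.re + K := by linarith [(Nat.cast_nonneg K : (0 : ℝ) ≤ K)]
  rw [modelDist, xPosLog_of_re_gt ha, ← regular_add (slowGrowth_powLog ha l)
    (slowGrowth_tailFn hK l), ← zeroExt_add]
  congr 2; funext x
  simp [tailFn_eq]

theorem fourierFn_modelFn {a : ℂ} (ha : -1 < a.re) (l K : ℕ) (ξ : ℝ) :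
    fourierFn (zeroExt (modelFn a l K)) ξ = gFun a l K ξ := by
  rw [fourierFn, gFun, integral_mul_zeroExt]
  congr 1
  have hz : (0 : ℝ) < (1 + Complex.I * (ξ : ℂ)).re := by simp
  have hn : ∀ n : ℕ, -1 < (a + n).re := fun n => by
    simp; linarith [(Nat.cast_nonneg n : (0 : ℝ) ≤ n)]
  have h : ∀ x ∈ Set.Ioi (0 : ℝ), Complex.exp (-Complex.I * x * ξ) * modelFn a l K x =
      ∑ n ∈ Finset.range K, ((n.factorial : ℂ)⁻¹) *
        (powLog (a + n) l x * Complex.exp (-((1 + Complex.I * ξ) * x))) := fun x hx => by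
    rw [modelFn, expTail, Finset.mul_sum, Finset.mul_sum, Finset.mul_sum]
    refine Finset.sum_congr rfl fun n _ => ?_
    have hx0 : (x : ℂ) ≠ 0 := by exact_mod_cast (ne_of_gt hx)
    have h1 : Complex.exp (-((1 + Complex.I * ξ) * x)) =
        Complex.exp (-Complex.I * x * ξ) * Complex.exp (-x) := by
      rw [← Complex.exp_add]; congr 1; ring
    rw [h1, powLog, powLog, Complex.cpow_add _ _ hx0, Complex.cpow_natCast]
    ring
  rw [setIntegral_congr_fun measurableSet_Ioi h, integral_finsetSum _ fun n _ =>
    (integrableOn_powLog_mul_exp (hn n) hz l).const_mul _]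
  refine Finset.sum_congr rfl fun n _ => ?_
  rw [integral_const_mul, integral_powLog_mul_exp (hn n) hz, add_right_comm]

theorem hasDerivAt_tailFn (a : ℂ) (l K : ℕ) {x : ℝ} (hx : 0 < x) :
    HasDerivAt (tailFn (a + 1) l (K + 1)) ((a + 1) * tailFn a l (K + 1) x +
      l * tailFn a (l - 1) (K + 1) x -
        (K.factorial : ℂ)⁻¹ * (powLog (a + 1 + K) l x * expTail 1 x)) x := by
  have h := (hasDerivAt_powLog (a + 1) l hx).mul ((hasDerivAt_expTail_succ K x).sub_const 1)
  refine h.congr_deriv ?_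
  have hx0 : (x : ℂ) ≠ 0 := by exact_mod_cast hx.ne'
  simp only [tailFn, add_sub_cancel_right]
  rw [show powLog (a + 1 + K) l x = powLog (a + 1) l x * (x : ℂ) ^ K by
    rw [powLog, powLog, Complex.cpow_add _ _ hx0, Complex.cpow_natCast]; ring]
  simp only [expTail, Finset.range_one, Finset.sum_singleton, pow_zero, Nat.factorial_zero,
    Nat.cast_one, div_one, mul_one]
  ring

/-- The image of `derivCLM_modelDist` on the Fourier side. With `z = 1 + iξ` one has `iξ = z - 1`;
the factor `z` acts through `mul_gammaPow_add_one`, and subtracting the sum itself cancels all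
shifted terms except the top one. -/
theorem I_mul_gFun {a : ℂ} (ha : ∀ m : ℕ, a + 1 ≠ -m) (l K : ℕ) (ξ : ℝ) :
    Complex.I * (ξ * gFun (a + 1) l (K + 1) ξ) = (a + 1) * gFun a l (K + 1) ξ +
      l * gFun a (l - 1) (K + 1) ξ - (K.factorial : ℂ)⁻¹ * gFun (a + 1 + K) l 1 ξ := by
  simp only [gFun]
  set c := ((Real.sqrt (2 * Real.pi))⁻¹ : ℂ)
  set z : ℂ := 1 + Complex.I * (ξ : ℂ) with hz
  have hz0 : z ≠ 0 := Complex.slitPlane_ne_zero (one_add_I_mul_mem (by simp))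
  have hM : ∀ (n l : ℕ), z * gammaPow l (a + 1 + (n + 1 : ℕ)) z =
      (a + 1 + n) * gammaPow l (a + 1 + n) z + l * gammaPow (l - 1) (a + 1 + n) z := fun n l => by
    have := mul_gammaPow_add_one (ne_neg_nat_add ha n) hz0 l
    rw [← this]; push_cast; rw [← add_assoc (a + 1)]
  have key : (z - 1) * ∑ n ∈ Finset.range (K + 1), ((n.factorial : ℂ)⁻¹) *
        gammaPow l (a + 1 + (n + 1 : ℕ)) z =
      (a + 1) * ∑ n ∈ Finset.range (K + 1), ((n.factorial : ℂ)⁻¹) * gammaPow l (a + 1 + n) z +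
      l * ∑ n ∈ Finset.range (K + 1), ((n.factorial : ℂ)⁻¹) * gammaPow (l - 1) (a + 1 + n) z -
      (K.factorial : ℂ)⁻¹ * gammaPow l (a + 1 + (K + 1 : ℕ)) z := by
    induction K with
    | zero =>
      have := hM 0 l
      simp only [zero_add, Finset.range_one, Finset.sum_singleton, Nat.factorial_zero,
        Nat.cast_one, inv_one, one_mul, Nat.cast_zero, add_zero] at this ⊢
      linear_combination this
    | succ K ih =>
      rw [Finset.sum_range_succ _ (K + 1), mul_add, ih, Finset.sum_range_succ _ (K + 1),
        Finset.sum_range_succ _ (K + 1)]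
      have h := hM (K + 1) l
      have hK : (K.factorial : ℂ) ≠ 0 := by exact_mod_cast K.factorial_ne_zero
      have hK' : (K : ℂ) + 1 ≠ 0 := by exact_mod_cast K.succ_ne_zero
      have hf : ((K + 1).factorial : ℂ) = (K + 1) * K.factorial := by
        rw [Nat.factorial_succ]; push_cast; ring
      have hf' : (K.factorial : ℂ)⁻¹ = (K + 1) * ((K + 1).factorial : ℂ)⁻¹ := by
        rw [hf]; field_simp
      rw [hf']
      push_cast at h ⊢
      linear_combination ((K + 1).factorial : ℂ)⁻¹ * h
  have e1 : ∀ n : ℕ, a + 1 + 1 + (n : ℂ) = a + 1 + (n + 1 : ℕ) := fun n => by push_cast; ring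
  have e2 : a + 1 + (K : ℂ) + 1 + ((0 : ℕ) : ℂ) = a + 1 + (K + 1 : ℕ) := by push_cast; ring
  simp only [e1, Finset.range_one, Finset.sum_singleton, e2, Nat.factorial_zero, Nat.cast_one,
    inv_one, one_mul]
  have e3 : Complex.I * (ξ : ℂ) = z - 1 := by rw [hz]; ring
  linear_combination c * key + c * (∑ n ∈ Finset.range (K + 1), ((n.factorial : ℂ)⁻¹) *
        gammaPow l (a + 1 + (n + 1 : ℕ)) z) * e3

theorem derivCLM_modelDist {a : ℂ} (ha : ∀ m : ℕ, a + 1 ≠ -m) (hre : a.re ≤ -1) {K : ℕ}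
    (hK : -1 < a.re + (K + 1 : ℕ)) (l : ℕ) :
    TemperedDistribution.derivCLM ℂ (modelDist (a + 1) l (K + 1)) =
      (a + 1) • modelDist a l (K + 1) + (l : ℂ) • modelDist a (l - 1) (K + 1) -
        (K.factorial : ℂ)⁻¹ • regular (zeroExt (modelFn (a + 1 + K) l 1)) := by
  have hre1 : -1 < (a + 1 + K).re := by
    push_cast at hK; simp; linarith
  have hK1 : 0 < (a + 1).re + (K + 1 : ℕ) := by
    push_cast at hK ⊢; simp; linarith
  have s1 := (slowGrowth_tailFn hK l).const_mul (a + 1)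
  have s2 := (slowGrowth_tailFn hK (l - 1)).const_mul (l : ℂ)
  have s3 := (slowGrowth_of_integrable (integrable_modelFn hre1 l 1)).const_mul
    (K.factorial : ℂ)⁻¹
  have hfun : zeroExt (fun x => (a + 1) * tailFn a l (K + 1) x + l * tailFn a (l - 1) (K + 1) x -
      (K.factorial : ℂ)⁻¹ * (powLog (a + 1 + K) l x * expTail 1 x)) = fun x =>
      ((a + 1) * zeroExt (tailFn a l (K + 1)) x + l * zeroExt (tailFn a (l - 1) (K + 1)) x) -
        (K.factorial : ℂ)⁻¹ * zeroExt (modelFn (a + 1 + K) l 1) x := by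
    funext x; by_cases h : 0 < x <;> simp [zeroExt, h, modelFn]
  -- The function is of order `Re (a + 1) + K + 1 > 0` at the origin, up to logarithms, so it tends
  -- to zero and its derivative has no point mass.
  have hd := derivCLM_regular_zeroExt (fun x hx => hasDerivAt_tailFn a l K hx)
    (slowGrowth_tailFn (by linarith) l) (by rw [hfun]; exact (s1.add s2).sub s3) (by
      have h1 := (tailFn_isBigO_zero (a + 1) l (K + 1)).trans
        (gauge_absorb_zero (half_lt_self hK1) l)
      refine h1.trans_tendsto ?_
      rw [gauge_zero_right]
      have h2 : Tendsto (fun x : ℝ => |x| ^ (((a + 1).re + (K + 1 : ℕ)) / 2)) (𝓝 0) (𝓝 0) := by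
        have hc : Continuous fun x : ℝ => |x| ^ (((a + 1).re + (K + 1 : ℕ)) / 2) :=
          continuous_abs.rpow_const fun x => Or.inr (by positivity)
        exact hc.tendsto' 0 0 (by rw [abs_zero, Real.zero_rpow (by positivity)])
      exact h2.mono_left nhdsWithin_le_nhds)
  rw [modelDist, map_add, derivCLM_xPosLog ha hre, hd, hfun, regular_sub (s1.add s2) s3,
    regular_add s1 s2, regular_const_mul _ (slowGrowth_tailFn hK l),
    regular_const_mul _ (slowGrowth_tailFn hK (l - 1)),
    regular_const_mul _ (slowGrowth_of_integrable (integrable_modelFn hre1 l 1)), modelDist,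
    modelDist, smul_add, smul_add]
  abel

theorem fourierD_modelDist_of_re_gt {a : ℂ} (ha : -1 < a.re) (l K : ℕ) :
    fourierD (modelDist a l K) = regular fun ξ : ℝ => gFun a l K ξ := by
  rw [modelDist_of_re_gt ha, fourierD_regular (integrable_modelFn ha l K)]
  congr 1; funext ξ
  exact fourierFn_modelFn ha l K ξ

/-- Outer induction on the number `d` of unit steps that bring `Re a` into the integrable range,
inner induction on `l`. Differentiating the model for `a + 1` gives `a + 1` times the model for `a`,
a model with fewer logarithms and an integrable one; the transforms satisfy the same relation by
`I_mul_gFun`. -/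
theorem fourierD_modelDist_aux (d : ℕ) : ∀ (a : ℂ), (∀ m : ℕ, a + 1 ≠ -m) → -1 < a.re + d →
    ∀ (K : ℕ), -1 < a.re + (K + 1 : ℕ) → ∀ l : ℕ,
      fourierD (modelDist a l (K + 1)) = regular fun ξ : ℝ => gFun a l (K + 1) ξ := by
  induction d with
  | zero =>
    intro a _ had K _ l
    exact fourierD_modelDist_of_re_gt (by simpa using had) l (K + 1)
  | succ d ih =>
    intro a ha had K hK
    rcases lt_or_ge (-1) a.re with hre | hre
    · intro l; exact fourierD_modelDist_of_re_gt hre l (K + 1)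
    -- The relation is solved for the model with exponent `a` by cancelling `a + 1`, which is why
    -- negative integers must be excluded.
    have ha1 : a + 1 ≠ 0 := fun h => ha 0 (by simpa using h)
    have had' : -1 < (a + 1).re + d := by push_cast at had; simp; linarith
    have hKa : -1 < (a + 1).re + (K + 1 : ℕ) := by simp at hK ⊢; linarith
    have hre1 : -1 < (a + 1 + K).re := by push_cast at hK; simp; linarith
    have ha' : ∀ m : ℕ, a + 1 + 1 ≠ -m := ne_neg_nat_add_one ha
    have haK : ∀ m : ℕ, a + 1 + K + 1 ≠ -m := ne_neg_nat_add_one (ne_neg_nat_add ha K)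
    intro l
    induction l with
    | zero =>
      have h1 := fourierD_derivCLM (slowGrowth_gFun ha' 0 (K + 1)) (ih (a + 1) ha' had' K hKa 0)
      have h2 := derivCLM_modelDist ha hre hK 0
      rw [h2, map_sub, map_add, map_smul, map_smul, map_smul,
        ← modelDist_of_re_gt hre1, fourierD_modelDist_of_re_gt hre1] at h1
      have h3 : (regular fun ξ : ℝ => Complex.I * ((ξ : ℂ) * gFun (a + 1) 0 (K + 1) ξ)) =
          (a + 1) • (regular fun ξ : ℝ => gFun a 0 (K + 1) ξ) -
            (K.factorial : ℂ)⁻¹ • regular fun ξ : ℝ => gFun (a + 1 + K) 0 1 ξ := by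
        rw [← regular_const_mul _ (slowGrowth_gFun ha 0 (K + 1)),
          ← regular_const_mul _ (slowGrowth_gFun haK 0 1),
          ← regular_sub ((slowGrowth_gFun ha 0 (K + 1)).const_mul _)
            ((slowGrowth_gFun haK 0 1).const_mul _)]
        congr 1; funext ξ
        rw [I_mul_gFun ha]; simp
      rw [h3] at h1
      simp only [Nat.cast_zero, zero_smul_distribution, add_zero, sub_left_inj] at h1
      exact smul_right_injective _ ha1 h1
    | succ l ihl =>
      have h1 := fourierD_derivCLM (slowGrowth_gFun ha' (l + 1) (K + 1))
        (ih (a + 1) ha' had' K hKa (l + 1))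
      have h2 := derivCLM_modelDist ha hre hK (l + 1)
      rw [h2, map_sub, map_add, map_smul, map_smul, map_smul, Nat.add_sub_cancel, ihl,
        ← modelDist_of_re_gt hre1, fourierD_modelDist_of_re_gt hre1] at h1
      have h3 : (regular fun ξ : ℝ => Complex.I * ((ξ : ℂ) * gFun (a + 1) (l + 1) (K + 1) ξ)) =
          (a + 1) • (regular fun ξ : ℝ => gFun a (l + 1) (K + 1) ξ) +
            ((l + 1 : ℕ) : ℂ) • (regular fun ξ : ℝ => gFun a l (K + 1) ξ) -
            (K.factorial : ℂ)⁻¹ • regular fun ξ : ℝ => gFun (a + 1 + K) (l + 1) 1 ξ := by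
        rw [← regular_const_mul _ (slowGrowth_gFun ha (l + 1) (K + 1)),
          ← regular_const_mul _ (slowGrowth_gFun ha l (K + 1)),
          ← regular_const_mul _ (slowGrowth_gFun haK (l + 1) 1),
          ← regular_add ((slowGrowth_gFun ha (l + 1) (K + 1)).const_mul _)
            ((slowGrowth_gFun ha l (K + 1)).const_mul _),
          ← regular_sub (((slowGrowth_gFun ha (l + 1) (K + 1)).const_mul _).add
            ((slowGrowth_gFun ha l (K + 1)).const_mul _)) ((slowGrowth_gFun haK (l + 1) 1).const_mul _)]
        congr 1; funext ξ
        rw [I_mul_gFun ha]; simp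
      rw [h3, sub_left_inj, add_left_inj] at h1
      exact smul_right_injective _ ha1 h1

theorem fourierD_modelDist {a : ℂ} (ha : ∀ m : ℕ, a + 1 ≠ -m) {K : ℕ}
    (hK : -1 < a.re + (K + 1 : ℕ)) (l : ℕ) :
    fourierD (modelDist a l (K + 1)) = regular fun ξ : ℝ => gFun a l (K + 1) ξ :=
  let ⟨d, hd⟩ := exists_nat_gt (-1 - a.re)
  fourierD_modelDist_aux d a ha (by linarith) K hK l

/-! ### Regularity of the extension by zero -/

theorem contDiffOn_iteratedDeriv {r : ℝ → ℂ} (hr : ContDiffOn ℝ ∞ r (Set.Ioi 0)) (k : ℕ) :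
    ContDiffOn ℝ ∞ (iteratedDeriv k r) (Set.Ioi 0) := by
  induction k with
  | zero => simpa using hr
  | succ k ih =>
    rw [iteratedDeriv_succ]
    exact ((contDiffOn_infty_iff_deriv_of_isOpen isOpen_Ioi).1 ih).2

theorem hasDerivAt_iteratedDeriv {r : ℝ → ℂ} (hr : ContDiffOn ℝ ∞ r (Set.Ioi 0)) (k : ℕ) {x : ℝ}
    (hx : 0 < x) : HasDerivAt (iteratedDeriv k r) (iteratedDeriv (k + 1) r x) x := by
  rw [iteratedDeriv_succ]
  exact (((contDiffOn_iteratedDeriv hr k).differentiableOn (by simp)).differentiableAt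
    (isOpen_Ioi.mem_nhds hx)).hasDerivAt

/-- The condition `q = o(x)` gives the extension the derivative `0` at the origin from the right as
well as from the left. -/
theorem hasDerivAt_zeroExt {q q' : ℝ → ℂ} (hd : ∀ x, 0 < x → HasDerivAt q (q' x) x)
    (h0 : q =o[𝓝[>] 0] fun x : ℝ => x) (x : ℝ) : HasDerivAt (zeroExt q) (zeroExt q' x) x := by
  rcases lt_trichotomy x 0 with hx | rfl | hx
  · have h1 : zeroExt q' x = 0 := by simp [zeroExt, not_lt.2 hx.le]
    rw [h1]
    refine (hasDerivAt_const x (0 : ℂ)).congr_of_eventuallyEq ?_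
    filter_upwards [eventually_lt_nhds hx] with y hy
    simp [zeroExt, not_lt.2 hy.le]
  · have h1 : ∀ q : ℝ → ℂ, zeroExt q 0 = 0 := fun q => by simp [zeroExt]
    rw [hasDerivAt_iff_isLittleO, h1, h1]
    simp only [sub_zero, smul_zero]
    rw [isLittleO_iff] at h0 ⊢
    intro c hc
    have := eventually_nhdsWithin_iff.1 (h0 hc)
    filter_upwards [this] with y hy
    by_cases hy0 : 0 < y
    · simpa [zeroExt, hy0] using hy hy0
    · simp [zeroExt, hy0]; positivity
  · have h1 : zeroExt q' x = q' x := by simp [zeroExt, hx]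
    rw [h1]
    refine (hd x hx).congr_of_eventuallyEq ?_
    filter_upwards [eventually_gt_nhds hx] with y hy
    simp [zeroExt, hy]

theorem gauge_isLittleO_id {r : ℝ} (hr : 1 < r) (μ : ℕ) :
    gauge r μ =o[𝓝[>] 0] fun x : ℝ => x := by
  obtain ⟨r', h1, h2⟩ := exists_between hr
  refine (gauge_absorb_zero h2 μ).trans_isLittleO ?_
  have hc : Continuous fun x : ℝ => |x| ^ (r' - 1) :=
    continuous_abs.rpow_const fun x => Or.inr (by linarith)
  have ht : Tendsto (fun x : ℝ => |x| ^ (r' - 1)) (𝓝[>] 0) (𝓝 0) :=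
    (hc.tendsto' 0 0 (by rw [abs_zero, Real.zero_rpow (by linarith)])).mono_left
      nhdsWithin_le_nhds
  have h3 := ((isLittleO_one_iff ℝ).2 ht).mul_isBigO
    (isBigO_refl (fun x : ℝ => x) (𝓝[>] (0 : ℝ)))
  refine h3.congr' ?_ (Eventually.of_forall fun x => by simp)
  filter_upwards [self_mem_nhdsWithin] with x hx
  have hx : 0 < x := hx
  rw [gauge_zero_right]
  simp only [abs_of_pos hx]
  rw [Real.rpow_sub_one hx.ne']
  field_simp

/-- Before each differentiation the order of vanishing at the origin is `s - k > 1`, so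
`hasDerivAt_zeroExt` applies and differentiation commutes with extension by zero. -/
theorem iteratedDeriv_zeroExt {r : ℝ → ℂ} (hr : ContDiffOn ℝ ∞ r (Set.Ioi 0)) {s : ℝ} {μ M : ℕ}
    (hs : M < s) (h0 : ∀ k, SymAt (𝓝[>] 0) k s μ r) (k : ℕ) (hk : k ≤ M) :
    iteratedDeriv k (zeroExt r) = zeroExt (iteratedDeriv k r) := by
  induction k with
  | zero => simp
  | succ k ih =>
    rw [iteratedDeriv_succ, ih (by omega)]
    funext x
    refine (hasDerivAt_zeroExt (fun y hy => hasDerivAt_iteratedDeriv hr k hy) ?_ x).deriv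
    have hkM : (k : ℝ) + 1 ≤ M := by exact_mod_cast hk
    exact (h0 k).bound.trans_isLittleO (gauge_isLittleO_id (by linarith) μ)

theorem contDiff_zeroExt {r : ℝ → ℂ} (hr : ContDiffOn ℝ ∞ r (Set.Ioi 0)) {s : ℝ} {μ M : ℕ}
    (hs : M + 1 < s) (h0 : ∀ k, SymAt (𝓝[>] 0) k s μ r) : ContDiff ℝ M (zeroExt r) := by
  refine contDiff_of_differentiable_iteratedDeriv (n := (M : ℕ∞)) fun k hk => ?_
  have hk : k ≤ M := by exact_mod_cast hk
  have hkM : (k : ℝ) ≤ M := by exact_mod_cast hk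
  rw [iteratedDeriv_zeroExt hr (by linarith) h0 k hk]
  exact fun x => (hasDerivAt_zeroExt (fun y hy => hasDerivAt_iteratedDeriv hr k hy)
    ((h0 k).bound.trans_isLittleO (gauge_isLittleO_id (by linarith) μ)) x).differentiableAt

theorem integrable_pow_mul_zeroExt_iteratedDeriv {r : ℝ → ℂ} (hr : ContDiffOn ℝ ∞ r (Set.Ioi 0))
    {s : ℝ} {μ k : ℕ} (hs : -1 < s - k) (h0 : SymAt (𝓝[>] 0) k s μ r)
    (h1 : ∀ ρ, SymAt atTop k ρ 0 r) (n : ℕ) :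
    Integrable fun x => ‖x‖ ^ n * ‖zeroExt (iteratedDeriv k r) x‖ := by
  have hc : Continuous fun x : ℝ => (x : ℂ) ^ n := by fun_prop
  have hb0 := (((hc.tendsto 0).mono_left (nhdsWithin_le_nhds (s := Set.Ioi 0))).isBigO_one ℝ).mul
    h0.bound
  simp only [one_mul] at hb0
  have hn : (fun x : ℝ => (x : ℂ) ^ n) =O[atTop] gauge n 0 := by
    refine IsBigO.of_bound 1 (Eventually.of_forall fun x => ?_)
    rw [gauge_zero_right]; simp
  have hb1 : (fun x : ℝ => (x : ℂ) ^ n * iteratedDeriv k r x) =O[atTop] gauge (-2) 0 := by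
    refine (hn.mul (h1 (-2 - n + k)).bound).congr' EventuallyEq.rfl ?_
    filter_upwards [eventually_gt_atTop 0] with x hx
    rw [gauge_mul hx.ne']; congr 1; ring
  have := (integrable_zeroExt (hc.continuousOn.mul (contDiffOn_iteratedDeriv hr k).continuousOn)
    hs hb0 (by norm_num) hb1).norm
  refine this.congr (Eventually.of_forall fun x => ?_)
  by_cases hx : 0 < x <;> simp [zeroExt, hx]

/-! ### Smoothness and decay of Fourier transforms -/

theorem contDiff_fourierFn {f : ℝ → ℂ} {N : ℕ}
    (h : ∀ n ≤ N, Integrable fun x => ‖x‖ ^ n * ‖f x‖) : ContDiff ℝ N (fourierFn f) := by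
  rw [fourierFn_eq]
  exact contDiff_const.mul (VectorFourier.contDiff_fourierIntegral scaledMul (N := N)
    fun n hn => h n (by exact_mod_cast hn))

theorem exists_pow_mul_iteratedDeriv_fourierFn_le {f : ℝ → ℂ} {k n : ℕ} (hf : ContDiff ℝ n f)
    (h : ∀ i ≤ k, ∀ j ≤ n, Integrable fun x => ‖x‖ ^ i * ‖iteratedDeriv j f x‖) :
    ∃ C, ∀ ξ : ℝ, |ξ| ^ n * ‖iteratedDeriv k (fourierFn f) ξ‖ ≤ C := by
  -- The estimate is tested on the vector `2π`, whose pairing with `ξ` is exactly `ξ`.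
  have hb := VectorFourier.pow_mul_norm_iteratedFDeriv_fourierIntegral_le scaledMul
    (f := f) (μ := volume) (K := k) (N := n) hf
    (fun i j hi hj => by
      simpa only [norm_iteratedFDeriv_eq_norm_iteratedDeriv] using
        h i (by exact_mod_cast hi) j (by exact_mod_cast hj)) le_rfl le_rfl (2 * Real.pi)
  refine ⟨‖((Real.sqrt (2 * Real.pi))⁻¹ : ℂ)‖ * (‖2 * Real.pi‖ ^ n *
    (2 * Real.pi * ‖scaledMul‖) ^ k * (2 * (k : ℝ) + 2) ^ n *
      ∑ p ∈ Finset.range (k + 1) ×ˢ Finset.range (n + 1),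
        ∫ v : ℝ, ‖v‖ ^ p.1 * ‖iteratedFDeriv ℝ p.2 f v‖), fun ξ => ?_⟩
  rw [fourierFn_eq, iteratedDeriv_const_mul_field, norm_mul, mul_left_comm]
  refine mul_le_mul_of_nonneg_left ?_ (norm_nonneg _)
  have h1 := hb ξ
  rw [scaledMul_apply, norm_iteratedFDeriv_eq_norm_iteratedDeriv] at h1
  have h2 : (2 * Real.pi)⁻¹ * (2 * Real.pi * ξ) = ξ := by
    have := Real.pi_pos
    field_simp
  rw [h2] at h1
  exact h1

theorem integrable_pow_mul_zeroExt {r : ℝ → ℂ} (hr : ContDiffOn ℝ ∞ r (Set.Ioi 0))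
    {s : ℝ} {μ : ℕ} (hs : -1 < s) (h0 : SymAt (𝓝[>] 0) 0 s μ r)
    (h1 : ∀ ρ, SymAt atTop 0 ρ 0 r) (n : ℕ) :
    Integrable fun x => ‖x‖ ^ n * ‖zeroExt r x‖ := by
  simpa using integrable_pow_mul_zeroExt_iteratedDeriv hr (by simpa using hs) h0 h1 n

theorem integrable_zeroExt_of_symAt {r : ℝ → ℂ} (hr : ContDiffOn ℝ ∞ r (Set.Ioi 0))
    {s : ℝ} {μ : ℕ} (hs : -1 < s) (h0 : SymAt (𝓝[>] 0) 0 s μ r)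
    (h1 : ∀ ρ, SymAt atTop 0 ρ 0 r) : Integrable (zeroExt r) := by
  refine integrable_zeroExt hr.continuousOn hs (μ := μ) ?_ (s := -2) (ν := 0) (by norm_num) ?_
  · simpa using h0.bound
  · simpa using (h1 (-2)).bound

theorem contDiff_fourierFn_zeroExt {r : ℝ → ℂ} (hr : ContDiffOn ℝ ∞ r (Set.Ioi 0))
    {s : ℝ} {μ : ℕ} (hs : -1 < s) (h0 : SymAt (𝓝[>] 0) 0 s μ r)
    (h1 : ∀ ρ, SymAt atTop 0 ρ 0 r) : ContDiff ℝ ∞ (fourierFn (zeroExt r)) :=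
  contDiff_infty.2 fun _ => contDiff_fourierFn fun n _ => integrable_pow_mul_zeroExt hr hs h0 h1 n

/-- The order `k - M` only says that the `k`-th derivative is `O(|ξ|^{-M})`. The loss of `k` does no
harm, because `M` may be chosen after `k`. -/
theorem symAt_fourierFn_zeroExt {r : ℝ → ℂ} (hr : ContDiffOn ℝ ∞ r (Set.Ioi 0))
    {s : ℝ} {μ M : ℕ} (hs : M + 1 < s) (h0 : ∀ k, SymAt (𝓝[>] 0) k s μ r)
    (h1 : ∀ k ρ, SymAt atTop k ρ 0 r) (k : ℕ) :
    SymAt (cocompact ℝ) k ((k : ℝ) - M) 0 (fourierFn (zeroExt r)) := by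
  have hM : (0 : ℝ) ≤ M := Nat.cast_nonneg M
  have hs1 := contDiff_fourierFn_zeroExt hr (by linarith) (h0 0) (h1 0)
  refine ⟨Eventually.of_forall fun x => hs1.contDiffAt.of_le (by exact_mod_cast le_top), ?_⟩
  obtain ⟨C, hC⟩ := exists_pow_mul_iteratedDeriv_fourierFn_le (k := k) (n := M)
    (contDiff_zeroExt hr hs h0) fun i _ j hj => by
      have hjM : (j : ℝ) ≤ M := by exact_mod_cast hj
      rw [iteratedDeriv_zeroExt hr (by linarith) h0 j hj]
      exact integrable_pow_mul_zeroExt_iteratedDeriv hr (by linarith) (h0 j) (h1 j) i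
  refine IsBigO.of_bound C ?_
  filter_upwards [eventually_one_le_abs_cocompact 1] with ξ hξ
  have hξ0 : 0 < |ξ| := by linarith
  rw [Real.norm_of_nonneg (gauge_nonneg _ _ _), gauge_zero_right]
  have := hC ξ
  beta_reduce
  rw [show (k : ℝ) - M - k = -(M : ℝ) by ring, Real.rpow_neg hξ0.le, Real.rpow_natCast,
    ← div_eq_mul_inv, le_div_iff₀ (by positivity)]
  linarith

/-! ### Fourier-Laplace transforms in the lower half-plane -/

/-- The Fourier-Laplace transform of a function on the positive half-line. -/
def laplaceFn (r : ℝ → ℂ) (ζ : ℂ) : ℂ :=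
  ((Real.sqrt (2 * Real.pi))⁻¹ : ℂ) *
    ∫ x in Set.Ioi (0 : ℝ), Complex.exp (-(Complex.I * ζ * x)) * r x

theorem laplaceFn_ofReal (r : ℝ → ℂ) (ξ : ℝ) : laplaceFn r ξ = fourierFn (zeroExt r) ξ := by
  rw [laplaceFn, fourierFn, integral_mul_zeroExt]
  congr 2; funext x; congr 2; ring

theorem norm_exp_laplace_le {ζ : ℂ} (hζ : ζ.im ≤ 0) {x : ℝ} (hx : 0 < x) :
    ‖Complex.exp (-(Complex.I * ζ * x))‖ ≤ 1 := by
  rw [Complex.norm_exp, Real.exp_le_one_iff]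
  simp; nlinarith

theorem aestronglyMeasurable_laplace {r : ℝ → ℂ} (hr : IntegrableOn r (Set.Ioi 0)) (ζ : ℂ) :
    AEStronglyMeasurable (fun x : ℝ => Complex.exp (-(Complex.I * ζ * x)) * r x)
      (volume.restrict (Set.Ioi 0)) :=
  (by fun_prop : Continuous fun x : ℝ =>
    Complex.exp (-(Complex.I * ζ * x))).aestronglyMeasurable.mul hr.aestronglyMeasurable

theorem norm_laplace_integrand_le (r : ℝ → ℂ) {ζ : ℂ} (hζ : ζ.im ≤ 0) :
    ∀ᵐ x : ℝ ∂volume.restrict (Set.Ioi (0 : ℝ)),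
      ‖Complex.exp (-(Complex.I * ζ * x)) * r x‖ ≤ ‖r x‖ := by
  filter_upwards [ae_restrict_mem measurableSet_Ioi] with x hx
  rw [norm_mul]
  exact mul_le_of_le_one_left (norm_nonneg _) (norm_exp_laplace_le hζ hx)

theorem norm_laplaceFn_le {r : ℝ → ℂ} (hr : IntegrableOn r (Set.Ioi 0)) {ζ : ℂ} (hζ : ζ.im ≤ 0) :
    ‖laplaceFn r ζ‖ ≤ ‖((Real.sqrt (2 * Real.pi))⁻¹ : ℂ)‖ * ∫ x in Set.Ioi (0 : ℝ), ‖r x‖ := by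
  rw [laplaceFn, norm_mul]
  refine mul_le_mul_of_nonneg_left ((norm_integral_le_integral_norm _).trans ?_) (norm_nonneg _)
  exact integral_mono_ae ((hr.norm).mono' (aestronglyMeasurable_laplace hr ζ).norm
    (by simpa using norm_laplace_integrand_le r hζ)) hr.norm (norm_laplace_integrand_le r hζ)

theorem differentiableOn_laplaceFn {r : ℝ → ℂ} (hr : IntegrableOn r (Set.Ioi 0)) :
    DifferentiableOn ℂ (laplaceFn r) {ζ | ζ.im < 0} := by
  have h := differentiableOn_laplace (q := r) fun δ hδ => by
    refine hr.norm.mono' ?_ ?_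
    · exact (by fun_prop : Continuous fun x : ℝ =>
        Complex.exp (-(δ * x))).aestronglyMeasurable.mul hr.aestronglyMeasurable
    · filter_upwards [ae_restrict_mem measurableSet_Ioi] with x hx
      have hx : 0 < x := hx
      rw [norm_mul, Complex.norm_exp]
      refine mul_le_of_le_one_left (norm_nonneg _) (Real.exp_le_one_iff.2 ?_)
      simp; positivity
  have h2 : DifferentiableOn ℂ (fun ζ : ℂ => Complex.I * ζ) {ζ | ζ.im < 0} :=
    (differentiable_id.const_mul Complex.I).differentiableOn
  exact (h.comp h2 fun ζ hζ => by
    have hζ : ζ.im < 0 := hζ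
    simpa using hζ).const_mul _

theorem tendsto_laplaceFn {r : ℝ → ℂ} (hr : IntegrableOn r (Set.Ioi 0)) (ξ : ℝ) :
    Tendsto (fun η : ℝ => laplaceFn r (ξ - η * Complex.I)) (𝓝[>] 0) (𝓝 (laplaceFn r ξ)) := by
  refine Tendsto.const_mul _ (tendsto_integral_filter_of_dominated_convergence (fun x => ‖r x‖)
    (Eventually.of_forall fun η => aestronglyMeasurable_laplace hr _) ?_ hr.norm ?_)
  · filter_upwards [self_mem_nhdsWithin] with η hη
    have hη : 0 < η := hη
    exact norm_laplace_integrand_le r (ζ := ξ - η * Complex.I) (by simpa using hη.le)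
  · refine Eventually.of_forall fun x => ?_
    have : Continuous fun η : ℝ => Complex.exp (-(Complex.I * (ξ - η * Complex.I) * x)) * r x := by
      fun_prop
    exact (this.tendsto' 0 _ (by simp)).mono_left nhdsWithin_le_nhds

/-! ### Boundary values from the lower half-plane -/

/-- The functions `h (· - i η)` converge to `H` as `η → 0⁺`. -/
structure HasLowerBV (h : ℂ → ℂ) (H : 𝓢'(ℝ, ℂ)) : Prop where
  slowGrowth : ∀ η : ℝ, 0 < η → SlowGrowth fun ξ : ℝ => h (ξ - η * Complex.I)
  tendsto : Tendsto (fun η : ℝ => regular fun ξ : ℝ => h (ξ - η * Complex.I)) (𝓝[>] 0) (𝓝 H)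

/-- Polynomial growth in the open lower half-plane. -/
def LowerGrowth (h : ℂ → ℂ) : Prop :=
  ∃ (C : ℝ) (m : ℕ), 0 ≤ C ∧ ∀ ζ : ℂ, ζ.im < 0 → ‖h ζ‖ ≤ C * (1 + ‖ζ‖) ^ m

theorem LowerGrowth.add {h₁ h₂ : ℂ → ℂ} (H₁ : LowerGrowth h₁) (H₂ : LowerGrowth h₂) :
    LowerGrowth fun ζ => h₁ ζ + h₂ ζ := by
  obtain ⟨C₁, m₁, hC₁, h1⟩ := H₁
  obtain ⟨C₂, m₂, hC₂, h2⟩ := H₂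
  refine ⟨C₁ + C₂, max m₁ m₂, by positivity, fun ζ hζ => ?_⟩
  rw [add_mul]
  have h0 : 1 ≤ 1 + ‖ζ‖ := by simp
  refine (norm_add_le _ _).trans (add_le_add ((h1 ζ hζ).trans ?_) ((h2 ζ hζ).trans ?_))
  · exact mul_le_mul_of_nonneg_left (pow_le_pow_right₀ h0 (le_max_left _ _)) hC₁
  · exact mul_le_mul_of_nonneg_left (pow_le_pow_right₀ h0 (le_max_right _ _)) hC₂

theorem LowerGrowth.const_mul {h : ℂ → ℂ} (c : ℂ) (H : LowerGrowth h) :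
    LowerGrowth fun ζ => c * h ζ := by
  obtain ⟨C, m, hC, h1⟩ := H
  refine ⟨‖c‖ * C, m, by positivity, fun ζ hζ => ?_⟩
  rw [norm_mul, mul_assoc]
  exact mul_le_mul_of_nonneg_left (h1 ζ hζ) (norm_nonneg _)

theorem LowerGrowth.sum {ι : Type*} (s : Finset ι) {h : ι → ℂ → ℂ}
    (H : ∀ i ∈ s, LowerGrowth (h i)) : LowerGrowth fun ζ => ∑ i ∈ s, h i ζ := by
  classical
  induction s using Finset.induction_on with
  | empty => exact ⟨0, 0, le_rfl, fun ζ _ => by simp⟩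
  | insert i s hi ih =>
    simp only [Finset.sum_insert hi]
    exact (H i (by simp)).add (ih fun j hj => H j (by simp [hj]))

theorem norm_sub_mul_I_le (ξ : ℝ) {η : ℝ} (hη : 0 < η) :
    1 + ‖(ξ : ℂ) - η * Complex.I‖ ≤ (1 + η) * (1 + ‖ξ‖) := by
  have h1 : ‖(ξ : ℂ) - η * Complex.I‖ ≤ ‖ξ‖ + η := by
    refine (norm_sub_le _ _).trans_eq ?_
    rw [norm_mul, Complex.norm_I, mul_one, Complex.norm_real, Complex.norm_real,
      Real.norm_of_nonneg hη.le]
  nlinarith [norm_nonneg ξ]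

/-- Polynomial growth gives a majorant uniform in `0 < η < 1`, so against a Schwartz function
pointwise convergence becomes convergence in `𝓢'` by dominated convergence. -/
theorem hasLowerBV_regular {h : ℂ → ℂ} {g : ℝ → ℂ} (hd : DifferentiableOn ℂ h {ζ | ζ.im < 0})
    (hg : LowerGrowth h) (hgc : Continuous g)
    (hlim : ∀ ξ : ℝ, Tendsto (fun η : ℝ => h (ξ - η * Complex.I)) (𝓝[>] 0) (𝓝 (g ξ))) :
    SlowGrowth g ∧ HasLowerBV h (regular g) := by
  obtain ⟨C, m, hC, hb⟩ := hg
  have hcont : ∀ η : ℝ, 0 < η → Continuous fun ξ : ℝ => h (ξ - η * Complex.I) := fun η hη =>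
    hd.continuousOn.comp_continuous (by fun_prop) fun ξ => by simpa using hη
  have hbη : ∀ (η : ℝ), 0 < η → ∀ ξ : ℝ, ‖h (ξ - η * Complex.I)‖ ≤
      C * (1 + η) ^ m * (1 + ‖ξ‖) ^ m := fun η hη ξ => by
    refine (hb _ (by simpa using hη)).trans ?_
    rw [mul_assoc, ← mul_pow]
    exact mul_le_mul_of_nonneg_left
      (pow_le_pow_left₀ (by positivity) (norm_sub_mul_I_le ξ hη) m) hC
  have hslow : ∀ η : ℝ, 0 < η → SlowGrowth fun ξ : ℝ => h (ξ - η * Complex.I) := fun η hη =>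
    slowGrowth_of_bound (hcont η hη).aestronglyMeasurable (hbη η hη)
  have hIoo : ∀ᶠ η : ℝ in 𝓝[>] 0, 0 < η ∧ η < 1 := Ioo_mem_nhdsGT one_pos
  have hb1 : ∀ (η : ℝ), 0 < η ∧ η < 1 → ∀ ξ : ℝ, ‖h (ξ - η * Complex.I)‖ ≤
      C * 2 ^ m * (1 + ‖ξ‖) ^ m := fun η hη ξ => by
    refine (hbη η hη.1 ξ).trans ?_
    refine mul_le_mul_of_nonneg_right (mul_le_mul_of_nonneg_left ?_ hC) (by positivity)
    exact pow_le_pow_left₀ (by linarith [hη.1]) (by linarith [hη.2]) m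
  have hgb : ∀ ξ, ‖g ξ‖ ≤ C * 2 ^ m * (1 + ‖ξ‖) ^ m := fun ξ =>
    le_of_tendsto (hlim ξ).norm (hIoo.mono fun η hη => hb1 η hη ξ)
  have hsg : SlowGrowth g := slowGrowth_of_bound hgc.aestronglyMeasurable hgb
  refine ⟨hsg, hslow, ?_⟩
  rw [PointwiseConvergenceCLM.tendsto_iff_forall_tendsto]
  intro φ
  rw [regular_apply hsg]
  have hw : SlowGrowth fun ξ : ℝ => ((C * 2 ^ m * (1 + ‖ξ‖) ^ m : ℝ) : ℂ) :=
    slowGrowth_of_bound (by fun_prop) (C := C * 2 ^ m) (m := m) fun ξ => by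
      rw [Complex.norm_real, Real.norm_of_nonneg (by positivity)]
  have hlim2 := tendsto_integral_filter_of_dominated_convergence (μ := volume) (l := 𝓝[>] (0 : ℝ))
    (F := fun η ξ => φ ξ * h (ξ - η * Complex.I)) (f := fun ξ => φ ξ * g ξ)
    (fun ξ => ‖φ ξ * ((C * 2 ^ m * (1 + ‖ξ‖) ^ m : ℝ) : ℂ)‖)
    (hIoo.mono fun η hη => (φ.continuous.mul (hcont η hη.1)).aestronglyMeasurable)
    (hIoo.mono fun η hη => Eventually.of_forall fun ξ => by
      rw [norm_mul, norm_mul, Complex.norm_real, Real.norm_of_nonneg (by positivity)]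
      exact mul_le_mul_of_nonneg_left (hb1 η hη ξ) (norm_nonneg _))
    (hw.integrable_mul φ).norm
    (Eventually.of_forall fun ξ => (hlim ξ).const_mul _)
  refine hlim2.congr' (hIoo.mono fun η hη => ?_)
  beta_reduce
  rw [regular_apply (hslow η hη.1)]

theorem HasLowerBV.sub {h₁ h₂ : ℂ → ℂ} {H₁ H₂ : 𝓢'(ℝ, ℂ)} (h1 : HasLowerBV h₁ H₁)
    (h2 : HasLowerBV h₂ H₂) : HasLowerBV (fun ζ => h₁ ζ - h₂ ζ) (H₁ - H₂) := by
  refine ⟨fun η hη => (h1.slowGrowth η hη).sub (h2.slowGrowth η hη), ?_⟩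
  refine (h1.tendsto.sub h2.tendsto).congr' ?_
  filter_upwards [self_mem_nhdsWithin] with η hη
  exact (regular_sub (h1.slowGrowth η hη) (h2.slowGrowth η hη)).symm

/-! ### Functions holomorphic in the lower half-plane have one-sided Fourier transforms -/

/-- Cauchy's theorem for the rectangle `[-R, R] × [-R, 0]`: the three lower sides have length at
most `2R`, while `F` is `O((1+R)^{-2})` on them. Holomorphy up to `Im ζ < ε` lets the upper side lie
on the real axis. -/
theorem integral_eq_zero_of_decay_lower {F : ℂ → ℂ} {ε C : ℝ} (hε : 0 < ε)
    (hd : DifferentiableOn ℂ F {ζ | ζ.im < ε})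
    (hb : ∀ ζ : ℂ, ζ.im ≤ 0 → ‖F ζ‖ ≤ C * ((1 + ‖ζ‖) ^ 2)⁻¹) :
    (Integrable fun ξ : ℝ => F ξ) ∧ ∫ ξ : ℝ, F ξ = 0 := by
  have hC : 0 ≤ C := by simpa using (norm_nonneg _).trans (hb 0 (by simp))
  have hcont : Continuous fun ξ : ℝ => F ξ :=
    hd.continuousOn.comp_continuous (by fun_prop) fun ξ => by simpa using hε
  have hint : Integrable fun ξ : ℝ => F ξ := by
    have hi : Integrable fun x : ℝ => C * (1 + ‖x‖) ^ (-(2 : ℝ)) :=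
      (integrable_one_add_norm (by simp)).const_mul C
    refine hi.mono' hcont.aestronglyMeasurable (Eventually.of_forall fun x => ?_)
    rw [Real.rpow_neg (by positivity), Real.rpow_ofNat]
    simpa using hb x (by simp)
  refine ⟨hint, ?_⟩
  have hbR : ∀ R : ℝ, 0 < R → ∀ ζ : ℂ, ζ.im ≤ 0 → R ≤ ‖ζ‖ → ‖F ζ‖ ≤ C * ((1 + R) ^ 2)⁻¹ := by
    intro R hR ζ hζ hζR
    refine (hb ζ hζ).trans (mul_le_mul_of_nonneg_left ?_ hC)
    exact inv_anti₀ (by positivity) (pow_le_pow_left₀ (by positivity) (by linarith) 2)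
  have hkey : ∀ R : ℝ, 0 < R → ‖∫ x : ℝ in (-R)..R, F x‖ ≤ 4 * C / (1 + R) := by
    intro R hR
    have hc := Complex.integral_boundary_rect_eq_zero_of_differentiableOn F
      (-R - R * Complex.I) R (hd.mono ?_)
    · simp only [Complex.sub_re, Complex.neg_re, Complex.ofReal_re, Complex.mul_re, Complex.I_re,
        Complex.ofReal_im, Complex.I_im, Complex.sub_im, Complex.neg_im, Complex.mul_im, mul_zero,
        mul_one, zero_mul, sub_zero, neg_zero, zero_sub, add_zero, Complex.ofReal_zero,
        smul_eq_mul] at hc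
      have h1 : ‖∫ x : ℝ in (-R)..R, F (x + (-R : ℝ) * Complex.I)‖ ≤
          C * ((1 + R) ^ 2)⁻¹ * |R - -R| :=
        intervalIntegral.norm_integral_le_of_norm_le_const fun x _ =>
          hbR R hR _ (by simpa using hR.le) (by
            simpa [abs_of_pos hR] using Complex.abs_im_le_norm (x + (-R : ℝ) * Complex.I))
      have h2 : ∀ s : ℝ, |s| = R → ‖∫ y : ℝ in (-R)..0, F (s + y * Complex.I)‖ ≤
          C * ((1 + R) ^ 2)⁻¹ * |0 - -R| := fun s hs =>
        intervalIntegral.norm_integral_le_of_norm_le_const fun y hy => by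
          rw [Set.uIoc_of_le (by linarith)] at hy
          refine hbR R hR _ (by simpa using hy.2) ?_
          simpa [hs] using Complex.abs_re_le_norm (s + y * Complex.I)
      have h3 := h2 R (abs_of_pos hR)
      have h4 := h2 (-R) (by rw [abs_neg, abs_of_pos hR])
      have heq : (∫ x : ℝ in (-R)..R, F x) =
          (∫ x : ℝ in (-R)..R, F (x + (-R : ℝ) * Complex.I)) +
          Complex.I * (∫ y : ℝ in (-R)..0, F ((R : ℝ) + y * Complex.I)) -
          Complex.I * (∫ y : ℝ in (-R)..0, F ((-R : ℝ) + y * Complex.I)) := by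
        linear_combination -hc
      rw [heq]
      refine (norm_sub_le _ _).trans ((add_le_add (norm_add_le _ _) le_rfl).trans ?_)
      rw [norm_mul, norm_mul, Complex.norm_I, one_mul, one_mul]
      rw [show |R - -R| = 2 * R by rw [abs_of_pos] <;> linarith] at h1
      rw [show |0 - -R| = R by rw [zero_sub, neg_neg, abs_of_pos hR]] at h3 h4
      refine (add_le_add (add_le_add h1 h3) h4).trans ?_
      have h5 : R * ((1 + R) ^ 2)⁻¹ ≤ (1 + R)⁻¹ := by
        rw [pow_two, mul_inv, ← mul_assoc, ← div_eq_mul_inv]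
        exact mul_le_of_le_one_left (by positivity) ((div_le_one (by positivity)).2 (by linarith))
      calc _ = 4 * C * (R * ((1 + R) ^ 2)⁻¹) := by ring
        _ ≤ 4 * C * (1 + R)⁻¹ := mul_le_mul_of_nonneg_left h5 (by positivity)
        _ = _ := by rw [div_eq_mul_inv]
    · rintro ζ ⟨-, hζ⟩
      have hζ : ζ.im ∈ Set.uIcc (-(R : ℂ) - R * Complex.I).im ((R : ℂ)).im := hζ
      simp only [Complex.sub_im, Complex.neg_im, Complex.ofReal_im, Complex.mul_im,
        Complex.ofReal_re, Complex.I_im, Complex.I_re, mul_one, mul_zero, add_zero, neg_zero,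
        zero_sub] at hζ
      rw [Set.uIcc_of_le (by linarith)] at hζ
      exact hζ.2.trans_lt hε
  have ht : Tendsto (fun R : ℝ => ∫ x : ℝ in (-R)..R, F x) atTop (𝓝 (∫ ξ : ℝ, F ξ)) :=
    intervalIntegral_tendsto_integral hint tendsto_neg_atTop_atBot tendsto_id
  refine tendsto_nhds_unique ht (squeeze_zero_norm' ?_ (a := fun R => 4 * C / (1 + R)) ?_)
  · filter_upwards [eventually_gt_atTop 0] with R hR using hkey R hR
  · exact tendsto_const_nhds.div_atTop (tendsto_atTop_add_const_left _ _ tendsto_id)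

theorem fourierS_derivCLM (ψ : 𝓢(ℝ, ℂ)) (ξ : ℝ) :
    fourierS (SchwartzMap.derivCLM ℂ ℂ ψ) ξ = Complex.I * ξ * fourierS ψ ξ := by
  rw [fourierS_apply, fourierS_apply]
  have hu : ∀ x : ℝ, HasDerivAt (fun x : ℝ => Complex.exp (-Complex.I * x * ξ))
      (-Complex.I * ξ * Complex.exp (-Complex.I * x * ξ)) x := fun x => by
    have h1 : HasDerivAt (fun x : ℝ => -Complex.I * (x : ℂ) * ξ) (-Complex.I * 1 * ξ) x :=
      ((hasDerivAt_id x).ofReal_comp.const_mul _).mul_const _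
    refine h1.cexp.congr_deriv ?_
    ring
  have hb : ∀ φ : 𝓢(ℝ, ℂ), Integrable fun x : ℝ => Complex.exp (-Complex.I * x * ξ) * φ x :=
    fun φ => by
      refine φ.integrable.bdd_mul (c := 1) (by fun_prop) (Eventually.of_forall fun x => ?_)
      rw [Complex.norm_exp]; simp
  have h := integral_mul_deriv_eq_deriv_mul_of_integrable (fun x _ => hu x)
    (fun x _ => ψ.hasDerivAt x) (hb (SchwartzMap.derivCLM ℂ ℂ ψ))
    (((hb ψ).const_mul (-Complex.I * ξ)).congr (Eventually.of_forall fun x => by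
      simp only [Pi.mul_apply]; ring)) (hb ψ)
  have h2 : (∫ x : ℝ, Complex.exp (-Complex.I * x * ξ) * SchwartzMap.derivCLM ℂ ℂ ψ x) =
      Complex.I * ξ * ∫ x : ℝ, Complex.exp (-Complex.I * x * ξ) * ψ x := by
    refine h.trans ?_
    rw [← integral_const_mul, ← integral_neg]
    congr 1; funext x; ring
  rw [h2]; ring

/-- The operator `-i d/dx - i`, with symbol `ξ - i`. -/
def shiftDeriv (ψ : 𝓢(ℝ, ℂ)) : 𝓢(ℝ, ℂ) :=
  (-Complex.I) • SchwartzMap.derivCLM ℂ ℂ ψ + (-Complex.I) • ψ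

theorem fourierS_shiftDeriv (ψ : 𝓢(ℝ, ℂ)) (ξ : ℝ) :
    fourierS (shiftDeriv ψ) ξ = (ξ - Complex.I) * fourierS ψ ξ := by
  rw [shiftDeriv, map_add, map_smul, map_smul, add_apply, smul_apply, smul_apply,
    fourierS_derivCLM, smul_eq_mul, smul_eq_mul]
  linear_combination (-(ξ : ℂ) * fourierS ψ ξ) * Complex.I_mul_I

theorem fourierS_iterate_shiftDeriv (ψ : 𝓢(ℝ, ℂ)) (n : ℕ) (ξ : ℝ) :
    fourierS (shiftDeriv^[n] ψ) ξ = (ξ - Complex.I) ^ n * fourierS ψ ξ := by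
  induction n with
  | zero => simp
  | succ n ih => rw [Function.iterate_succ_apply', fourierS_shiftDeriv, ih]; ring

theorem iterate_shiftDeriv_eq_zero {ψ : 𝓢(ℝ, ℂ)} (h : ∀ x < 0, ψ x = 0) (n : ℕ) :
    ∀ x < 0, shiftDeriv^[n] ψ x = 0 := by
  induction n with
  | zero => simpa using h
  | succ n ih =>
    intro x hx
    rw [Function.iterate_succ_apply']
    have hev : (shiftDeriv^[n] ψ : ℝ → ℂ) =ᶠ[𝓝 x] fun _ => 0 := by
      filter_upwards [eventually_lt_nhds hx] with y hy using ih y hy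
    simp [shiftDeriv, ih x hx, hev.deriv_eq]

theorem one_add_norm_sq_le (ζ : ℂ) (hζ : ζ.im ≤ 0) :
    1 + ‖ζ‖ ≤ 2 * ‖ζ - Complex.I‖ := by
  have h1 : 1 ≤ ‖ζ - Complex.I‖ := by
    have := Complex.abs_im_le_norm (ζ - Complex.I)
    simp only [Complex.sub_im, Complex.I_im] at this
    rw [abs_of_neg (by linarith)] at this
    linarith
  have h2 : ‖ζ‖ ≤ ‖ζ - Complex.I‖ := by
    rw [Complex.norm_eq_sqrt_sq_add_sq, Complex.norm_eq_sqrt_sq_add_sq]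
    refine Real.sqrt_le_sqrt ?_
    simp only [Complex.sub_re, Complex.I_re, Complex.sub_im, Complex.I_im]
    nlinarith
  linarith

/-- A power of `ζ - i` is moved from `h` to `ψ`. What is left of `h` decays quadratically, so by
Cauchy's theorem its transform vanishes for `x ≥ 0`, where `e^{-ixζ}` is bounded in the lower
half-plane. On the `ψ` side the power acts as a differential operator, which keeps the support in `x
≥ 0`; hence the product of the two transforms vanishes everywhere. -/
theorem integral_mul_fourierS_eq_zero {h : ℂ → ℂ} (hd : DifferentiableOn ℂ h {ζ | ζ.im < 0})
    (hg : LowerGrowth h) {ψ : 𝓢(ℝ, ℂ)} (hψ : ∀ x < 0, ψ x = 0) {η : ℝ} (hη : 0 < η) :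
    ∫ ξ : ℝ, fourierS ψ ξ * h (ξ - η * Complex.I) = 0 := by
  obtain ⟨C, m, hC, hb⟩ := hg
  -- The exponent `m + 2` compensates the growth of order `m` and leaves quadratic decay; `ζ - i`
  -- has no zero for `Im ζ < 1`.
  set κ : ℂ → ℂ := fun ζ => h (ζ - η * Complex.I) * ((ζ - Complex.I) ^ (m + 2))⁻¹ with hκ
  have hne : ∀ ζ : ℂ, ζ.im < 1 → (ζ - Complex.I) ^ (m + 2) ≠ 0 := fun ζ hζ => by
    refine pow_ne_zero _ fun h0 => ?_
    have := congrArg Complex.im h0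
    simp only [Complex.sub_im, Complex.I_im, Complex.zero_im] at this
    linarith
  have hκd : DifferentiableOn ℂ κ {ζ | ζ.im < min η 1} := by
    refine DifferentiableOn.mul ?_ (DifferentiableOn.inv (by fun_prop) fun ζ hζ => ?_)
    · refine hd.comp (by fun_prop) fun ζ hζ => ?_
      have hζ : ζ.im < min η 1 := hζ
      simpa using hζ.trans_le (min_le_left _ _)
    · have hζ : ζ.im < min η 1 := hζ
      exact hne ζ (hζ.trans_le (min_le_right _ _))
  have hκb : ∀ ζ : ℂ, ζ.im ≤ 0 →
      ‖κ ζ‖ ≤ C * (1 + η) ^ m * 2 ^ (m + 2) * ((1 + ‖ζ‖) ^ 2)⁻¹ := fun ζ hζ => by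
    have h1 := hb (ζ - η * Complex.I) (by simp; linarith)
    have h2 : 1 + ‖ζ - η * Complex.I‖ ≤ (1 + η) * (1 + ‖ζ‖) := by
      have : ‖ζ - η * Complex.I‖ ≤ ‖ζ‖ + η := by
        refine (norm_sub_le _ _).trans_eq ?_
        rw [norm_mul, Complex.norm_I, mul_one, Complex.norm_real, Real.norm_of_nonneg hη.le]
      nlinarith [norm_nonneg ζ]
    have h3 : 0 < 1 + ‖ζ‖ := by positivity
    have h4 : 0 < ‖ζ - Complex.I‖ := by linarith [one_add_norm_sq_le ζ hζ]
    rw [hκ, norm_mul, norm_inv, norm_pow]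
    calc _ ≤ (C * ((1 + η) * (1 + ‖ζ‖)) ^ m) * (((1 + ‖ζ‖) / 2) ^ (m + 2))⁻¹ := by
          refine mul_le_mul (h1.trans (mul_le_mul_of_nonneg_left
            (pow_le_pow_left₀ (by positivity) h2 m) hC)) ?_ (by positivity) (by positivity)
          refine inv_anti₀ (by positivity) (pow_le_pow_left₀ (by positivity) ?_ _)
          linarith [one_add_norm_sq_le ζ hζ]
      _ = _ := by
        rw [mul_pow, div_pow]
        field_simp
        ring
  have hF : ∀ x : ℝ, 0 ≤ x → (Integrable fun ξ : ℝ => Complex.exp (-Complex.I * ξ * x) * κ ξ) ∧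
      ∫ ξ : ℝ, Complex.exp (-Complex.I * ξ * x) * κ ξ = 0 := fun x hx =>
    integral_eq_zero_of_decay_lower (F := fun ζ => Complex.exp (-Complex.I * ζ * x) * κ ζ)
      (lt_min hη one_pos) (DifferentiableOn.mul (by fun_prop) hκd) fun ζ hζ => by
        rw [norm_mul]
        refine (mul_le_of_le_one_left (norm_nonneg _) ?_).trans (hκb ζ hζ)
        rw [Complex.norm_exp, Real.exp_le_one_iff]
        simp; nlinarith
  have hκi : Integrable fun ξ : ℝ => κ ξ := by simpa using (hF 0 le_rfl).1
  have h1 : ∀ ξ : ℝ, fourierS ψ ξ * h (ξ - η * Complex.I) =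
      fourierFn (shiftDeriv^[m + 2] ψ) ξ * κ ξ := fun ξ => by
    rw [← fourierS_eq_fourierFn, fourierS_iterate_shiftDeriv, hκ]
    have := hne ξ (by simp)
    field_simp
  simp only [h1]
  rw [integral_fourierFn_mul (SchwartzMap.integrable _) hκi]
  refine integral_eq_zero_of_ae (Eventually.of_forall fun x => ?_)
  rcases lt_or_ge x 0 with hx | hx
  · simp only [iterate_shiftDeriv_eq_zero hψ _ x hx, zero_mul, Pi.zero_apply]
  · simp only [fourierFn, (hF x hx).2, mul_zero, Pi.zero_apply]

/-- **Paley–Wiener**: the Fourier transform of an integrable boundary value from the lower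
half-plane vanishes on the positive half-line. -/
theorem fourierFn_eq_zero_of_hasLowerBV {h : ℂ → ℂ} {g : ℝ → ℂ}
    (hd : DifferentiableOn ℂ h {ζ | ζ.im < 0}) (hg : LowerGrowth h) (hi : Integrable g)
    (hbv : HasLowerBV h (regular g)) {x : ℝ} (hx : 0 < x) : fourierFn g x = 0 := by
  have h0 : ∀ ψ : 𝓢(ℝ, ℂ), (∀ x < 0, ψ x = 0) → ∫ x, ψ x * fourierFn g x = 0 := fun ψ hψ => by
    have ht := (PointwiseConvergenceCLM.tendsto_iff_forall_tendsto.1 hbv.tendsto) (fourierS ψ)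
    rw [regular_apply (slowGrowth_of_integrable hi)] at ht
    have h2 : ∫ x, ψ x * fourierFn g x = ∫ x, fourierS ψ x * g x := by
      rw [← integral_fourierFn_mul ψ.integrable hi]
      simp only [fourierS_eq_fourierFn]
    rw [h2]
    refine tendsto_nhds_unique ht (tendsto_const_nhds.congr' ?_)
    filter_upwards [self_mem_nhdsWithin] with η hη
    rw [regular_apply (hbv.slowGrowth η hη), integral_mul_fourierS_eq_zero hd hg hψ hη]
  have hc := continuous_fourierFn hi
  have hae := isOpen_Ioi.ae_eq_zero_of_integral_contDiff_smul_eq_zero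
    (hc.locallyIntegrable.locallyIntegrableOn (Set.Ioi (0 : ℝ))) fun ψ hψ hψc hψs => by
      have hcs : HasCompactSupport fun x => (ψ x : ℂ) :=
        hψc.comp_left (g := ((↑) : ℝ → ℂ)) Complex.ofReal_zero
      refine h0 (hcs.toSchwartzMap (Complex.ofRealCLM.contDiff.comp hψ)) fun y hy => ?_
      have : ψ y = 0 := by
        by_contra hne
        exact absurd (hψs (subset_tsupport ψ hne)) (by simpa using hy.le)
      change (ψ y : ℂ) = 0
      simp [this]
  have heq : Set.EqOn (fourierFn g) (fun _ => 0) (Set.Ioi 0) := by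
    refine Measure.eqOn_open_of_ae_eq (μ := volume) ?_ isOpen_Ioi hc.continuousOn
      continuousOn_const
    rw [EventuallyEq, ae_restrict_iff' measurableSet_Ioi]
    exact hae
  exact heq hx

/-! ### Partial sums of model functions and of symbols -/

/-- The pairs `(j, k)` with `j ≤ N` and `k ≤ m_j`. -/
def PowerSet.idx (P : PowerSet) (N : ℕ) : Finset (Σ _ : ℕ, ℕ) :=
  (Finset.range (N + 1)).sigma fun j => Finset.range (P.m j + 1)

theorem PowerSet.mem_idx {P : PowerSet} {N : ℕ} {i : Σ _ : ℕ, ℕ} :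
    i ∈ P.idx N ↔ i.1 ≤ N ∧ i.2 ≤ P.m i.1 := by
  simp [PowerSet.idx]

theorem PowerSet.idx_mono (P : PowerSet) {N N' : ℕ} (h : N ≤ N') : P.idx N ⊆ P.idx N' :=
  fun i hi => by
    rw [PowerSet.mem_idx] at hi ⊢
    exact ⟨hi.1.trans h, hi.2⟩

theorem PowerSet.m_le_logDegree (P : PowerSet) (j : ℕ) : P.m j ≤ P.logDegree :=
  le_ciSup P.bddAbove_m j

theorem PowerSet.sum_idx (P : PowerSet) (N : ℕ) {A : Type*} [AddCommMonoid A]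
    (f : ℕ → ℕ → A) : ∑ i ∈ P.idx N, f i.1 i.2 =
      ∑ j ∈ Finset.range (N + 1), ∑ k ∈ Finset.range (P.m j + 1), f j k :=
  Finset.sum_sigma _ _ _

theorem PowerSet.exists_re_gt (P : PowerSet) (n : ℕ) (R : ℝ) : ∃ N ≥ n, R < (P.p (N + 1)).re := by
  obtain ⟨N, hN1, hN2⟩ := ((P.tendsto_re.comp (tendsto_add_atTop_nat 1)).eventually_gt_atTop R
    |>.and (eventually_ge_atTop n)).exists
  exact ⟨N, hN2, hN1⟩

theorem partialSumZero_eq (P : PowerSet) (a : ℕ → ℕ → ℂ) (N : ℕ) (x : ℝ) :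
    partialSumZero P a N x = ∑ i ∈ P.idx N, a i.1 i.2 * powLog (P.p i.1) i.2 x := by
  rw [P.sum_idx N fun j k => a j k * powLog (P.p j) k x]
  simp only [partialSumZero, powLog, mul_assoc]

/-- The function `∑_{j ≤ N} ∑_{k ≤ m_j} a_{jk} x^{p_j} log^k x e^{-x} ∑_{n < K} x^n / n!`. -/
def modelSum (P : PowerSet) (a : ℕ → ℕ → ℂ) (N K : ℕ) (x : ℝ) : ℂ :=
  ∑ i ∈ P.idx N, a i.1 i.2 * modelFn (P.p i.1) i.2 K x

/-- The linear combination of `tailFn` corresponding to `modelSum`. -/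
def tailSum (P : PowerSet) (a : ℕ → ℕ → ℂ) (N K : ℕ) (x : ℝ) : ℂ :=
  ∑ i ∈ P.idx N, a i.1 i.2 * tailFn (P.p i.1) i.2 K x

/-- The Fourier-Laplace transform of `modelSum`. -/
def gSum (P : PowerSet) (a : ℕ → ℕ → ℂ) (N K : ℕ) (ζ : ℂ) : ℂ :=
  ∑ i ∈ P.idx N, a i.1 i.2 * gFun (P.p i.1) i.2 K ζ

/-- The Fourier transform of `∑_{j ≤ N} ∑_{k ≤ m_j} a_{jk} x₊^{p_j} log^k x` away from zero. -/
def symbolSum (P : PowerSet) (a : ℕ → ℕ → ℂ) (N : ℕ) (ξ : ℝ) : ℂ :=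
  ∑ i ∈ P.idx N, a i.1 i.2 * (((Real.sqrt (2 * Real.pi))⁻¹ : ℂ) *
    gammaPow i.2 (P.p i.1 + 1) (Complex.I * ξ))

theorem tailSum_eq (P : PowerSet) (a : ℕ → ℕ → ℂ) (N K : ℕ) (x : ℝ) :
    tailSum P a N K x = modelSum P a N K x - partialSumZero P a N x := by
  rw [partialSumZero_eq, tailSum, modelSum, ← Finset.sum_sub_distrib]
  simp only [tailFn_eq, mul_sub]

section

variable {P : PowerSet}

theorem re_p_zero_le (P : PowerSet) (j : ℕ) : (P.p 0).re ≤ (P.p j).re :=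
  P.monotone_re (Nat.zero_le j)

theorem symAt_zero_tailSum (a : ℕ → ℕ → ℂ) (N k : ℕ) {K : ℕ} {s : ℝ} (hK : s ≤ (P.p 0).re + K) :
    SymAt (𝓝[>] 0) k s P.logDegree (tailSum P a N K) :=
  SymAt.sum _ fun i hi => ((symAt_zero_powLog_mul_expTail_sub_one _ _ _ _).mono_zero
    (by linarith [re_p_zero_le P i.1])
    ((PowerSet.mem_idx.1 hi).2.trans (P.m_le_logDegree _))).const_mul _

theorem symAt_top_modelSum (a : ℕ → ℕ → ℂ) (N K k : ℕ) (ρ : ℝ) :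
    SymAt atTop k ρ 0 (modelSum P a N K) :=
  SymAt.sum _ fun _ _ => (symAt_top_powLog_mul_expTail _ _ _ _ _).const_mul _

theorem slowGrowth_tailSum (a : ℕ → ℕ → ℂ) (N : ℕ) {K : ℕ} (hK : -1 < (P.p 0).re + K) :
    SlowGrowth (zeroExt (tailSum P a N K)) := by
  unfold tailSum
  rw [zeroExt_sum]
  refine SlowGrowth.sum _ fun i _ => ?_
  rw [zeroExt_const_mul]
  exact (slowGrowth_tailFn (by linarith [re_p_zero_le P i.1]) _).const_mul _

theorem regular_zeroExt_tailSum (a : ℕ → ℕ → ℂ) (N : ℕ) {K : ℕ} (hK : -1 < (P.p 0).re + K) :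
    regular (zeroExt (tailSum P a N K)) =
      ∑ i ∈ P.idx N, a i.1 i.2 • regular (zeroExt (tailFn (P.p i.1) i.2 K)) := by
  unfold tailSum
  have h : ∀ i : Σ _ : ℕ, ℕ, SlowGrowth (zeroExt (tailFn (P.p i.1) i.2 K)) := fun i =>
    slowGrowth_tailFn (by linarith [re_p_zero_le P i.1]) _
  rw [zeroExt_sum, regular_sum _ fun i _ => by
    rw [zeroExt_const_mul]; exact (h i).const_mul _]
  refine Finset.sum_congr rfl fun i _ => ?_
  rw [zeroExt_const_mul, regular_const_mul _ (h i)]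

theorem contDiffOn_modelSum (a : ℕ → ℕ → ℂ) (N K : ℕ) {n : ℕ∞ω} :
    ContDiffOn ℝ n (modelSum P a N K) (Set.Ioi 0) := fun _ hx =>
  (ContDiffAt.sum fun _ _ => contDiffAt_const.mul ((contDiffAt_powLog _ _ hx n).mul
    (contDiff_expTail K).contDiffAt)).contDiffWithinAt

theorem continuousOn_partialSumZero (a : ℕ → ℕ → ℂ) (N : ℕ) :
    ContinuousOn (partialSumZero P a N) (Set.Ioi 0) := by
  rw [funext (partialSumZero_eq P a N)]
  exact continuousOn_finsetSum _ fun i _ => continuousOn_const.mul (continuousOn_powLog _ _)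

theorem contDiff_gSum (hreg : ∀ j, ∀ m : ℕ, P.p j + 1 ≠ -m) (a : ℕ → ℕ → ℂ) (N K : ℕ)
    {n : ℕ∞ω} : ContDiff ℝ n fun ξ : ℝ => gSum P a N K ξ :=
  ContDiff.sum fun i _ => contDiff_const.mul (contDiff_gFun (hreg i.1) _ _)

theorem slowGrowth_gSum (hreg : ∀ j, ∀ m : ℕ, P.p j + 1 ≠ -m) (a : ℕ → ℕ → ℂ) (N K : ℕ) :
    SlowGrowth fun ξ : ℝ => gSum P a N K ξ :=
  SlowGrowth.sum _ fun i _ => (slowGrowth_gFun (hreg i.1) _ _).const_mul _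

theorem differentiableOn_gSum (hreg : ∀ j, ∀ m : ℕ, P.p j + 1 ≠ -m) (a : ℕ → ℕ → ℂ) (N K : ℕ) :
    DifferentiableOn ℂ (gSum P a N K) {ζ | ζ.im < 1} :=
  DifferentiableOn.fun_sum fun i _ => (differentiableOn_gFun (hreg i.1) _ _).const_mul _

theorem lowerGrowth_gSum (hreg : ∀ j, ∀ m : ℕ, P.p j + 1 ≠ -m) (a : ℕ → ℕ → ℂ) (N K : ℕ) :
    LowerGrowth (gSum P a N K) :=
  LowerGrowth.sum _ fun i _ => LowerGrowth.const_mul _ <| by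
    obtain ⟨C, m, hC, h⟩ := exists_norm_gFun_le (hreg i.1) i.2 K
    exact ⟨C, m, hC, fun ζ hζ => h ζ hζ.le⟩

theorem tendsto_sub_mul_I (ξ : ℝ) :
    Tendsto (fun η : ℝ => (ξ : ℂ) - η * Complex.I) (𝓝[>] 0) (𝓝 ξ) := by
  have h : Continuous fun η : ℝ => (ξ : ℂ) - η * Complex.I := by fun_prop
  exact (h.tendsto' 0 _ (by simp)).mono_left nhdsWithin_le_nhds

theorem tendsto_gSum (hreg : ∀ j, ∀ m : ℕ, P.p j + 1 ≠ -m) (a : ℕ → ℕ → ℂ) (N K : ℕ) (ξ : ℝ) :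
    Tendsto (fun η : ℝ => gSum P a N K (ξ - η * Complex.I)) (𝓝[>] 0) (𝓝 (gSum P a N K ξ)) := by
  have ho : IsOpen {ζ : ℂ | ζ.im < 1} := isOpen_lt Complex.continuous_im continuous_const
  have := ((differentiableOn_gSum hreg a N K).differentiableAt
    (ho.mem_nhds (x := (ξ : ℂ)) (by simp))).continuousAt
  exact this.tendsto.comp (tendsto_sub_mul_I ξ)

theorem symAt_gSum_sub (hreg : ∀ j, ∀ m : ℕ, P.p j + 1 ≠ -m) (a : ℕ → ℕ → ℂ) (N k : ℕ) {K : ℕ}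
    {s : ℝ} (hK : s ≤ (P.p 0).re + (K + 1 : ℕ)) :
    SymAt (cocompact ℝ) k (-s - 1) P.logDegree
      fun ξ : ℝ => gSum P a N (K + 1) ξ - symbolSum P a N ξ := by
  have h : (fun ξ : ℝ => gSum P a N (K + 1) ξ - symbolSum P a N ξ) = fun ξ : ℝ =>
      ∑ i ∈ P.idx N, a i.1 i.2 * (gFun (P.p i.1) i.2 (K + 1) ξ -
        ((Real.sqrt (2 * Real.pi))⁻¹ : ℂ) * gammaPow i.2 (P.p i.1 + 1) (Complex.I * ξ)) := by
    funext ξ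
    rw [gSum, symbolSum, ← Finset.sum_sub_distrib]
    simp only [mul_sub]
  rw [h]
  exact SymAt.sum _ fun i hi => ((symAt_gFun_sub (hreg i.1) _ _ _).mono_infty
    (by linarith [re_p_zero_le P i.1])
    ((PowerSet.mem_idx.1 hi).2.trans (P.m_le_logDegree _))).const_mul _

theorem sum_idx_sub (P : PowerSet) {M N : ℕ} (h : M ≤ N) (f : (Σ _ : ℕ, ℕ) → ℂ) :
    ∑ i ∈ P.idx N, f i - ∑ i ∈ P.idx M, f i = ∑ i ∈ P.idx N \ P.idx M, f i := by
  rw [← Finset.sum_sdiff (P.idx_mono h)]; ring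

theorem le_of_mem_idx_sdiff {M N : ℕ} {i : Σ _ : ℕ, ℕ} (hi : i ∈ P.idx N \ P.idx M) :
    (P.p (M + 1)).re ≤ (P.p i.1).re ∧ i.2 ≤ P.logDegree := by
  rw [Finset.mem_sdiff, PowerSet.mem_idx, PowerSet.mem_idx] at hi
  refine ⟨P.monotone_re ?_, hi.1.2.trans (P.m_le_logDegree _)⟩
  by_contra hlt
  exact hi.2 ⟨by omega, hi.1.2⟩

/-- Since `Re p_j` is nondecreasing, every term between `M` and `N` is of at most the order of the
first omitted one. -/
theorem symAt_symbolSum_sub (hreg : ∀ j, ∀ m : ℕ, P.p j + 1 ≠ -m) (a : ℕ → ℕ → ℂ) {M N : ℕ}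
    (h : M ≤ N) (k : ℕ) : SymAt (cocompact ℝ) k (-(P.p (M + 1)).re - 1) P.logDegree
      fun ξ : ℝ => symbolSum P a N ξ - symbolSum P a M ξ := by
  simp only [symbolSum, sum_idx_sub P h]
  refine SymAt.sum _ fun i hi => ((SymAt.const_mul _ ?_)).const_mul _
  refine (symAt_gammaPow (hreg i.1) i.2 k).mono_infty ?_ (le_of_mem_idx_sdiff hi).2
  have := (le_of_mem_idx_sdiff hi).1
  simp only [Complex.add_re, Complex.one_re]; linarith

theorem symAt_zero_partialSumZero_sub (a : ℕ → ℕ → ℂ) {M N : ℕ}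
    (h : M ≤ N) (k : ℕ) : SymAt (𝓝[>] 0) k (P.p (M + 1)).re P.logDegree
      fun x : ℝ => partialSumZero P a N x - partialSumZero P a M x := by
  simp only [partialSumZero_eq, sum_idx_sub P h]
  exact SymAt.sum _ fun i hi => ((symAt_zero_powLog _ i.2 k).mono_zero
    (le_of_mem_idx_sdiff hi).1 (le_of_mem_idx_sdiff hi).2).const_mul _

/-! ### The extension by zero -/

theorem extendPos_eq (P : PowerSet) (u : ℝ → ℂ) (a : ℕ → ℕ → ℂ) (N : ℕ) :
    extendPos P u a N = ∑ i ∈ P.idx N, a i.1 i.2 • xPosLog (P.p i.1) i.2 +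
      regular (zeroExt fun x => u x - partialSumZero P a N x) := by
  rw [P.sum_idx N fun j k => a j k • xPosLog (P.p j) k]; rfl

theorem slowGrowth_sub_partialSumZero {u : ℝ → ℂ} {a : ℕ → ℕ → ℂ} {N K : ℕ}
    (hK : -1 < (P.p 0).re + K)
    (hs : SlowGrowth (zeroExt fun x => u x - modelSum P a N K x)) :
    SlowGrowth (zeroExt fun x => u x - partialSumZero P a N x) := by
  have := hs.add (slowGrowth_tailSum a N hK)
  rw [← zeroExt_add] at this
  simpa [tailSum_eq] using this

/-- The tails that turn `xPosLog` into `modelDist` are exactly those by which the two remainders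
differ. -/
theorem extendPos_eq_modelDist {u : ℝ → ℂ} {a : ℕ → ℕ → ℂ} {N K : ℕ} (hK : -1 < (P.p 0).re + K)
    (hs : SlowGrowth (zeroExt fun x => u x - modelSum P a N K x)) :
    extendPos P u a N = ∑ i ∈ P.idx N, a i.1 i.2 • modelDist (P.p i.1) i.2 K +
      regular (zeroExt fun x => u x - modelSum P a N K x) := by
  have h1 : (fun x => u x - partialSumZero P a N x) =
      fun x => (u x - modelSum P a N K x) + tailSum P a N K x := by
    funext x; rw [tailSum_eq]; ring
  rw [extendPos_eq, h1, zeroExt_add, regular_add hs (slowGrowth_tailSum a N hK),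
    regular_zeroExt_tailSum a N hK]
  simp only [modelDist, smul_add, Finset.sum_add_distrib]
  abel

/-- As `Re p_{N+1} > -1`, the new singular terms are locally integrable functions and pass unchanged
from the remainder to the sum of powers. -/
theorem extendPos_succ {u : ℝ → ℂ} {a : ℕ → ℕ → ℂ} {N : ℕ} (hN : -1 < (P.p (N + 1)).re)
    (hs : SlowGrowth (zeroExt fun x => u x - partialSumZero P a N x)) :
    SlowGrowth (zeroExt fun x => u x - partialSumZero P a (N + 1) x) ∧
      extendPos P u a (N + 1) = extendPos P u a N := by
  set q : ℝ → ℂ := fun x => ∑ k ∈ Finset.range (P.m (N + 1) + 1),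
    a (N + 1) k * powLog (P.p (N + 1)) k x with hq
  have hps : ∀ x, partialSumZero P a (N + 1) x = partialSumZero P a N x + q x := fun x => by
    simp only [partialSumZero, Finset.sum_range_succ _ (N + 1), hq, powLog, mul_assoc]
  have hqs : SlowGrowth (zeroExt q) := by
    rw [hq, zeroExt_sum]
    refine SlowGrowth.sum _ fun k _ => ?_
    rw [zeroExt_const_mul]
    exact (slowGrowth_powLog hN k).const_mul _
  have hqr : regular (zeroExt q) =
      ∑ k ∈ Finset.range (P.m (N + 1) + 1), a (N + 1) k • xPosLog (P.p (N + 1)) k := by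
    rw [hq, zeroExt_sum, regular_sum _ fun k _ => by
      rw [zeroExt_const_mul]; exact (slowGrowth_powLog hN k).const_mul _]
    refine Finset.sum_congr rfl fun k _ => ?_
    rw [zeroExt_const_mul, regular_const_mul _ (slowGrowth_powLog hN k), xPosLog_of_re_gt hN]
  have h1 : (fun x => u x - partialSumZero P a N x) =
      fun x => (u x - partialSumZero P a (N + 1) x) + q x := by
    funext x; rw [hps]; ring
  have hs' : SlowGrowth (zeroExt fun x => u x - partialSumZero P a (N + 1) x) := by
    have := hs.sub hqs
    refine (congrArg SlowGrowth (funext fun x => ?_)).mp this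
    by_cases hx : 0 < x
    · simp only [zeroExt, hx, if_true, hps]; ring
    · simp [zeroExt, hx]
  refine ⟨hs', ?_⟩
  have h2 : extendPos P u a N = (∑ j ∈ Finset.range (N + 1),
      ∑ k ∈ Finset.range (P.m j + 1), a j k • xPosLog (P.p j) k) +
        regular (zeroExt fun x => u x - partialSumZero P a N x) := rfl
  have h3 : extendPos P u a (N + 1) = (∑ j ∈ Finset.range (N + 1 + 1),
      ∑ k ∈ Finset.range (P.m j + 1), a j k • xPosLog (P.p j) k) +
        regular (zeroExt fun x => u x - partialSumZero P a (N + 1) x) := rfl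
  rw [h2, h3, h1, zeroExt_add, regular_add hs' hqs, hqr, Finset.sum_range_succ _ (N + 1)]
  abel

theorem extendPos_of_le {u : ℝ → ℂ} {a : ℕ → ℕ → ℂ} {N N' : ℕ} (hN : -1 < (P.p (N + 1)).re)
    (hs : SlowGrowth (zeroExt fun x => u x - partialSumZero P a N x)) (h : N ≤ N') :
    SlowGrowth (zeroExt fun x => u x - partialSumZero P a N' x) ∧
      extendPos P u a N' = extendPos P u a N := by
  induction N', h using Nat.le_induction with
  | base => exact ⟨hs, rfl⟩
  | succ n hn ih =>
    have h1 := extendPos_succ (hN.trans_le (P.monotone_re (by omega : N + 1 ≤ n + 1))) ih.1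
    exact ⟨h1.1, h1.2.trans ih.2⟩

theorem fourierD_extendPos (hreg : ∀ j, ∀ m : ℕ, P.p j + 1 ≠ -m) {u : ℝ → ℂ} {a : ℕ → ℕ → ℂ}
    {N K : ℕ} (hK : -1 < (P.p 0).re + (K + 1 : ℕ))
    (hi : Integrable (zeroExt fun x => u x - modelSum P a N (K + 1) x)) :
    fourierD (extendPos P u a N) = regular fun ξ : ℝ => gSum P a N (K + 1) ξ +
      fourierFn (zeroExt fun x => u x - modelSum P a N (K + 1) x) ξ := by
  rw [extendPos_eq_modelDist hK (slowGrowth_of_integrable hi), map_add, map_sum,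
    fourierD_regular hi, regular_add (slowGrowth_gSum hreg a N (K + 1)) (slowGrowth_fourierFn hi)]
  congr 1
  unfold gSum
  rw [regular_sum _ fun i _ => (slowGrowth_gFun (hreg i.1) _ _).const_mul _]
  refine Finset.sum_congr rfl fun i _ => ?_
  rw [map_smul, fourierD_modelDist (hreg i.1) (by linarith [re_p_zero_le P i.1]),
    regular_const_mul _ (slowGrowth_gFun (hreg i.1) _ _)]

/-! ### Fourier transforms of extensions by zero -/

theorem contDiffAt_partialSumZero (a : ℕ → ℕ → ℂ) (N : ℕ) {x : ℝ} (hx : 0 < x) (n : ℕ∞ω) :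
    ContDiffAt ℝ n (partialSumZero P a N) x := by
  rw [funext (partialSumZero_eq P a N)]
  exact ContDiffAt.sum fun i _ => contDiffAt_const.mul (contDiffAt_powLog _ _ hx n)

theorem hasExpansionAtZero_iff_symAt {u : ℝ → ℂ} {a : ℕ → ℕ → ℂ}
    (hu : ContDiffOn ℝ ∞ u (Set.Ioi 0)) : HasExpansionAtZero P u a ↔ ∀ N k,
      SymAt (𝓝[>] 0) k (P.p (N + 1)).re P.logDegree fun x => u x - partialSumZero P a N x := by
  have hg : ∀ N k : ℕ, gauge ((P.p (N + 1)).re - k) P.logDegree =ᶠ[𝓝[>] 0]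
      fun x : ℝ => x ^ ((P.p (N + 1)).re - k) * (1 + |Real.log x|) ^ P.logDegree := fun N k => by
    filter_upwards [self_mem_nhdsWithin] with x hx
    have hx : 0 < x := hx
    rw [gauge, abs_of_pos hx]
  refine forall₂_congr fun N k => ⟨fun h => ⟨?_, h.congr' EventuallyEq.rfl (hg N k).symm⟩,
    fun h => h.bound.congr' EventuallyEq.rfl (hg N k)⟩
  filter_upwards [self_mem_nhdsWithin] with x hx
  exact ((hu.contDiffAt (isOpen_Ioi.mem_nhds hx)).of_le (by exact_mod_cast le_top)).sub
    (contDiffAt_partialSumZero a N hx _)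

theorem symAt_top_iff {u : ℝ → ℂ} (hu : ContDiffOn ℝ ∞ u (Set.Ioi 0)) (k : ℕ) :
    (∀ l : ℕ, iteratedDeriv k u =O[atTop] fun x : ℝ => (x ^ l)⁻¹) ↔
      ∀ ρ : ℝ, SymAt atTop k ρ 0 u := by
  refine ⟨fun h ρ => ⟨?_, ?_⟩, fun h l => ?_⟩
  · filter_upwards [eventually_gt_atTop 0] with x hx
    exact (hu.contDiffAt (isOpen_Ioi.mem_nhds hx)).of_le (by exact_mod_cast le_top)
  · obtain ⟨l, hl⟩ := exists_nat_ge (k - ρ)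
    refine (h l).trans (IsBigO.of_bound 1 ?_)
    filter_upwards [eventually_ge_atTop 1] with x hx
    have hx0 : 0 < x := by linarith
    rw [gauge_zero_right, one_mul, Real.norm_of_nonneg (by positivity),
      Real.norm_of_nonneg (by positivity)]
    beta_reduce
    rw [abs_of_pos hx0, ← Real.rpow_natCast,
      ← Real.rpow_neg hx0.le]
    exact Real.rpow_le_rpow_of_exponent_le hx (by linarith)
  · refine (h (k - l)).bound.congr' EventuallyEq.rfl ?_
    filter_upwards [eventually_gt_atTop 0] with x hx
    rw [gauge_zero_right]
    simp only [abs_of_pos hx]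
    rw [sub_sub_cancel_left, Real.rpow_neg hx.le, Real.rpow_natCast]

theorem symAt_zero_sub_modelSum {u : ℝ → ℂ} {a : ℕ → ℕ → ℂ} {N k K : ℕ} {s : ℝ}
    (hs : s ≤ (P.p (N + 1)).re) (hK : s ≤ (P.p 0).re + K)
    (h : SymAt (𝓝[>] 0) k (P.p (N + 1)).re P.logDegree fun x => u x - partialSumZero P a N x) :
    SymAt (𝓝[>] 0) k s P.logDegree fun x => u x - modelSum P a N K x := by
  have := (h.mono_zero hs le_rfl).sub (symAt_zero_tailSum a N k hK)
  simp only [tailSum_eq] at this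
  simpa using this

theorem MemSchwartzP.symAt_top {u : ℝ → ℂ} (hu : MemSchwartzP P u) (a : ℕ → ℕ → ℂ) (N K k : ℕ)
    (ρ : ℝ) : SymAt atTop k ρ 0 fun x => u x - modelSum P a N K x :=
  ((symAt_top_iff hu.smooth k).1 (hu.decay k) ρ).sub (symAt_top_modelSum a N K k ρ)

theorem MemSchwartzP.symAt_zero {u : ℝ → ℂ} {a : ℕ → ℕ → ℂ} (hu : MemSchwartzP P u)
    (ha : HasExpansionAtZero P u a) {N K : ℕ} (k : ℕ) {s : ℝ} (hs : s ≤ (P.p (N + 1)).re)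
    (hK : s ≤ (P.p 0).re + K) :
    SymAt (𝓝[>] 0) k s P.logDegree fun x => u x - modelSum P a N K x :=
  symAt_zero_sub_modelSum hs hK ((hasExpansionAtZero_iff_symAt hu.smooth).1 ha N k)

theorem MemSchwartzP.integrable {u : ℝ → ℂ} {a : ℕ → ℕ → ℂ} (hu : MemSchwartzP P u)
    (ha : HasExpansionAtZero P u a) {N K : ℕ} (hN : -1 < (P.p (N + 1)).re)
    (hK : -1 < (P.p 0).re + K) : Integrable (zeroExt fun x => u x - modelSum P a N K x) :=
  integrable_zeroExt_of_symAt (hu.smooth.sub (contDiffOn_modelSum a N K)) (lt_min hN hK)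
    (hu.symAt_zero ha 0 (min_le_left _ _) (min_le_right _ _)) (hu.symAt_top a N K 0)

theorem extendPos_of_memSchwartzP {u : ℝ → ℂ} {a : ℕ → ℕ → ℂ} (hu : MemSchwartzP P u)
    (ha : HasExpansionAtZero P u a) {N N' : ℕ} (hN : -1 < (P.p (N + 1)).re) (h : N ≤ N') :
    extendPos P u a N' = extendPos P u a N := by
  obtain ⟨K, hK0⟩ := exists_nat_gt (-1 - (P.p 0).re)
  have hK : -1 < (P.p 0).re + K := by linarith
  exact (extendPos_of_le hN (slowGrowth_sub_partialSumZero hK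
    (slowGrowth_of_integrable (hu.integrable ha hN hK))) h).2

/-- The smooth function `g` is the boundary value of the holomorphic function `h` of polynomial
growth in the lower half-plane, and its expansion at infinity has the symbols given by `a`. -/
structure IsLowerTransform (P : PowerSet) (a : ℕ → ℕ → ℂ) (h : ℂ → ℂ) (g : ℝ → ℂ) : Prop where
  differentiableOn : DifferentiableOn ℂ h {ζ | ζ.im < 0}
  lowerGrowth : LowerGrowth h
  slowGrowth : SlowGrowth g
  contDiff : ContDiff ℝ ∞ g
  hasLowerBV : HasLowerBV h (regular g)
  symAt : ∀ N k, SymAt (cocompact ℝ) k (-(P.p (N + 1)).re - 1) P.logDegree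
    fun ξ => g ξ - symbolSum P a N ξ

/-- The holomorphic function is built from one pair `N`, `K`, while each order of the expansion is
read off from another, sufficiently large pair describing the same `g`. -/
theorem exists_isLowerTransform (hreg : ∀ j, ∀ m : ℕ, P.p j + 1 ≠ -m) {u : ℝ → ℂ}
    {a : ℕ → ℕ → ℂ} {N : ℕ} (hu : MemSchwartzP P u) (ha : HasExpansionAtZero P u a)
    (hN : -1 < (P.p (N + 1)).re) : ∃ h g, IsLowerTransform P a h g ∧
      fourierD (extendPos P u a N) = regular g := by
  set r : ℕ → ℕ → ℝ → ℂ := fun N K x => u x - modelSum P a N (K + 1) x with hr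
  have hrs : ∀ N K, ContDiffOn ℝ ∞ (r N K) (Set.Ioi 0) := fun N K =>
    hu.smooth.sub (contDiffOn_modelSum a N (K + 1))
  have hrtop : ∀ N K k ρ, SymAt atTop k ρ 0 (r N K) := fun N K k ρ => hu.symAt_top a N (K + 1) k ρ
  have hri : ∀ N K, -1 < (P.p (N + 1)).re → -1 < (P.p 0).re + (K + 1 : ℕ) →
      Integrable (zeroExt (r N K)) := fun N K h1 h2 => hu.integrable ha h1 h2
  set g : ℕ → ℕ → ℝ → ℂ := fun N K ξ => gSum P a N (K + 1) ξ + fourierFn (zeroExt (r N K)) ξ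
    with hg
  have hgs : ∀ N K, -1 < (P.p (N + 1)).re → -1 < (P.p 0).re + (K + 1 : ℕ) →
      ContDiff ℝ ∞ (g N K) := fun N K h1 h2 =>
    (contDiff_gSum hreg a N (K + 1)).add (contDiff_fourierFn_zeroExt (hrs N K) (lt_min h1 h2)
      (hu.symAt_zero ha 0 (min_le_left _ _) (min_le_right _ _)) (hrtop N K 0))
  have hgsl : ∀ N K, -1 < (P.p (N + 1)).re → -1 < (P.p 0).re + (K + 1 : ℕ) →
      SlowGrowth (g N K) := fun N K h1 h2 =>
    (slowGrowth_gSum hreg a N (K + 1)).add (slowGrowth_fourierFn (hri N K h1 h2))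
  have hfd : ∀ N K, -1 < (P.p (N + 1)).re → -1 < (P.p 0).re + (K + 1 : ℕ) →
      fourierD (extendPos P u a N) = regular (g N K) := fun N K h1 h2 =>
    fourierD_extendPos hreg h2 (hri N K h1 h2)
  obtain ⟨K, hK0⟩ := exists_nat_gt (-1 - (P.p 0).re)
  have hK : -1 < (P.p 0).re + (K + 1 : ℕ) := by push_cast; linarith
  -- All these smooth functions represent the transform of the same extension by zero, and
  -- continuous functions are determined by their distributions.
  have hgeq : ∀ N' K', N ≤ N' → -1 < (P.p 0).re + (K' + 1 : ℕ) → g N K = g N' K' :=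
    fun N' K' h1 h2 => by
      have hN' : -1 < (P.p (N' + 1)).re := hN.trans_le (P.monotone_re (by omega))
      refine eq_of_regular_eq (hgsl N K hN hK) (hgsl N' K' hN' h2) (hgs N K hN hK).continuous
        (hgs N' K' hN' h2).continuous ?_
      rw [← hfd N K hN hK, ← hfd N' K' hN' h2, extendPos_of_memSchwartzP hu ha hN h1]
  have hrI : IntegrableOn (r N K) (Set.Ioi 0) := integrable_zeroExt_iff.1 (hri N K hN hK)
  have hdiff : DifferentiableOn ℂ (fun ζ => gSum P a N (K + 1) ζ + laplaceFn (r N K) ζ)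
      {ζ | ζ.im < 0} :=
    ((differentiableOn_gSum hreg a N (K + 1)).mono
      (fun ζ (hζ : ζ.im < 0) => lt_trans hζ one_pos)).fun_add (differentiableOn_laplaceFn hrI)
  have hgrow : LowerGrowth fun ζ => gSum P a N (K + 1) ζ + laplaceFn (r N K) ζ :=
    (lowerGrowth_gSum hreg a N (K + 1)).add ⟨‖((Real.sqrt (2 * Real.pi))⁻¹ : ℂ)‖ *
      ∫ x in Set.Ioi (0 : ℝ), ‖r N K x‖, 0, by positivity, fun ζ hζ => by
        rw [pow_zero, mul_one]; exact norm_laplaceFn_le hrI hζ.le⟩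
  refine ⟨fun ζ => gSum P a N (K + 1) ζ + laplaceFn (r N K) ζ, g N K,
    ⟨hdiff, hgrow, hgsl N K hN hK, hgs N K hN hK, ?_, fun M k => ?_⟩, hfd N K hN hK⟩
  · refine (hasLowerBV_regular hdiff hgrow (hgs N K hN hK).continuous fun ξ => ?_).2
    rw [hg]
    beta_reduce
    rw [← laplaceFn_ofReal]
    exact (tendsto_gSum hreg a N (K + 1) ξ).add (tendsto_laplaceFn hrI ξ)
  -- With this `L` one has `k - L ≤ -Re p_{M+1} - 1`, so the transform of the `C^L` remainder is
  -- absorbed in the required error.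
  · obtain ⟨L, hL⟩ := exists_nat_ge (k + 1 + |(P.p (M + 1)).re|)
    obtain ⟨N', hN', hpN'⟩ := P.exists_re_gt (max N M) (L + 1)
    obtain ⟨K', hK'⟩ := exists_nat_gt ((P.p (N' + 1)).re - (P.p 0).re)
    have hL0 : (0 : ℝ) ≤ L := Nat.cast_nonneg L
    have hk0 : (0 : ℝ) ≤ k := Nat.cast_nonneg k
    have habs := le_abs_self (P.p (M + 1)).re
    have hK'1 : (P.p (N' + 1)).re ≤ (P.p 0).re + (K' + 1 : ℕ) := by push_cast; linarith
    rw [hgeq N' K' (le_trans (le_max_left _ _) hN') (by linarith)]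
    have h1 := symAt_gSum_sub hreg a N' k (K := K') (s := (P.p (M + 1)).re) (by linarith)
    have h2 := symAt_symbolSum_sub hreg a (le_trans (le_max_right N M) hN') k
    have h3 := (symAt_fourierFn_zeroExt (hrs N' K') hpN'
      (fun k => hu.symAt_zero ha k le_rfl hK'1) (hrtop N' K') k).mono_infty
        (r' := -(P.p (M + 1)).re - 1) (by linarith) (Nat.zero_le P.logDegree)
    have h4 := (h1.add h2).add h3
    refine (congrArg (SymAt _ _ _ _) (funext fun ξ => ?_)).mp h4
    rw [hg]; ring

end

/-! ### Inversion of the Fourier transform -/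

theorem integrable_pow_mul_of_isBigO {q : ℝ → ℂ} (hq : Continuous q) {s : ℝ} {μ i : ℕ}
    (h : q =O[cocompact ℝ] gauge s μ) (hs : i + s < -1) :
    Integrable fun x : ℝ => ‖x‖ ^ i * ‖q x‖ := by
  obtain ⟨r, hr1, hr2⟩ := exists_between hs
  have hn : (fun x : ℝ => ‖x‖ ^ i) =O[cocompact ℝ] gauge i 0 := by
    refine IsBigO.of_bound 1 (Eventually.of_forall fun x => ?_)
    rw [gauge_zero_right]; simp
  have h1 : (fun x : ℝ => ‖x‖ ^ i * ‖q x‖) =O[cocompact ℝ] gauge (i + s) μ := by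
    refine (hn.mul h.norm_left).congr' EventuallyEq.rfl ?_
    filter_upwards [eventually_one_le_abs_cocompact 1] with x hx
    rw [gauge_mul (abs_pos.1 (by linarith)), zero_add]
  have h2 : gauge r 0 =O[cocompact ℝ] fun x : ℝ => (1 + ‖x‖) ^ (-(-r)) := by
    refine IsBigO.of_bound (2 ^ (-r)) ?_
    filter_upwards [eventually_one_le_abs_cocompact 1] with x hx
    rw [Real.norm_of_nonneg (gauge_nonneg _ _ _), Real.norm_of_nonneg (by positivity),
      gauge_zero_right, neg_neg, Real.norm_eq_abs]
    beta_reduce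
    have h3 : (1 + |x|) / 2 ≤ |x| := by linarith
    refine (Real.rpow_le_rpow_of_nonpos (by positivity) h3 (by linarith)).trans_eq ?_
    rw [Real.div_rpow (by positivity) (by positivity), Real.rpow_neg (by positivity),
      div_eq_mul_inv, mul_comm]
  refine LocallyIntegrable.integrable_of_isBigO_cocompact
    (by fun_prop : Continuous fun x : ℝ => ‖x‖ ^ i * ‖q x‖).locallyIntegrable
    ((h1.trans (gauge_absorb_cocompact hr1 μ)).trans h2) ?_
  exact (integrable_one_add_norm (by simp; linarith)).integrableAtFilter _

theorem fourierFn_eq_fourier (f : ℝ → ℂ) (ξ : ℝ) :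
    fourierFn f ξ = ((Real.sqrt (2 * Real.pi))⁻¹ : ℂ) *
      FourierTransform.fourier f (ξ * (2 * Real.pi)⁻¹) := by
  rw [fourierFn, Real.fourier_eq']
  congr 2; funext x
  rw [smul_eq_mul]
  congr 2
  have hpi : (Real.pi : ℂ) ≠ 0 := by exact_mod_cast Real.pi_ne_zero
  simp only [RCLike.inner_apply, conj_trivial]
  push_cast
  field_simp

theorem sqrt_two_pi_mul_self : (Real.sqrt (2 * Real.pi) : ℂ) * Real.sqrt (2 * Real.pi) =
    2 * Real.pi := by
  rw [← Complex.ofReal_mul, Real.mul_self_sqrt (by positivity)]; push_cast; rfl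

theorem sqrt_two_pi_ne_zero : (Real.sqrt (2 * Real.pi) : ℂ) ≠ 0 :=
  Complex.ofReal_ne_zero.2 (by positivity)

theorem fourierFn_fourierFn_neg {g : ℝ → ℂ} (hc : Continuous g) (hi : Integrable g)
    (hfi : Integrable (fourierFn g)) : fourierFn (fun x => fourierFn g (-x)) = g := by
  have h2 : (2 * Real.pi : ℝ) ≠ 0 := by positivity
  have hF : FourierTransform.fourier g =
      fun w => (Real.sqrt (2 * Real.pi) : ℂ) * fourierFn g (2 * Real.pi * w) := by
    funext w
    rw [fourierFn_eq_fourier, ← mul_assoc, mul_inv_cancel₀ sqrt_two_pi_ne_zero, one_mul]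
    field_simp
  have hFi : Integrable (FourierTransform.fourier g) := by
    rw [hF]
    exact (hfi.comp_mul_left' h2).const_mul _
  have hinv := hc.fourierInv_fourier_eq hi hFi
  funext ξ
  rw [← congrFun hinv ξ, Real.fourierInv_eq', hF, fourierFn]
  have h3 : (∫ x : ℝ, Complex.exp (-Complex.I * x * ξ) * fourierFn g (-x)) =
      ∫ y : ℝ, Complex.exp (Complex.I * y * ξ) * fourierFn g y := by
    rw [← integral_neg_eq_self fun y : ℝ => Complex.exp (Complex.I * y * ξ) * fourierFn g y]
    congr 1; funext x
    push_cast; ring_nf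
  have h4 := Measure.integral_comp_mul_left
    (fun y : ℝ => Complex.exp (Complex.I * y * ξ) * fourierFn g y) (2 * Real.pi)
  rw [h3]
  have h5 : (∫ v : ℝ, Complex.exp (((2 * Real.pi * inner ℝ v ξ : ℝ) : ℂ) * Complex.I) •
      ((Real.sqrt (2 * Real.pi) : ℂ) * fourierFn g (2 * Real.pi * v))) =
      (Real.sqrt (2 * Real.pi) : ℂ) * ∫ v : ℝ, Complex.exp (Complex.I * (2 * Real.pi * v : ℝ) * ξ) *
        fourierFn g (2 * Real.pi * v) := by
    rw [← integral_const_mul]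
    congr 1; funext v
    simp only [RCLike.inner_apply, conj_trivial, smul_eq_mul]
    rw [mul_left_comm]
    congr 3
    push_cast; ring
  rw [h5, h4, abs_of_pos (by positivity), Complex.real_smul, ← mul_assoc]
  congr 1
  have := sqrt_two_pi_mul_self
  have h6 := sqrt_two_pi_ne_zero
  have hpi : (Real.pi : ℂ) ≠ 0 := by exact_mod_cast Real.pi_ne_zero
  rw [inv_eq_iff_eq_inv, mul_inv, Complex.ofReal_inv, inv_inv]
  push_cast
  rw [← this]
  field_simp

/-! ### Reconstruction of a function from its transform -/

section

variable {P : PowerSet} {a : ℕ → ℕ → ℂ} {h : ℂ → ℂ} {g : ℝ → ℂ}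

/-- `f` is the inverse Fourier transform of the remainder of `g` after subtraction of `gSum`,
and it is `M` times continuously differentiable. -/
structure IsRemainder (P : PowerSet) (a : ℕ → ℕ → ℂ) (g : ℝ → ℂ) (M N K : ℕ) (f : ℝ → ℂ) :
    Prop where
  lt_re : M < (P.p (N + 1)).re
  le_re_add : (P.p (N + 1)).re ≤ (P.p 0).re + (K + 1 : ℕ)
  contDiff : ContDiff ℝ M f
  vanish : ∀ x ≤ 0, f x = 0
  symAt : ∀ k ≤ M, ∀ ρ, SymAt atTop k ρ 0 f
  integrable : Integrable f
  fourierFn_eq : ∀ ξ, fourierFn f ξ = g ξ - gSum P a N (K + 1) ξ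

/-- The difference `q` of `g` and `gSum` is of order `-Re p_{N+1} - 1` with `Re p_{N+1} > M`. So
`|ξ|^i q^{(j)}` is integrable for `i ≤ M` and all `j`: the weights make the transform `C^M`, the
derivatives make it rapidly decreasing. Paley–Wiener and continuity make it vanish for `x ≥ 0`, and
the inverse transform is its reflection. -/
theorem IsLowerTransform.exists_isRemainder (hreg : ∀ j, ∀ m : ℕ, P.p j + 1 ≠ -m)
    (H : IsLowerTransform P a h g) (n M : ℕ) :
    ∃ N K f, n ≤ N ∧ IsRemainder P a g M N K f := by
  obtain ⟨N, hN, hMN⟩ := P.exists_re_gt n M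
  obtain ⟨K, hK⟩ := exists_nat_gt ((P.p (N + 1)).re - (P.p 0).re)
  have hK1 : (P.p (N + 1)).re ≤ (P.p 0).re + (K + 1 : ℕ) := by push_cast; linarith
  have hM0 : (0 : ℝ) ≤ M := Nat.cast_nonneg M
  set q : ℝ → ℂ := fun ξ => g ξ - gSum P a N (K + 1) ξ with hq
  have hqc : ContDiff ℝ ∞ q := H.contDiff.sub (contDiff_gSum hreg a N (K + 1))
  have hqs : ∀ k, SymAt (cocompact ℝ) k (-(P.p (N + 1)).re - 1) P.logDegree q := fun k => by
    have := (H.symAt N k).sub (symAt_gSum_sub hreg a N k hK1)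
    simpa [hq] using this
  have hint : ∀ i ≤ M, ∀ j : ℕ, Integrable fun x : ℝ => ‖x‖ ^ i * ‖iteratedDeriv j q x‖ :=
    fun i hi j => by
      have hi' : (i : ℝ) ≤ M := by exact_mod_cast hi
      have hj : (0 : ℝ) ≤ j := Nat.cast_nonneg j
      exact integrable_pow_mul_of_isBigO
        (hqc.continuous_iteratedDeriv j (by exact_mod_cast le_top)) (hqs j).bound (by linarith)
  have hqi : Integrable q := by
    have := hint 0 (Nat.zero_le M) 0
    simp only [pow_zero, one_mul, iteratedDeriv_zero] at this
    exact (integrable_norm_iff hqc.continuous.aestronglyMeasurable).1 this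
  have hFc : ContDiff ℝ M (fourierFn q) := contDiff_fourierFn fun n hn => by
    simpa using hint n hn 0
  have hFb : ∀ k ≤ M, ∀ n : ℕ, ∃ C, ∀ x : ℝ, |x| ^ n * ‖iteratedDeriv k (fourierFn q) x‖ ≤ C :=
    fun k hk n => exists_pow_mul_iteratedDeriv_fourierFn_le
      (hqc.of_le (by exact_mod_cast le_top)) fun i hi j _ => hint i (hi.trans hk) j
  have hgs := slowGrowth_gSum hreg a N (K + 1)
  have hbv : HasLowerBV (fun ζ => h ζ - gSum P a N (K + 1) ζ) (regular q) := by
    have h1 := (hasLowerBV_regular ((differentiableOn_gSum hreg a N (K + 1)).mono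
      (fun ζ (hζ : ζ.im < 0) => lt_trans hζ one_pos)) (lowerGrowth_gSum hreg a N (K + 1))
      (contDiff_gSum hreg a N (K + 1) (n := 0)).continuous (tendsto_gSum hreg a N (K + 1))).2
    have h2 := H.hasLowerBV.sub h1
    rwa [← regular_sub H.slowGrowth hgs] at h2
  have hpw : ∀ x : ℝ, 0 < x → fourierFn q x = 0 := fun x hx =>
    fourierFn_eq_zero_of_hasLowerBV
      (H.differentiableOn.fun_sub ((differentiableOn_gSum hreg a N (K + 1)).mono
        (fun ζ (hζ : ζ.im < 0) => lt_trans hζ one_pos)))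
      (by simpa [sub_eq_add_neg] using
        H.lowerGrowth.add ((lowerGrowth_gSum hreg a N (K + 1)).const_mul (-1)))
      hqi hbv hx
  have hpw0 : ∀ x : ℝ, 0 ≤ x → fourierFn q x = 0 := fun x hx => by
    have hcl : closure (Set.Ioi (0 : ℝ)) ⊆ {x | fourierFn q x = 0} :=
      closure_minimal (fun y hy => hpw y hy) (isClosed_eq hFc.continuous continuous_const)
    rw [closure_Ioi] at hcl
    exact hcl hx
  have hFi : Integrable (fourierFn q) := by
    obtain ⟨C, hC⟩ := hFb 0 (Nat.zero_le M) 2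
    have := integrable_pow_mul_of_isBigO (i := 0) (s := -2) (μ := 0) hFc.continuous
      (IsBigO.of_bound C (by
        filter_upwards [eventually_one_le_abs_cocompact 1] with x hx
        have hx0 : 0 < |x| := by linarith
        have h1 := hC x
        rw [iteratedDeriv_zero] at h1
        rw [Real.norm_of_nonneg (gauge_nonneg _ _ _), gauge_zero_right]
        beta_reduce
        rw [Real.rpow_neg hx0.le, Real.rpow_ofNat, ← div_eq_mul_inv, le_div_iff₀ (by positivity)]
        linarith)) (by norm_num)
    simp only [pow_zero, one_mul] at this
    exact (integrable_norm_iff hFc.continuous.aestronglyMeasurable).1 this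
  refine ⟨N, K, fun x => fourierFn q (-x), hN, hMN, hK1, hFc.comp contDiff_neg,
    fun x hx => hpw0 _ (by linarith), fun k hk ρ => ⟨?_, ?_⟩, hFi.comp_neg,
    fun ξ => congrFun (fourierFn_fourierFn_neg hqc.continuous hqi hFi) ξ⟩
  · exact Eventually.of_forall fun x =>
      ((hFc.comp contDiff_neg).of_le (by exact_mod_cast hk)).contDiffAt
  · obtain ⟨n, hn⟩ := exists_nat_ge (k - ρ)
    obtain ⟨C, hC⟩ := hFb k hk n
    have hC0 : 0 ≤ C := le_trans (by positivity) (hC 0)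
    refine IsBigO.of_bound C ?_
    filter_upwards [eventually_ge_atTop 1] with x hx
    have hx0 : 0 < x := by linarith
    have h1 := hC (-x)
    rw [abs_neg, abs_of_pos hx0] at h1
    rw [iteratedDeriv_comp_neg, Real.norm_of_nonneg (gauge_nonneg _ _ _), gauge_zero_right,
      norm_smul, norm_pow, norm_neg, norm_one, one_pow, one_mul]
    beta_reduce
    rw [abs_of_pos hx0]
    have h2 : x ^ (-(n : ℝ)) ≤ x ^ (ρ - k) := Real.rpow_le_rpow_of_exponent_le hx (by linarith)
    refine le_trans ?_ (mul_le_mul_of_nonneg_left h2 hC0)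
    rw [Real.rpow_neg hx0.le, Real.rpow_natCast, ← div_eq_mul_inv, le_div_iff₀ (by positivity)]
    linarith

namespace IsRemainder

variable {M N K M' N' K' : ℕ} {f f' : ℝ → ℂ}

theorem zeroExt_eq (R : IsRemainder P a g M N K f) : zeroExt f = f := by
  funext x
  by_cases hx : 0 < x
  · simp [zeroExt, hx]
  · simp [zeroExt, hx, R.vanish x (not_lt.1 hx)]

theorem neg_one_lt_re (R : IsRemainder P a g M N K f) : -1 < (P.p (N + 1)).re := by
  have : (0 : ℝ) ≤ M := Nat.cast_nonneg M
  linarith [R.lt_re]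

theorem integrable_zeroExt_sub (R : IsRemainder P a g M N K f) : Integrable
    (zeroExt fun x => (modelSum P a N (K + 1) x + f x) - modelSum P a N (K + 1) x) := by
  simpa [R.zeroExt_eq] using R.integrable

theorem slowGrowth (R : IsRemainder P a g M N K f) : SlowGrowth
    (zeroExt fun x => (modelSum P a N (K + 1) x + f x) - partialSumZero P a N x) :=
  slowGrowth_sub_partialSumZero (by linarith [R.neg_one_lt_re, R.le_re_add])
    (slowGrowth_of_integrable R.integrable_zeroExt_sub)

theorem fourierD_extendPos (hreg : ∀ j, ∀ m : ℕ, P.p j + 1 ≠ -m)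
    (R : IsRemainder P a g M N K f) :
    fourierD (extendPos P (fun x => modelSum P a N (K + 1) x + f x) a N) = regular g := by
  rw [LogPoly.fourierD_extendPos hreg (by linarith [R.neg_one_lt_re, R.le_re_add])
    R.integrable_zeroExt_sub]
  congr 1; funext ξ
  simp only [add_sub_cancel_left]
  have : fourierFn (zeroExt fun x => f x) ξ = fourierFn f ξ := congrFun (congrArg _ R.zeroExt_eq) ξ
  rw [this, R.fourierFn_eq]; ring

/-- Both functions have extensions with Fourier transform `g`, so the extensions agree. Written at
the common level `max N N'` they contain the same singular sum, because `a` is the same, and the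
regular parts can be compared. -/
theorem eqOn (hreg : ∀ j, ∀ m : ℕ, P.p j + 1 ≠ -m) (R : IsRemainder P a g M N K f)
    (R' : IsRemainder P a g M' N' K' f') :
    Set.EqOn (fun x => modelSum P a N (K + 1) x + f x)
      (fun x => modelSum P a N' (K' + 1) x + f' x) (Set.Ioi 0) := by
  obtain ⟨h1, h2⟩ := extendPos_of_le R.neg_one_lt_re R.slowGrowth (le_max_left N N')
  obtain ⟨h1', h2'⟩ := extendPos_of_le R'.neg_one_lt_re R'.slowGrowth (le_max_right N N')
  have h3 := fourierD_injective
    ((R.fourierD_extendPos hreg).trans (R'.fourierD_extendPos hreg).symm)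
  rw [← h2, ← h2', extendPos_eq, extendPos_eq] at h3
  have h4 := eqOn_of_regular_zeroExt_eq h1 h1' ?_ ?_ (add_left_cancel h3)
  · intro x hx
    have := h4 hx
    simpa using this
  · exact ((contDiffOn_modelSum a N (K + 1) (n := 0)).continuousOn.add
      R.contDiff.continuous.continuousOn).sub (continuousOn_partialSumZero a _)
  · exact ((contDiffOn_modelSum a N' (K' + 1) (n := 0)).continuousOn.add
      R'.contDiff.continuous.continuousOn).sub (continuousOn_partialSumZero a _)

end IsRemainder

theorem SymAt.congr_of_eqOn_zero {f f' : ℝ → ℂ} {k μ : ℕ} {s : ℝ}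
    (hf : SymAt (𝓝[>] 0) k s μ f) (h : Set.EqOn f f' (Set.Ioi 0)) : SymAt (𝓝[>] 0) k s μ f' :=
  hf.congr (by
    filter_upwards [self_mem_nhdsWithin] with x hx
    exact h.eventuallyEq_of_mem (isOpen_Ioi.mem_nhds hx))

theorem SymAt.congr_of_eqOn_top {f f' : ℝ → ℂ} {k μ : ℕ} {s : ℝ}
    (hf : SymAt atTop k s μ f) (h : Set.EqOn f f' (Set.Ioi 0)) : SymAt atTop k s μ f' :=
  hf.congr (by
    filter_upwards [eventually_gt_atTop 0] with x hx
    exact h.eventuallyEq_of_mem (isOpen_Ioi.mem_nhds hx))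

theorem IsLowerTransform.exists_memSchwartzP (hreg : ∀ j, ∀ m : ℕ, P.p j + 1 ≠ -m)
    (H : IsLowerTransform P a h g) : ∃ u, MemSchwartzP P u ∧ HasExpansionAtZero P u a ∧
      ∃ N, -1 < (P.p (N + 1)).re ∧ fourierD (extendPos P u a N) = regular g := by
  -- The remainder with `M = 0` fixes `u`. Every further derivative is then obtained from a smoother
  -- remainder, which represents the same `u` on the half-line.
  obtain ⟨N₀, K₀, f₀, -, R₀⟩ := H.exists_isRemainder hreg 0 0
  set u : ℝ → ℂ := fun x => modelSum P a N₀ (K₀ + 1) x + f₀ x with hu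
  have hsm : ContDiffOn ℝ ∞ u (Set.Ioi 0) := by
    refine contDiffOn_infty.2 fun n => ?_
    obtain ⟨N, K, f, -, R⟩ := H.exists_isRemainder hreg 0 n
    exact ((contDiffOn_modelSum a N (K + 1)).add R.contDiff.contDiffOn).congr
      (R₀.eqOn hreg R)
  have htop : ∀ k ρ, SymAt atTop k ρ 0 u := fun k ρ => by
    obtain ⟨N, K, f, -, R⟩ := H.exists_isRemainder hreg 0 k
    exact ((symAt_top_modelSum a N (K + 1) k ρ).add (R.symAt k le_rfl ρ)).congr_of_eqOn_top
      (R.eqOn hreg R₀)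
  have hexp : HasExpansionAtZero P u a := by
    refine (hasExpansionAtZero_iff_symAt hsm).2 fun n k => ?_
    -- `M ≥ k` makes the `k`-th derivative of the remainder available; `M ≥ Re p_{n+1}` makes its
    -- vanishing of order `M` at zero as good as the required error.
    obtain ⟨M, hM⟩ := exists_nat_ge (max (k : ℝ) (P.p (n + 1)).re)
    have hkM : k ≤ M := by exact_mod_cast (le_max_left _ _).trans hM
    have hpM : (P.p (n + 1)).re ≤ M := (le_max_right _ _).trans hM
    obtain ⟨N, K, f, hN, R⟩ := H.exists_isRemainder hreg n M
    have h1 := symAt_zero_tailSum (P := P) a N k (K := K + 1) (s := (P.p (n + 1)).re)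
      (by linarith [R.lt_re, R.le_re_add])
    have h2 := symAt_zero_partialSumZero_sub (P := P) a hN k
    have h3 := (symAt_zero_of_vanish R.contDiff (fun x hx => R.vanish x hx.le) hkM).mono_zero
      hpM (Nat.zero_le P.logDegree)
    refine ((h1.add h2).add h3).congr_of_eqOn_zero fun x hx => ?_
    have h4 := R.eqOn hreg R₀ hx
    beta_reduce at h4 ⊢
    rw [hu]
    beta_reduce
    rw [← h4, tailSum_eq]; ring
  exact ⟨u, ⟨hsm, fun k => (symAt_top_iff hsm k).2 (htop k), a, hexp⟩, hexp, N₀,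
    R₀.neg_one_lt_re, R₀.fourierD_extendPos hreg⟩

end

/-! ### Reflection -/

theorem sign_mul_self_real (σ : ℤˣ) : (((σ : ℤ) : ℝ)) * ((σ : ℤ) : ℝ) = 1 := by
  rcases Int.units_eq_one_or σ with rfl | rfl <;> simp

theorem sign_mul_self_complex (σ : ℤˣ) : (((σ : ℤ) : ℂ)) * ((σ : ℤ) : ℂ) = 1 := by
  rcases Int.units_eq_one_or σ with rfl | rfl <;> simp

theorem sign_mul_sign_mul_real (σ : ℤˣ) (x : ℝ) : ((σ : ℤ) : ℝ) * (((σ : ℤ) : ℝ) * x) = x := by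
  rw [← mul_assoc, sign_mul_self_real, one_mul]

theorem sign_mul_sign_mul_complex (σ : ℤˣ) (x : ℂ) : ((σ : ℤ) : ℂ) * (((σ : ℤ) : ℂ) * x) = x := by
  rw [← mul_assoc, sign_mul_self_complex, one_mul]

theorem integral_comp_sign_mul (σ : ℤˣ) (f : ℝ → ℂ) : ∫ x, f (((σ : ℤ) : ℝ) * x) = ∫ x, f x := by
  rcases Int.units_eq_one_or σ with rfl | rfl
  · simp
  · simpa using integral_neg_eq_self f volume

theorem SlowGrowth.comp_sign_mul (σ : ℤˣ) {f : ℝ → ℂ} (hf : SlowGrowth f) :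
    SlowGrowth fun x => f (((σ : ℤ) : ℝ) * x) := by
  rcases Int.units_eq_one_or σ with rfl | rfl
  · simpa using hf
  · obtain ⟨K, hK⟩ := hf
    exact ⟨K, by simpa using hK.comp_neg⟩

theorem dilate_sign_apply (σ : ℤˣ) (φ : 𝓢(ℝ, ℂ)) (x : ℝ) :
    dilate (Units.map (Int.castRingHom ℝ : ℤ →* ℝ) σ) φ x = φ (((σ : ℤ) : ℝ) * x) := by
  rw [dilate_apply, mul_comm]; rfl

theorem reflect_apply (σ : ℤˣ) (U : 𝓢'(ℝ, ℂ)) (φ : 𝓢(ℝ, ℂ)) :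
    reflect σ U φ = U (dilate (Units.map (Int.castRingHom ℝ : ℤ →* ℝ) σ) φ) := rfl

theorem reflect_reflect (σ : ℤˣ) (U : 𝓢'(ℝ, ℂ)) : reflect σ (reflect σ U) = U := by
  ext φ
  rw [reflect_apply, reflect_apply]
  congr 1
  ext x
  rw [dilate_sign_apply, dilate_sign_apply, sign_mul_sign_mul_real]

theorem reflect_regular (σ : ℤˣ) {f : ℝ → ℂ} (hf : SlowGrowth f) :
    reflect σ (regular f) = regular fun x => f (((σ : ℤ) : ℝ) * x) := by
  ext φ
  rw [reflect_apply, regular_apply hf, regular_apply (hf.comp_sign_mul σ),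
    ← integral_comp_sign_mul σ]
  simp only [dilate_sign_apply, sign_mul_sign_mul_real]

theorem fourierD_reflect (σ : ℤˣ) (U : 𝓢'(ℝ, ℂ)) :
    fourierD (reflect σ U) = reflect σ (fourierD U) := by
  ext φ
  rw [fourierD_apply, reflect_apply, reflect_apply, fourierD_apply]
  congr 1
  ext ξ
  rw [dilate_sign_apply, fourierS_apply, fourierS_apply, ← integral_comp_sign_mul σ]
  congr 2; funext x
  rw [dilate_sign_apply]
  congr 2
  push_cast
  linear_combination (-Complex.I * x * ξ) * sign_mul_self_complex σ

theorem SymAt.comp_sign_mul (σ : ℤˣ) {k μ : ℕ} {r : ℝ} {f : ℝ → ℂ}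
    (hf : SymAt (cocompact ℝ) k r μ f) :
    SymAt (cocompact ℝ) k r μ fun x => f (((σ : ℤ) : ℝ) * x) := by
  rcases Int.units_eq_one_or σ with rfl | rfl
  · simpa using hf
  · have ht : Tendsto (fun x : ℝ => -x) (cocompact ℝ) (cocompact ℝ) :=
      (Homeomorph.neg ℝ).isClosedEmbedding.tendsto_cocompact
    have hg : gauge (r - k) μ ∘ (fun x : ℝ => -x) = gauge (r - k) μ := by
      funext x; simp [gauge]
    simp only [Units.val_neg, Units.val_one, Int.cast_neg, Int.cast_one, neg_mul, one_mul]
    refine ⟨?_, ?_⟩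
    · filter_upwards [ht.eventually hf.smooth] with x hx
      exact hx.comp x contDiff_neg.contDiffAt
    · have := hf.bound.comp_tendsto ht
      rw [hg] at this
      refine (IsBigO.of_bound 1 (Eventually.of_forall fun x => ?_)).trans this
      rw [iteratedDeriv_comp_neg, norm_smul]
      simp

theorem isOpen_halfPlane (σ : ℤˣ) : IsOpen (halfPlane σ) :=
  isOpen_lt (continuous_const.mul Complex.continuous_im) continuous_const

theorem sign_mul_mem_halfPlane (σ : ℤˣ) (ζ : ℂ) :
    ((σ : ℤ) : ℂ) * ζ ∈ halfPlane σ ↔ ζ.im < 0 := by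
  have : (((σ : ℤ) : ℂ) * ζ).im = ((σ : ℤ) : ℝ) * ζ.im := by simp
  rw [halfPlane, Set.mem_ofPred_eq, this, sign_mul_sign_mul_real]

theorem mem_halfPlane_iff (σ : ℤˣ) (ζ : ℂ) :
    ζ ∈ halfPlane σ ↔ (((σ : ℤ) : ℂ) * ζ).im < 0 := by
  rw [← sign_mul_mem_halfPlane σ, sign_mul_sign_mul_complex]

theorem norm_sign_mul (σ : ℤˣ) (ζ : ℂ) : ‖((σ : ℤ) : ℂ) * ζ‖ = ‖ζ‖ := by
  rcases Int.units_eq_one_or σ with rfl | rfl <;> simp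

theorem analyticOnNhd_halfPlane_iff (σ : ℤˣ) (h : ℂ → ℂ) :
    AnalyticOnNhd ℂ h (halfPlane σ) ↔
      DifferentiableOn ℂ (fun ζ => h (((σ : ℤ) : ℂ) * ζ)) {ζ | ζ.im < 0} := by
  rw [Complex.analyticOnNhd_iff_differentiableOn (isOpen_halfPlane σ)]
  refine ⟨fun H => H.comp (by fun_prop) fun ζ hζ => (sign_mul_mem_halfPlane σ ζ).2 hζ,
    fun H => ?_⟩
  have := H.comp (f := fun ζ : ℂ => ((σ : ℤ) : ℂ) * ζ) (s := halfPlane σ) (by fun_prop)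
    fun ζ hζ => (mem_halfPlane_iff σ ζ).1 hζ
  refine this.congr fun ζ _ => ?_
  simp only [Function.comp_apply, sign_mul_sign_mul_complex]

theorem polynomialGrowth_iff (σ : ℤˣ) (h : ℂ → ℂ) :
    PolynomialGrowth σ h ↔ LowerGrowth fun ζ => h (((σ : ℤ) : ℂ) * ζ) := by
  have h1 : ∀ ζ : ℂ, Real.sqrt (1 + ‖ζ‖ ^ 2) ≤ 1 + ‖ζ‖ := fun ζ => by
    rw [Real.sqrt_le_left (by positivity)]
    nlinarith [norm_nonneg ζ]
  have h2 : ∀ ζ : ℂ, 1 + ‖ζ‖ ≤ 2 * Real.sqrt (1 + ‖ζ‖ ^ 2) := fun ζ => by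
    have h3 : 1 ≤ Real.sqrt (1 + ‖ζ‖ ^ 2) := Real.one_le_sqrt.2 (by nlinarith [norm_nonneg ζ])
    have h4 : ‖ζ‖ ≤ Real.sqrt (1 + ‖ζ‖ ^ 2) := Real.le_sqrt_of_sq_le (by linarith)
    linarith
  constructor
  · rintro ⟨m, C, hC, H⟩
    refine ⟨C, m, hC.le, fun ζ hζ => (H _ ((sign_mul_mem_halfPlane σ ζ).2 hζ)).trans ?_⟩
    rw [norm_sign_mul]
    exact mul_le_mul_of_nonneg_left (pow_le_pow_left₀ (by positivity) (h1 ζ) m) hC.le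
  · rintro ⟨C, m, hC, H⟩
    refine ⟨m, (C + 1) * 2 ^ m, by positivity, fun ζ hζ => ?_⟩
    have h3 := H _ ((mem_halfPlane_iff σ ζ).1 hζ)
    beta_reduce at h3
    rw [sign_mul_sign_mul_complex, norm_sign_mul] at h3
    refine h3.trans ?_
    rw [mul_assoc, ← mul_pow]
    exact mul_le_mul (by linarith) (pow_le_pow_left₀ (by positivity) (h2 ζ) m) (by positivity)
      (by positivity)

theorem hasBoundaryValue_iff (σ : ℤˣ) (h : ℂ → ℂ) (H : 𝓢'(ℝ, ℂ)) :
    HasBoundaryValue σ h H ↔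
      HasLowerBV (fun ζ => h (((σ : ℤ) : ℂ) * ζ)) (reflect σ H) := by
  set F : ℝ → ℝ → ℂ := fun η ξ => h (ξ - (σ : ℤ) * η * Complex.I) with hF
  have h1 : ∀ η : ℝ, (fun ξ : ℝ => h (((σ : ℤ) : ℂ) * (ξ - η * Complex.I))) =
      fun ξ => F η (((σ : ℤ) : ℝ) * ξ) := fun η => by
    funext ξ
    simp only [hF]
    congr 1; push_cast; ring
  have h2 : ∀ η : ℝ, (fun ξ => F η (((σ : ℤ) : ℝ) * (((σ : ℤ) : ℝ) * ξ))) = F η := fun η => by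
    simp only [sign_mul_sign_mul_real]
  constructor
  · rintro ⟨hs, ht⟩
    refine ⟨fun η hη => by rw [h1]; exact (hs η hη).comp_sign_mul σ, ?_⟩
    refine (((reflect σ).continuous.tendsto H).comp ht).congr' ?_
    filter_upwards [self_mem_nhdsWithin] with η hη
    simp only [Function.comp_apply]
    rw [reflect_regular σ (hs η hη), h1]
  · rintro ⟨hs, ht⟩
    have hs' : ∀ η : ℝ, 0 < η → SlowGrowth (F η) := fun η hη => by
      have := hs η hη
      rw [h1] at this
      have h3 := this.comp_sign_mul σ
      rwa [h2] at h3
    refine ⟨hs', ?_⟩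
    have h4 := ((reflect σ).continuous.tendsto (reflect σ H)).comp ht
    rw [reflect_reflect] at h4
    refine h4.congr' ?_
    filter_upwards [self_mem_nhdsWithin] with η hη
    simp only [Function.comp_apply]
    rw [reflect_regular σ (hs η hη)]
    have h5 := h1 η
    congr 1
    funext ξ
    have := congrFun h5 (((σ : ℤ) : ℝ) * ξ)
    beta_reduce at this
    rw [this, sign_mul_sign_mul_real]

/-! ### Powers of `ξ ∓ i0` -/

/-- The point `iσξ` arises from `ξ - σi0` by rotation through `σπ/2`. The argument of `ξ - σi0` is
`0` or `-σπ`, so the rotated one is `±π/2` and the principal branch is not left. -/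
theorem log_I_mul_sign (σ : ℤˣ) {ξ : ℝ} (hξ : ξ ≠ 0) :
    Complex.log (Complex.I * (((σ : ℤ) : ℝ) * ξ : ℝ)) =
      bvLog σ ξ + (σ : ℤ) * (Real.pi * Complex.I / 2) := by
  have hpos : ∀ x : ℝ, 0 < x → Complex.log (Complex.I * x) =
      Real.log x + Real.pi * Complex.I / 2 := fun x hx => by
    rw [mul_comm, Complex.log_ofReal_mul hx Complex.I_ne_zero, Complex.log_I]
    ring
  have hneg : ∀ x : ℝ, 0 < x → Complex.log (Complex.I * (-x : ℝ)) =
      Real.log x - Real.pi * Complex.I / 2 := fun x hx => by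
    rw [show Complex.I * ((-x : ℝ) : ℂ) = x * (-Complex.I) by push_cast; ring,
      Complex.log_ofReal_mul hx (neg_ne_zero.2 Complex.I_ne_zero), Complex.log_neg_I]
    ring
  rcases lt_or_gt_of_ne hξ with h | h
  · have h' : 0 < -ξ := by linarith
    rcases Int.units_eq_one_or σ with rfl | rfl
    · have := hneg (-ξ) h'
      simp only [neg_neg, Real.log_neg_eq_log] at this
      simp [bvLog, h, this]; ring
    · have := hpos (-ξ) h'
      simp only [Real.log_neg_eq_log] at this
      simp only [Units.val_neg, Units.val_one, Int.cast_neg, Int.cast_one, neg_mul, one_mul, this,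
        bvLog, h, if_true, Real.log_abs]
      ring
  · rcases Int.units_eq_one_or σ with rfl | rfl
    · simp [bvLog, not_lt.2 h.le, hpos ξ h]
    · have := hneg ξ h
      simp only [Units.val_neg, Units.val_one, Int.cast_neg, Int.cast_one, neg_mul, one_mul, this,
        bvLog, not_lt.2 h.le, if_false, Real.log_abs]
      ring

theorem cpow_I_mul_sign (σ : ℤˣ) (s : ℂ) {ξ : ℝ} (hξ : ξ ≠ 0) :
    (Complex.I * (((σ : ℤ) : ℝ) * ξ : ℝ)) ^ (-s) =
      Complex.exp (-s * ((σ : ℤ) * (Real.pi * Complex.I / 2))) * bvPow σ (-s) ξ := by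
  have hσ : (((σ : ℤ) : ℝ)) ≠ 0 := by
    intro h
    have := sign_mul_self_real σ
    rw [h] at this; simp at this
  rw [Complex.cpow_def_of_ne_zero (mul_ne_zero Complex.I_ne_zero
    (Complex.ofReal_ne_zero.2 (mul_ne_zero hσ hξ))), log_I_mul_sign σ hξ, bvPow,
    ← Complex.exp_add]
  congr 1; ring

theorem bvPow_eq (σ : ℤˣ) (w : ℂ) {ξ : ℝ} (hξ : ξ ≠ 0) :
    bvPow σ w ξ = posPow w ξ + Complex.exp (-((σ : ℤ) * Real.pi * Complex.I * w)) * negPow w ξ := by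
  rcases lt_or_gt_of_ne hξ with h | h
  · have h1 : ((|ξ| : ℝ) : ℂ) ≠ 0 := Complex.ofReal_ne_zero.2 (abs_pos.2 hξ).ne'
    simp only [bvPow, bvLog, posPow, negPow, h, not_lt.2 h.le, if_true, if_false, zero_add]
    rw [Complex.cpow_def_of_ne_zero h1, ← Complex.exp_add, ← Complex.ofReal_log (abs_nonneg _)]
    congr 1; ring
  · have h1 : (ξ : ℂ) ≠ 0 := Complex.ofReal_ne_zero.2 hξ
    simp only [bvPow, bvLog, posPow, negPow, h, not_lt.2 h.le, if_true, if_false, mul_zero,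
      add_zero, sub_zero]
    rw [Complex.cpow_def_of_ne_zero h1, ← Complex.ofReal_log h.le, abs_of_pos h]
    congr 1; ring

/-! ### Linear algebra between the coefficients at zero and at infinity -/

/-- The polynomial in `ln (ξ - σ i0)` whose product with `(ξ - σ i0)^{-s}` is
`(2π)^{-1/2} ∂_s^k (Γ(s) (i σ ξ)^{-s})`. -/
def symbolPoly (σ : ℤˣ) (s : ℂ) (k : ℕ) : Polynomial ℂ :=
  ∑ i ∈ Finset.range (k + 1), Polynomial.C (((Real.sqrt (2 * Real.pi))⁻¹ : ℂ) *
    ((k.choose i : ℂ) * iteratedDeriv i Complex.Gamma s *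
      Complex.exp (-s * ((σ : ℤ) * (Real.pi * Complex.I / 2))))) *
    (-(Polynomial.X + Polynomial.C ((σ : ℤ) * (Real.pi * Complex.I / 2)))) ^ (k - i)

theorem symbolPoly_eval (σ : ℤˣ) {s : ℂ} (hs : ∀ m : ℕ, s ≠ -m) (k : ℕ) {ξ : ℝ} (hξ : ξ ≠ 0) :
    ((Real.sqrt (2 * Real.pi))⁻¹ : ℂ) * gammaPow k s (Complex.I * (((σ : ℤ) : ℝ) * ξ : ℝ)) =
      (symbolPoly σ s k).eval (bvLog σ ξ) * bvPow σ (-s) ξ := by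
  have hσ : (((σ : ℤ) : ℝ)) ≠ 0 := by
    intro h
    have := sign_mul_self_real σ
    rw [h] at this; simp at this
  rw [gammaPow_eq_sum hs (mul_ne_zero Complex.I_ne_zero
    (Complex.ofReal_ne_zero.2 (mul_ne_zero hσ hξ))), log_I_mul_sign σ hξ,
    cpow_I_mul_sign σ s hξ, symbolPoly, Polynomial.eval_finsetSum, Finset.sum_mul,
    Finset.mul_sum]
  refine Finset.sum_congr rfl fun i _ => ?_
  simp only [Polynomial.eval_mul, Polynomial.eval_C, Polynomial.eval_pow, Polynomial.eval_neg,
    Polynomial.eval_add, Polynomial.eval_X]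
  ring

theorem natDegree_neg_X_add_C_pow_le (c : ℂ) (n : ℕ) :
    ((-(Polynomial.X + Polynomial.C c)) ^ n).natDegree ≤ n := by
  refine (Polynomial.natDegree_pow_le).trans ?_
  rw [Polynomial.natDegree_neg, Polynomial.natDegree_X_add_C, mul_one]

theorem symbolPoly_coeff_eq_zero (σ : ℤˣ) (s : ℂ) {k l : ℕ} (h : k < l) :
    (symbolPoly σ s k).coeff l = 0 := by
  rw [symbolPoly, Polynomial.finsetSum_coeff]
  refine Finset.sum_eq_zero fun i _ => ?_
  rw [Polynomial.coeff_C_mul, Polynomial.coeff_eq_zero_of_natDegree_lt, mul_zero]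
  exact (natDegree_neg_X_add_C_pow_le _ _).trans_lt (by omega)

/-- The top coefficient comes from `i = 0` alone and is `Γ(s)` times nonzero constants; `Γ` has no
zeros. -/
theorem symbolPoly_coeff_self_ne_zero (σ : ℤˣ) {s : ℂ} (hs : ∀ m : ℕ, s ≠ -m) (k : ℕ) :
    (symbolPoly σ s k).coeff k ≠ 0 := by
  rw [symbolPoly, Polynomial.finsetSum_coeff, Finset.sum_range_succ', Finset.sum_eq_zero, zero_add]
  · rw [Polynomial.coeff_C_mul, Nat.sub_zero]
    refine mul_ne_zero (mul_ne_zero (inv_ne_zero sqrt_two_pi_ne_zero) ?_) ?_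
    · simpa using Complex.Gamma_ne_zero hs
    · rw [neg_pow, ← Polynomial.C_1, ← Polynomial.C_neg, ← Polynomial.C_pow,
        Polynomial.coeff_C_mul]
      have h1 : ((Polynomial.X + Polynomial.C ((σ : ℤ) * (Real.pi * Complex.I / 2) : ℂ)) ^
          k).coeff k = 1 := by
        have := (Polynomial.monic_X_add_C ((σ : ℤ) * (Real.pi * Complex.I / 2) : ℂ)).pow k
        have h2 := this.coeff_natDegree
        rwa [Polynomial.natDegree_pow, Polynomial.natDegree_X_add_C, mul_one] at h2
      rw [h1, mul_one]
      exact pow_ne_zero _ (by norm_num)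
  · intro i hi
    rw [Polynomial.coeff_C_mul, Polynomial.coeff_eq_zero_of_natDegree_lt, mul_zero]
    have := Finset.mem_range.1 hi
    exact (natDegree_neg_X_add_C_pow_le _ _).trans_lt (by omega)

/-- Elimination of the top coefficient, one degree at a time. -/
theorem exists_sum_eq_of_triangular {Q : ℕ → Polynomial ℂ} (h0 : ∀ k l, k < l → (Q k).coeff l = 0)
    (h1 : ∀ k, (Q k).coeff k ≠ 0) (m : ℕ) : ∀ q : Polynomial ℂ, (∀ l, m ≤ l → q.coeff l = 0) →
    ∃ a : ℕ → ℂ, q = ∑ k ∈ Finset.range m, Polynomial.C (a k) * Q k := by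
  induction m with
  | zero =>
    intro q hq
    exact ⟨0, by ext l; simp [hq l (Nat.zero_le l)]⟩
  | succ m ih =>
    intro q hq
    obtain ⟨a, ha⟩ := ih (q - Polynomial.C (q.coeff m / (Q m).coeff m) * Q m) fun l hl => by
      rw [Polynomial.coeff_sub, Polynomial.coeff_C_mul]
      rcases hl.eq_or_lt with rfl | hl
      · rw [div_mul_cancel₀ _ (h1 m), sub_self]
      · rw [hq l hl, h0 m l hl, mul_zero, sub_zero]
    refine ⟨Function.update a m (q.coeff m / (Q m).coeff m), ?_⟩
    rw [Finset.sum_range_succ, Function.update_self, Finset.sum_congr rfl fun k hk => by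
      rw [Function.update_of_ne (Finset.mem_range.1 hk).ne], ← ha]
    ring

/-- The coefficients `c` at infinity correspond to the coefficients `a` at zero. -/
def CoeffLink (P : PowerSet) (σ : ℤˣ) (a c : ℕ → ℕ → ℂ) : Prop :=
  ∀ j, ∀ ξ : ℝ, ξ ≠ 0 → ∑ k ∈ Finset.range (P.m j + 1), a j k *
    (((Real.sqrt (2 * Real.pi))⁻¹ : ℂ) *
      gammaPow k (P.p j + 1) (Complex.I * (((σ : ℤ) : ℝ) * ξ : ℝ))) =
    ∑ l ∈ Finset.range (P.m j + 1), c j l * bvPow σ (-P.p j - 1) ξ * bvLog σ ξ ^ l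

section

variable {P : PowerSet}

theorem sum_symbolPoly_eq (hreg : ∀ j, ∀ m : ℕ, P.p j + 1 ≠ -m) (σ : ℤˣ) (a : ℕ → ℂ) (j : ℕ)
    {ξ : ℝ} (hξ : ξ ≠ 0) : ∑ k ∈ Finset.range (P.m j + 1), a k *
      (((Real.sqrt (2 * Real.pi))⁻¹ : ℂ) *
        gammaPow k (P.p j + 1) (Complex.I * (((σ : ℤ) : ℝ) * ξ : ℝ))) =
      (∑ k ∈ Finset.range (P.m j + 1), Polynomial.C (a k) * symbolPoly σ (P.p j + 1) k).eval
        (bvLog σ ξ) * bvPow σ (-P.p j - 1) ξ := by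
  rw [Polynomial.eval_finsetSum, Finset.sum_mul]
  refine Finset.sum_congr rfl fun k _ => ?_
  rw [symbolPoly_eval σ (hreg j) k hξ, Polynomial.eval_mul, Polynomial.eval_C, neg_add',
    mul_assoc]

theorem exists_coeffLink_right (hreg : ∀ j, ∀ m : ℕ, P.p j + 1 ≠ -m) (σ : ℤˣ) (a : ℕ → ℕ → ℂ) :
    ∃ c, CoeffLink P σ a c := by
  refine ⟨fun j l => (∑ k ∈ Finset.range (P.m j + 1),
    Polynomial.C (a j k) * symbolPoly σ (P.p j + 1) k).coeff l, fun j ξ hξ => ?_⟩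
  rw [sum_symbolPoly_eq hreg σ (a j) j hξ,
    Polynomial.eval_eq_sum_range' (n := P.m j + 1) ?_ (bvLog σ ξ), Finset.sum_mul]
  · exact Finset.sum_congr rfl fun l _ => by ring
  · refine Nat.lt_succ_of_le (Polynomial.natDegree_le_iff_coeff_eq_zero.2 fun l hl => ?_)
    rw [Polynomial.finsetSum_coeff]
    refine Finset.sum_eq_zero fun k hk => ?_
    rw [Polynomial.coeff_C_mul, symbolPoly_coeff_eq_zero σ _
      (by have := Finset.mem_range.1 hk; omega), mul_zero]

/-- For each `j` the polynomials `symbolPoly` with `k ≤ m_j` span all polynomials of degree at most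
`m_j`, so any coefficients at infinity come from coefficients at zero. -/
theorem exists_coeffLink_left (hreg : ∀ j, ∀ m : ℕ, P.p j + 1 ≠ -m) (σ : ℤˣ) (c : ℕ → ℕ → ℂ) :
    ∃ a, CoeffLink P σ a c := by
  have h := fun j => exists_sum_eq_of_triangular
    (fun k l => symbolPoly_coeff_eq_zero σ (P.p j + 1) (k := k) (l := l))
    (symbolPoly_coeff_self_ne_zero σ (hreg j)) (P.m j + 1)
    (∑ l ∈ Finset.range (P.m j + 1), Polynomial.C (c j l) * Polynomial.X ^ l) fun l hl => by
      rw [Polynomial.finsetSum_coeff]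
      refine Finset.sum_eq_zero fun k hk => ?_
      rw [Polynomial.coeff_C_mul, Polynomial.coeff_X_pow, if_neg, mul_zero]
      have := Finset.mem_range.1 hk; omega
  choose a ha using h
  refine ⟨a, fun j ξ hξ => ?_⟩
  rw [sum_symbolPoly_eq hreg σ (a j) j hξ, ← ha j, Polynomial.eval_finsetSum, Finset.sum_mul]
  refine Finset.sum_congr rfl fun l _ => ?_
  simp only [Polynomial.eval_mul, Polynomial.eval_C, Polynomial.eval_pow, Polynomial.eval_X]
  ring

theorem coeffLink_of_forall_m_eq_zero (hm : ∀ j, P.m j = 0) (σ : ℤˣ) (a : ℕ → ℕ → ℂ) :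
    CoeffLink P σ a fun j _ => a j 0 * (Complex.Gamma (P.p j + 1) / (Real.sqrt (2 * Real.pi) : ℂ) *
      Complex.exp (-((σ : ℤ) * Complex.I * Real.pi * (P.p j + 1) / 2))) := fun j ξ hξ => by
  rw [hm, zero_add, Finset.sum_range_one, Finset.sum_range_one, gammaPow, iteratedDeriv_zero,
    cpow_I_mul_sign σ _ hξ, pow_zero, neg_add',
    show (-P.p j - 1) * ((σ : ℤ) * (Real.pi * Complex.I / 2)) =
      -((σ : ℤ) * Complex.I * Real.pi * (P.p j + 1) / 2) by ring]
  ring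

theorem CoeffLink.symbolSum_eq {σ : ℤˣ} {a c : ℕ → ℕ → ℂ} (H : CoeffLink P σ a c) (N : ℕ) {ξ : ℝ}
    (hξ : ξ ≠ 0) : symbolSum P a N (((σ : ℤ) : ℝ) * ξ) = ∑ j ∈ Finset.range (N + 1),
      ∑ l ∈ Finset.range (P.m j + 1), c j l * bvPow σ (-P.p j - 1) ξ * bvLog σ ξ ^ l := by
  rw [symbolSum, P.sum_idx N fun j k => a j k * (((Real.sqrt (2 * Real.pi))⁻¹ : ℂ) *
    gammaPow k (P.p j + 1) (Complex.I * (((σ : ℤ) : ℝ) * ξ : ℝ)))]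
  exact Finset.sum_congr rfl fun j _ => H j ξ hξ

theorem contDiffAt_symbolSum (hreg : ∀ j, ∀ m : ℕ, P.p j + 1 ≠ -m) (a : ℕ → ℕ → ℂ) (N k : ℕ) :
    ∀ᶠ ξ in cocompact ℝ, ContDiffAt ℝ k (symbolSum P a N) ξ := by
  have h : SymAt (cocompact ℝ) k (-(P.p 0).re - 1) P.logDegree (symbolSum P a N) :=
    SymAt.sum _ fun i hi => (SymAt.const_mul _ ((symAt_gammaPow (hreg i.1) i.2 k).mono_infty
      (by simp only [Complex.add_re, Complex.one_re]; linarith [re_p_zero_le P i.1])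
      ((PowerSet.mem_idx.1 hi).2.trans (P.m_le_logDegree _)))).const_mul _
  exact h.smooth

/-- `CoeffLink` identifies the two partial sums off the origin, hence in a neighbourhood of every
large `ξ`, so all their derivatives agree too. -/
theorem hasExpansionAtInfinity_iff (hreg : ∀ j, ∀ m : ℕ, P.p j + 1 ≠ -m) {σ : ℤˣ}
    {a c : ℕ → ℕ → ℂ} (H : CoeffLink P σ a c) {G : ℝ → ℂ} (hG : ContDiff ℝ ∞ G) :
    HasExpansionAtInfinity P σ (fun ξ => G (((σ : ℤ) : ℝ) * ξ)) c ↔ ∀ N k,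
      SymAt (cocompact ℝ) k (-(P.p (N + 1)).re - 1) P.logDegree
        fun ξ => G ξ - symbolSum P a N ξ := by
  refine forall₂_congr fun N k => ?_
  have hev : ∀ᶠ ξ in cocompact ℝ, (fun ξ : ℝ => G (((σ : ℤ) : ℝ) * ξ) -
      symbolSum P a N (((σ : ℤ) : ℝ) * ξ)) =ᶠ[𝓝 ξ] fun ξ : ℝ => G (((σ : ℤ) : ℝ) * ξ) -
      ∑ j ∈ Finset.range (N + 1), ∑ l ∈ Finset.range (P.m j + 1),
        c j l * bvPow σ (-P.p j - 1) ξ * bvLog σ ξ ^ l := by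
    filter_upwards [eventually_one_le_abs_cocompact 1] with ξ hξ
    have hξ0 : ξ ≠ 0 := abs_pos.1 (by linarith)
    filter_upwards [eventually_ne_nhds hξ0] with y hy
    rw [H.symbolSum_eq N hy]
  constructor
  · intro h
    have h1 : SymAt (cocompact ℝ) k (-(P.p (N + 1)).re - 1) P.logDegree
        fun ξ => G ξ - symbolSum P a N ξ := by
      have hsm : ∀ᶠ ξ in cocompact ℝ, ContDiffAt ℝ k (fun ξ => G ξ - symbolSum P a N ξ) ξ :=
        (contDiffAt_symbolSum hreg a N k).mono fun ξ hξ =>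
          (hG.contDiffAt.of_le (by exact_mod_cast le_top)).sub hξ
      have h2 : SymAt (cocompact ℝ) k (-(P.p (N + 1)).re - 1) P.logDegree
          fun ξ : ℝ => G (((σ : ℤ) : ℝ) * ξ) - symbolSum P a N (((σ : ℤ) : ℝ) * ξ) := by
        refine ⟨?_, h.congr' ?_ EventuallyEq.rfl⟩
        · have ht : Tendsto (fun x : ℝ => ((σ : ℤ) : ℝ) * x) (cocompact ℝ) (cocompact ℝ) := by
            rcases Int.units_eq_one_or σ with rfl | rfl
            · simp only [Units.val_one, Int.cast_one, one_mul]
              exact tendsto_id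
            · simpa using (Homeomorph.neg ℝ).isClosedEmbedding.tendsto_cocompact
          filter_upwards [ht.eventually hsm] with ξ hξ
          exact hξ.comp ξ (contDiff_const.mul contDiff_id).contDiffAt
        · filter_upwards [hev] with ξ hξ using (hξ.iteratedDeriv_eq k).symm
      have h3 := h2.comp_sign_mul σ
      simpa only [sign_mul_sign_mul_real] using h3
    exact h1
  · intro h
    exact ((h.comp_sign_mul σ).congr hev).bound

/-! ### Uniqueness of the coefficients -/

theorem exists_exp_mul_ne_one {d : ℂ} (hd : d ≠ 0) : ∃ t : ℝ, Complex.exp (t * d) ≠ 1 := by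
  by_contra! h
  have h1 : HasDerivAt (fun t : ℝ => Complex.exp (t * d)) d 0 := by
    have h2 : HasDerivAt (fun t : ℝ => (t : ℂ) * d) (1 * d) 0 :=
      (hasDerivAt_id (0 : ℝ)).ofReal_comp.mul_const d
    simpa using h2.cexp
  rw [funext h] at h1
  exact hd (h1.unique (hasDerivAt_const _ _))

/-- Exponents may share their real part, so comparing sizes is not enough. Replacing `x` by `c x`
and subtracting `c^{q₀}` times the original relation removes `q₀` and multiplies each other
coefficient by `c^q - c^{q₀}`; a single remaining exponent is settled by its order. -/
theorem coeff_eq_zero_of_isBigO {r : ℝ} (n : ℕ) : ∀ (Q : Finset ℂ) (B : ℂ → ℂ), Q.card = n →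
    (∀ q ∈ Q, q.re < r) →
    ((fun x : ℝ => ∑ q ∈ Q, B q * (x : ℂ) ^ q) =O[𝓝[>] 0] fun x : ℝ => x ^ r) →
    ∀ q ∈ Q, B q = 0 := by
  induction n with
  | zero => intro Q B hQ _ _ q hq; simp_all
  | succ n ih =>
    intro Q B hQ hr hO q₁ hq₁
    by_cases hex : ∃ q₀ ∈ Q, q₀ ≠ q₁
    · obtain ⟨q₀, hq₀, hne⟩ := hex
      -- With `c = e^t` this choice makes `c^{q₁} ≠ c^{q₀}`, so the coefficient of `q₁` can be
      -- recovered after the elimination.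
      obtain ⟨t, ht⟩ := exists_exp_mul_ne_one (sub_ne_zero.2 hne.symm)
      set c : ℝ := Real.exp t with hc
      have hc0 : 0 < c := Real.exp_pos t
      have hcq : ∀ q : ℂ, (c : ℂ) ^ q = Complex.exp (t * q) := fun q => by
        rw [Complex.cpow_def_of_ne_zero (Complex.ofReal_ne_zero.2 hc0.ne'),
          ← Complex.ofReal_log hc0.le, hc, Real.log_exp]
      have hten : Tendsto (fun x : ℝ => c * x) (𝓝[>] 0) (𝓝[>] 0) := by
        refine tendsto_nhdsWithin_iff.2 ⟨?_, ?_⟩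
        · have : Continuous fun x : ℝ => c * x := by fun_prop
          exact (this.tendsto' 0 0 (by simp)).mono_left nhdsWithin_le_nhds
        · filter_upwards [self_mem_nhdsWithin] with x hx
          exact mul_pos hc0 hx
      have h1 : (fun x : ℝ => ∑ q ∈ Q, B q * ((c * x : ℝ) : ℂ) ^ q) =O[𝓝[>] 0]
          fun x : ℝ => x ^ r := by
        refine (hO.comp_tendsto hten).trans (IsBigO.of_bound (c ^ r) ?_)
        filter_upwards [self_mem_nhdsWithin] with x hx
        have hx : 0 < x := hx
        simp only [Function.comp_apply]
        rw [Real.mul_rpow hc0.le hx.le, norm_mul, Real.norm_of_nonneg (by positivity)]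
      have h2 : (fun x : ℝ => ∑ q ∈ Q.erase q₀, (B q * ((c : ℂ) ^ q - (c : ℂ) ^ q₀)) *
          (x : ℂ) ^ q) =O[𝓝[>] 0] fun x : ℝ => x ^ r := by
        refine (h1.sub (hO.const_mul_left ((c : ℂ) ^ q₀))).congr' ?_ EventuallyEq.rfl
        filter_upwards [self_mem_nhdsWithin] with x hx
        have hx : 0 < x := hx
        have h3 : ∑ q ∈ Q, B q * ((c * x : ℝ) : ℂ) ^ q - (c : ℂ) ^ q₀ *
            ∑ q ∈ Q, B q * (x : ℂ) ^ q =
            ∑ q ∈ Q, (B q * ((c : ℂ) ^ q - (c : ℂ) ^ q₀)) * (x : ℂ) ^ q := by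
          rw [Finset.mul_sum, ← Finset.sum_sub_distrib]
          refine Finset.sum_congr rfl fun q _ => ?_
          rw [Complex.ofReal_mul, Complex.mul_cpow_ofReal_nonneg hc0.le hx.le]
          ring
        rw [h3, ← Finset.add_sum_erase Q _ hq₀]
        simp
      have h4 := ih (Q.erase q₀) _ (by rw [Finset.card_erase_of_mem hq₀, hQ]; rfl)
        (fun q hq => hr q (Finset.mem_of_mem_erase hq)) h2 q₁
        (Finset.mem_erase.2 ⟨hne.symm, hq₁⟩)
      refine (mul_eq_zero.1 h4).resolve_right fun h5 => ht ?_
      rw [hcq, hcq, sub_eq_zero] at h5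
      rw [mul_sub, Complex.exp_sub, h5, div_self (Complex.exp_ne_zero _)]
    · push Not at hex
      have hQ1 : Q = {q₁} := Finset.eq_singleton_iff_unique_mem.2 ⟨hq₁, hex⟩
      rw [hQ1] at hO
      simp only [Finset.sum_singleton] at hO
      have hpos : 0 < r - q₁.re := sub_pos.2 (hr q₁ hq₁)
      have h1 : (fun _ : ℝ => B q₁) =O[𝓝[>] 0] fun x : ℝ => x ^ (r - q₁.re) := by
        obtain ⟨C, hC⟩ := hO.bound
        refine IsBigO.of_bound C ?_
        filter_upwards [hC, self_mem_nhdsWithin] with x hx hx0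
        have hx0 : 0 < x := hx0
        rw [norm_mul, Complex.norm_cpow_eq_rpow_re_of_pos hx0,
          Real.norm_of_nonneg (by positivity)] at hx
        rw [Real.norm_of_nonneg (by positivity), Real.rpow_sub hx0, ← mul_div_assoc,
          le_div_iff₀ (by positivity)]
        exact hx
      have h2 : Tendsto (fun x : ℝ => x ^ (r - q₁.re)) (𝓝[>] 0) (𝓝 0) := by
        have hcont : Continuous fun x : ℝ => x ^ (r - q₁.re) :=
          continuous_id.rpow_const fun x => Or.inr hpos.le
        exact (hcont.tendsto' 0 0 (Real.zero_rpow hpos.ne')).mono_left nhdsWithin_le_nhds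
      exact tendsto_nhds_unique tendsto_const_nhds (h1.trans_tendsto h2)

/-- Values of `p` may be repeated, so only the sums of the `b_j` over equal exponents vanish. This
is what is needed for any quantity `Φ` depending on the exponent alone. -/
theorem sum_smul_eq_zero_of_isBigO {r : ℝ} (s : Finset ℕ) (p b : ℕ → ℂ)
    (hr : ∀ j ∈ s, (p j).re < r)
    (h : (fun x : ℝ => ∑ j ∈ s, b j * (x : ℂ) ^ p j) =O[𝓝[>] 0] fun x : ℝ => x ^ r)
    {A : Type*} [AddCommGroup A] [Module ℂ A] (Φ : ℂ → A) : ∑ j ∈ s, b j • Φ (p j) = 0 := by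
  classical
  have h1 : (fun x : ℝ => ∑ q ∈ s.image p, (∑ j ∈ s with p j = q, b j) * (x : ℂ) ^ q)
      =O[𝓝[>] 0] fun x : ℝ => x ^ r := by
    refine h.congr_left fun x => ?_
    rw [← Finset.sum_fiberwise_of_maps_to (t := s.image p) (g := p)
      fun j hj => Finset.mem_image_of_mem p hj]
    refine Finset.sum_congr rfl fun q _ => ?_
    rw [Finset.sum_mul]
    refine Finset.sum_congr rfl fun j hj => ?_
    rw [(Finset.mem_filter.1 hj).2]
  have h2 := coeff_eq_zero_of_isBigO _ (s.image p) _ rfl (fun q hq => by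
    obtain ⟨j, hj, rfl⟩ := Finset.mem_image.1 hq
    exact hr j hj) h1
  rw [← Finset.sum_fiberwise_of_maps_to (t := s.image p) (g := p)
    fun j hj => Finset.mem_image_of_mem p hj]
  refine Finset.sum_eq_zero fun q hq => ?_
  have h3 := h2 q hq
  rw [Finset.sum_congr rfl fun j hj => by rw [(Finset.mem_filter.1 hj).2], ← Finset.sum_smul, h3,
    zero_smul]

/-- Cutting at such a gap makes the error smaller than every retained power, as uniqueness of the
coefficients requires. -/
theorem PowerSet.exists_re_lt_succ (P : PowerSet) (n : ℕ) :
    ∃ M ≥ n, (P.p M).re < (P.p (M + 1)).re := by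
  by_contra! h
  obtain ⟨N, hN, hlt⟩ := P.exists_re_gt n (P.p n).re
  have : ∀ k ≥ n, (P.p k).re ≤ (P.p n).re := fun k hk => by
    induction k, hk using Nat.le_induction with
    | base => exact le_rfl
    | succ k hk ih => exact (h k hk).trans ih
  linarith [this (N + 1) (by omega)]

theorem logDegree_eq_zero (hm : ∀ j, P.m j = 0) : P.logDegree = 0 := by
  simp [PowerSet.logDegree, hm]

/-- The difference of the two partial sums is of the order of the first omitted power, so
`sum_smul_eq_zero_of_isBigO` applies. Taking `Φ q = x^q` equates the functions, and `Φ q = xPosLog q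
0` equates their regularizations. -/
theorem extendPos_eq_extendPos (hm : ∀ j, P.m j = 0) {u : ℝ → ℂ} {a a' : ℕ → ℕ → ℂ}
    (ha : HasExpansionAtZero P u a) (ha' : HasExpansionAtZero P u a') {M : ℕ}
    (hM : (P.p M).re < (P.p (M + 1)).re) : extendPos P u a M = extendPos P u a' M := by
  have hps : ∀ a : ℕ → ℕ → ℂ, ∀ x : ℝ, partialSumZero P a M x =
      ∑ j ∈ Finset.range (M + 1), a j 0 * (x : ℂ) ^ P.p j := fun a x => by
    simp [partialSumZero, hm]
  have hO : (fun x : ℝ => ∑ j ∈ Finset.range (M + 1), (a j 0 - a' j 0) * (x : ℂ) ^ P.p j)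
      =O[𝓝[>] 0] fun x : ℝ => x ^ (P.p (M + 1)).re := by
    have h1 := (ha' M 0).sub (ha M 0)
    simp only [iteratedDeriv_zero, CharP.cast_eq_zero, sub_zero, logDegree_eq_zero hm, pow_zero,
      mul_one, hps, sub_sub_sub_cancel_left, ← Finset.sum_sub_distrib, ← sub_mul] at h1
    exact h1
  have key := fun {A : Type} [AddCommGroup A] [Module ℂ A] (Φ : ℂ → A) =>
    sum_smul_eq_zero_of_isBigO (Finset.range (M + 1)) P.p (fun j => a j 0 - a' j 0)
      (fun j hj => (P.monotone_re (by have := Finset.mem_range.1 hj; omega : j ≤ M)).trans_lt hM)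
      hO Φ
  have h1 : ∀ x, partialSumZero P a M x = partialSumZero P a' M x := fun x => by
    have := key fun q => (x : ℂ) ^ q
    simp only [smul_eq_mul, sub_mul, Finset.sum_sub_distrib] at this
    rw [hps, hps]
    exact sub_eq_zero.1 this
  have h2 := key fun q => xPosLog q 0
  have h3 : ∀ a : ℕ → ℕ → ℂ, extendPos P u a M =
      ∑ j ∈ Finset.range (M + 1), a j 0 • xPosLog (P.p j) 0 +
        regular (zeroExt fun x => u x - partialSumZero P a M x) := fun a => by
    rw [extendPos_eq, P.sum_idx M fun j k => a j k • xPosLog (P.p j) k]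
    simp only [hm, zero_add, Finset.sum_range_one]
  rw [h3, h3]
  simp only [sub_smul, Finset.sum_sub_distrib] at h2
  rw [sub_eq_zero.1 h2]
  simp only [h1]

end

/-! ### The characterization of Fourier transforms of extensions by zero -/

theorem PowerSet.IsAppropriate.add_one_ne {P : PowerSet} (hP : P.IsAppropriate) (j m : ℕ) :
    P.p j + 1 ≠ -m := fun h =>
  hP.ne_negInt j m (by linear_combination h)

section

variable {P : PowerSet}

theorem IsLowerTransform.isSmoothFunction {a : ℕ → ℕ → ℂ} {h : ℂ → ℂ} {g : ℝ → ℂ}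
    (H : IsLowerTransform P a h g) (σ : ℤˣ) :
    IsSmoothFunction (reflect σ (regular g)) fun ξ => g (((σ : ℤ) : ℝ) * ξ) :=
  ⟨H.contDiff.comp (contDiff_const.mul contDiff_id), H.slowGrowth.comp_sign_mul σ,
    reflect_regular σ H.slowGrowth⟩

theorem exists_boundaryValue_of_mem_spaceH (hP : P.IsAppropriate) {σ : ℤˣ} {H : 𝓢'(ℝ, ℂ)}
    (hH : H ∈ spaceH P σ) : ∃ h : ℂ → ℂ, AnalyticOnNhd ℂ h (halfPlane σ) ∧
      HasBoundaryValue σ h H ∧ PolynomialGrowth σ h ∧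
        ∃ g : ℝ → ℂ, IsSmoothFunction H g ∧
          ∃ c : ℕ → ℕ → ℂ, HasExpansionAtInfinity P σ g c := by
  obtain ⟨u, U, hu, ⟨a, N, ha, hN, rfl⟩, rfl⟩ := hH
  obtain ⟨h, g, hg, hF⟩ := exists_isLowerTransform hP.add_one_ne hu ha hN
  obtain ⟨c, hc⟩ := exists_coeffLink_right hP.add_one_ne σ a
  have hh : (fun ζ => h (((σ : ℤ) : ℂ) * (((σ : ℤ) : ℂ) * ζ))) = h := by
    simp only [sign_mul_sign_mul_complex]
  rw [fourierD_reflect, hF]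
  refine ⟨fun ζ => h (((σ : ℤ) : ℂ) * ζ), ?_, ?_, ?_, _, hg.isSmoothFunction σ, c,
    (hasExpansionAtInfinity_iff hP.add_one_ne hc hg.contDiff).2 hg.symAt⟩
  · rw [analyticOnNhd_halfPlane_iff, hh]
    exact hg.differentiableOn
  · rw [hasBoundaryValue_iff, hh, reflect_reflect]
    exact hg.hasLowerBV
  · rw [polynomialGrowth_iff, hh]
    exact hg.lowerGrowth

theorem mem_spaceH_of_boundaryValue (hP : P.IsAppropriate) {σ : ℤˣ} {H : 𝓢'(ℝ, ℂ)} {h : ℂ → ℂ}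
    {g : ℝ → ℂ} {c : ℕ → ℕ → ℂ} (han : AnalyticOnNhd ℂ h (halfPlane σ))
    (hbv : HasBoundaryValue σ h H) (hgr : PolynomialGrowth σ h) (hg : IsSmoothFunction H g)
    (hc : HasExpansionAtInfinity P σ g c) : H ∈ spaceH P σ := by
  obtain ⟨hgc, hgs, rfl⟩ := hg
  obtain ⟨a, ha⟩ := exists_coeffLink_left hP.add_one_ne σ c
  have hGc : ContDiff ℝ ∞ fun ξ => g (((σ : ℤ) : ℝ) * ξ) :=
    hgc.comp (contDiff_const.mul contDiff_id)
  have hL : IsLowerTransform P a (fun ζ => h (((σ : ℤ) : ℂ) * ζ))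
      fun ξ => g (((σ : ℤ) : ℝ) * ξ) := by
    refine ⟨(analyticOnNhd_halfPlane_iff σ h).1 han, (polynomialGrowth_iff σ h).1 hgr,
      hgs.comp_sign_mul σ, hGc, ?_,
      (hasExpansionAtInfinity_iff hP.add_one_ne ha hGc).1 ?_⟩
    · rw [← reflect_regular σ hgs]
      exact (hasBoundaryValue_iff σ h _).1 hbv
    · simpa only [sign_mul_sign_mul_real] using hc
  obtain ⟨v, hv, hva, N, hN, hF⟩ := hL.exists_memSchwartzP hP.add_one_ne
  have hvv : (fun x : ℝ => v (((σ : ℤ) : ℝ) * (((σ : ℤ) : ℝ) * x))) = v := by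
    simp only [sign_mul_sign_mul_real]
  refine ⟨fun x => v (((σ : ℤ) : ℝ) * x), reflect σ (extendPos P v a N), ?_,
    ⟨a, N, ?_, hN, ?_⟩, ?_⟩
  · rw [hvv]; exact hv
  · rw [hvv]; exact hva
  · rw [hvv]
  · rw [fourierD_reflect, hF, ← reflect_regular σ hgs, reflect_reflect]

theorem exists_expansion_of_forall_m_eq_zero (hP : P.IsAppropriate) (hm : ∀ j, P.m j = 0)
    {σ : ℤˣ} {u : ℝ → ℂ} {U : 𝓢'(ℝ, ℂ)} {a : ℕ → ℕ → ℂ}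
    (hu : MemSchwartzP P fun x => u (((σ : ℤ) : ℝ) * x)) (hU : IsExtension P σ u U)
    (ha : HasExpansionAtZero P (fun x => u (((σ : ℤ) : ℝ) * x)) a) :
    ∃ g : ℝ → ℂ, IsSmoothFunction (fourierD U) g ∧ HasExpansionAtInfinity P σ g fun j _ =>
      a j 0 * (Complex.Gamma (P.p j + 1) / (Real.sqrt (2 * Real.pi) : ℂ) *
        Complex.exp (-((σ : ℤ) * Complex.I * Real.pi * (P.p j + 1) / 2))) := by
  obtain ⟨a', N, ha', hN, rfl⟩ := hU
  -- The extension is defined with `a'`, whereas the formula uses `a`. Raising the cut to a gap does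
  -- not change the extension and allows `a'` to be replaced by `a`.
  obtain ⟨M, hNM, hM⟩ := P.exists_re_lt_succ N
  have hN' : -1 < (P.p (M + 1)).re := hN.trans_le (P.monotone_re (by omega))
  obtain ⟨h, g, hg, hF⟩ := exists_isLowerTransform hP.add_one_ne hu ha hN'
  rw [fourierD_reflect, ← extendPos_of_memSchwartzP hu ha' hN hNM,
    ← extendPos_eq_extendPos hm ha ha' hM, hF]
  exact ⟨_, hg.isSmoothFunction σ, (hasExpansionAtInfinity_iff hP.add_one_ne
    (coeffLink_of_forall_m_eq_zero hm σ a) hg.contDiff).2 hg.symAt⟩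

end

end

end LogPoly

/-! ### The theorem -/

open LogPoly
theorem mainTheorem2 (P : PowerSet) (hP : P.IsAppropriate) (σ : ℤˣ) :
    (∀ H : 𝓢'(ℝ, ℂ), H ∈ spaceH P σ ↔
      ∃ h : ℂ → ℂ, AnalyticOnNhd ℂ h (halfPlane σ) ∧ HasBoundaryValue σ h H ∧
        PolynomialGrowth σ h ∧
        ∃ g : ℝ → ℂ, IsSmoothFunction H g ∧
          ∃ c : ℕ → ℕ → ℂ, HasExpansionAtInfinity P σ g c) ∧
    ((∀ j, P.m j = 0) → ∀ (u : ℝ → ℂ) (U : 𝓢'(ℝ, ℂ)) (a : ℕ → ℕ → ℂ),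
      MemSchwartzP P (fun x => u ((σ : ℤ) * x)) → IsExtension P σ u U →
      HasExpansionAtZero P (fun x => u ((σ : ℤ) * x)) a →
      ∃ g : ℝ → ℂ, IsSmoothFunction (fourierD U) g ∧
        HasExpansionAtInfinity P σ g fun j _ =>
          a j 0 * (Complex.Gamma (P.p j + 1) / (Real.sqrt (2 * Real.pi) : ℂ) *
            Complex.exp (-((σ : ℤ) * Complex.I * Real.pi * (P.p j + 1) / 2)))) ∧
    (∀ (j : ℕ) (ξ : ℝ), ξ ≠ 0 →
      bvPow σ (-P.p j - 1) ξ = posPow (-P.p j - 1) ξ +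
        Complex.exp ((σ : ℤ) * Complex.I * (P.p j + 1) * Real.pi) * negPow (-P.p j - 1) ξ) := by
  refine ⟨fun H => ⟨exists_boundaryValue_of_mem_spaceH hP, ?_⟩, fun hm u U a hu hU ha =>
    exists_expansion_of_forall_m_eq_zero hP hm hu hU ha, fun j ξ hξ => ?_⟩
  · rintro ⟨h, han, hbv, hgr, g, hg, c, hc⟩
    exact mem_spaceH_of_boundaryValue hP han hbv hgr hg hc
  · rw [bvPow_eq σ _ hξ]
    congr 3
    ring
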